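/- Let $\mathbb T=\mathbb R/2\pi\mathbb Z$ and $\alpha\in\mathbb R$. Consider the inviscid Boussinesq equations in vorticity form on $\mathbb T\times\mathbb R$, linearized around $v=(y,0)$, $\theta=\alpha y$, in the coordinates $(x+ty,y)$ moving with the shear: $$\partial_t\omega=\partial_x\theta,\qquad \partial_t\theta=-\alpha v_2,\qquad v=\nabla_t^\perp\Delta_t^{-1}\omega,\qquad t\ge 0,$$ where $\nabla_t^\perp=(-(\partial_y-t\partial_x),\partial_x)$ and $\Delta_t=\partial_x^2+(\partial_y-t\partial_x)^2$. Solutions are paths $\omega,\theta$ in $L^2(\mathbb T\times\mathbb R)$ satisfying the equations with time derivatives taken in $L^2$; for all data $\omega_0\in H^1$, $\theta_0\in H^2$ such a solution exists. Let $\langle f\rangle(y)=\frac1{2\pi}\int_{\mathbb T}f(x,y)\,dx$ and let $H^s$ ($s\in\mathbb R$) be the Sobolev spaces on $\mathbb T\times\mathbb R$. Put $c=\tfrac12\operatorname{Re}\sqrt{1-4\alpha}\in[0,\infty)$, and $\ell(t)=1$ if $\alpha\ne\frac14$, $\ell(t)=1+\log t$ if $\alpha=\frac14$. (1) There is a constant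 $C=C(\alpha)>0$ such that for every solution, every $N\in\mathbb N$ and every $t\ge1$, $$\|\theta-\langle\theta\rangle\|_{H^N}+\|v_1-\langle v_1\rangle\|_{H^N}\le C\,\ell(t)\,t^{-1/2+c}\big(\|\omega_0\|_{H^{N+\max(1,c-1/2)}}+\|\theta_0\|_{H^{N+\max(2,c+1/2)}}\big),$$ $$\|v_2\|_{H^N}\le C\,\ell(t)\,t^{-3/2+c}\big(\|\omega_0\|_{H^{N+\max(2,c-1/2)}}+\|\theta_0\|_{H^{N+\max(3,c+1/2)}}\big).$$ (Thus for $\alpha\ge-2$ the norms on the right are those of $H^{N+1}$, $H^{N+2}$ in the first estimate and $H^{N+2}$, $H^{N+3}$ in the second.) (2) For every $\alpha$ there are real-valued initial data, in $H^s$ for all $s$, with $(\omega_0,\partial_x\theta_0)\neq(0,0)$, and $C>0$, $T\ge1$ such that some solution with these data satisfies, for all $N\in\mathbb N$ and $t\ge T$, $$\|\omega(t)\|_{H^N}\ge C\,t^{1/2+c}\,D_N,\qquad D_N=\|\omega_0\|_{H^N}+\|\partial_x\theta_0\|_{H^N},$$ and also $\|\theta-\langle\theta\rangle\|_{H^N}\ge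 C t^{-1/2+c}D_N$, $\|v_1-\langle v_1\rangle\|_{H^N}\ge C t^{-1/2+c}D_N$ and $\|v_2\|_{H^N}\ge C t^{-3/2+c}D_N$. (3) Moreover $c<\frac12$ if and only if $\alpha>0$, and $c<\frac32$ if and only if $\alpha>-2$. Call a quantity stable in $H^N$ if its $H^N$ norm tends to $0$ as $t\to\infty$ for all solutions with data in the relevant spaces, and unstable if for some real-valued data lying in all $H^s$ its $H^N$ norm is finite at all times but tends to $\infty$ as $t\to\infty$, for every $N\in\mathbb N$. Then for every $N\in\mathbb N$, each of $\theta-\langle\theta\rangle$ and $v_1-\langle v_1\rangle$ (data in $H^{N+1}\times H^{N+2}$) is stable if and only if $\alpha>0$, and $v_2$ (data in $H^{N+2}\times H^{N+3}$) is stable if and only if $\alpha>-2$. The quantities $\theta-\langle\theta\rangle$ and $v_1-\langle v_1\rangle$ are unstable if $\alpha<0$, $v_2$ is unstable if $\alpha<-2$, and $\omega$ is unstable for every $\alpha$. -/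

import Mathlib

open MeasureTheory FourierTransform Filter Topology
open scoped ENNReal

namespace Boussinesq

noncomputable section

instance factTwoPiPos : Fact (0 < 2 * Real.pi) := ⟨Real.two_pi_pos⟩

/-- The torus `𝕋 = ℝ / 2πℤ`. -/
abbrev Torus : Type := AddCircle (2 * Real.pi)

/-- The measure `(dx / 2π) ⊗ dy` on `𝕋 × ℝ`. -/
abbrev cylMeasure : Measure (Torus × ℝ) := (AddCircle.haarAddCircle (T := 2 * Real.pi)).prod volume

/-- The space `L²(𝕋 × ℝ; ℂ)`. -/
abbrev L2 : Type := Lp ℂ 2 cylMeasure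

/-- The `k`-th Fourier coefficient in `x`, as a function of `y`:
`y ↦ (1/2π) ∫_𝕋 f(x, y) e^{-ikx} dx`. -/
def xCoeff (f : L2) (k : ℤ) (y : ℝ) : ℂ :=
  fourierCoeff (fun x : Torus => f (x, y)) k

theorem memLp_xCoeff (f : L2) (k : ℤ) : MemLp (xCoeff f k) 2 (volume : Measure ℝ) := by
  have hf : MemLp f 2 cylMeasure := Lp.memLp f
  have hs : AEStronglyMeasurable (fun z : ℝ × Torus => f (z.2, z.1))
      ((volume : Measure ℝ).prod AddCircle.haarAddCircle) := hf.1.prod_swap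
  have hm : AEStronglyMeasurable
      (fun z : ℝ × Torus => fourier (-k) z.2 • f (z.2, z.1))
      ((volume : Measure ℝ).prod AddCircle.haarAddCircle) :=
    AEStronglyMeasurable.smul
      (((fourier (T := 2 * Real.pi) (-k)).continuous.comp continuous_snd).aestronglyMeasurable) hs
  refine ⟨hm.integral_prod_right', ?_⟩
  have h2 : (2 : ℝ≥0∞) ≠ 0 := two_ne_zero
  have h2' : (2 : ℝ≥0∞) ≠ ∞ := ENNReal.ofNat_ne_top
  rw [eLpNorm_lt_top_iff_lintegral_rpow_enorm_lt_top h2 h2']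
  have hfin := (eLpNorm_lt_top_iff_lintegral_rpow_enorm_lt_top h2 h2').1 hf.2
  refine lt_of_le_of_lt ?_ hfin
  rw [lintegral_prod_symm _ (hf.1.enorm.pow_const _)]
  refine lintegral_mono_ae ?_
  filter_upwards [hs.prodMk_left] with y hy
  have h1 : ‖xCoeff f k y‖ₑ ≤ eLpNorm (fun x : Torus => f (x, y)) 1 AddCircle.haarAddCircle := by
    rw [eLpNorm_one_eq_lintegral_enorm]
    refine (enorm_integral_le_lintegral_enorm _).trans (lintegral_mono fun x => ?_)
    rw [enorm_smul]
    have : ‖fourier (-k) x‖ₑ = 1 := by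
      rw [← ofReal_norm, fourier_apply, Circle.norm_coe, ENNReal.ofReal_one]
    rw [this, one_mul]
  have h3 := h1.trans (eLpNorm_le_eLpNorm_of_exponent_le (p := 1) (q := 2) (by norm_num) hy)
  calc ‖xCoeff f k y‖ₑ ^ (2 : ℝ≥0∞).toReal
      ≤ (eLpNorm (fun x : Torus => f (x, y)) 2 AddCircle.haarAddCircle) ^ (2 : ℝ≥0∞).toReal :=
        ENNReal.rpow_le_rpow h3 (by simp)
    _ = _ := by
        rw [eLpNorm_eq_lintegral_rpow_enorm_toReal h2 h2', ← ENNReal.rpow_mul]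
        simp

/-- The `x`-average `⟨f⟩(y) = (1/2π) ∫_𝕋 f(x, y) dx`, as an element of `L²(𝕋 × ℝ)`. -/
def xMean (f : L2) : L2 :=
  ((memLp_xCoeff f 0).comp_snd (AddCircle.haarAddCircle (T := 2 * Real.pi))).toLp _

/-- The fluctuation `f - ⟨f⟩`. -/
def fluct (f : L2) : L2 := f - xMean f

/-- The Fourier transform on `𝕋 × ℝ`: formally
`FT f k ξ = (1/2π) ∫_𝕋 ∫_ℝ f(x, y) e^{-i(kx + ξy)} dy dx`.
It is the `L²` Fourier transform in `y` of the `k`-th Fourier coefficient in `x`; Mathlib's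
transform uses the character `e^{-2πi y η}`, so it is evaluated at `η = ξ / 2π`.
As a function of `ξ` it is meaningful up to null sets. -/
def FT (f : L2) (k : ℤ) (ξ : ℝ) : ℂ :=
  (𝓕 ((memLp_xCoeff f k).toLp (xCoeff f k)) : Lp ℂ 2 (volume : Measure ℝ)) (ξ / (2 * Real.pi))

/-- The Sobolev norm `‖f‖_{H^s} = (∑_k ∫ (1 + k² + ξ²)^s |FT f k ξ|² dξ)^{1/2}`, which is `∞` if
`f` is not in `H^s`. -/
def sobolevNorm (s : ℝ) (f : L2) : ℝ≥0∞ :=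
  (∑' k : ℤ, ∫⁻ ξ : ℝ, ENNReal.ofReal ((1 + (k : ℝ) ^ 2 + ξ ^ 2) ^ s) * ‖FT f k ξ‖ₑ ^ 2) ^ (1 / 2 : ℝ)

/-- `g = m(D) f` for the Fourier multiplier with symbol `m(k, ξ)`. -/
def IsMultiplier (m : ℤ → ℝ → ℂ) (f g : L2) : Prop :=
  ∀ k : ℤ, ∀ᵐ ξ : ℝ, FT g k ξ = m k ξ * FT f k ξ

/-- The symbol of `∂_x`. -/
def symDx (k : ℤ) (_ξ : ℝ) : ℂ := Complex.I * k

/-- The symbol of `∂_y - t ∂_x`. -/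
def symDy (t : ℝ) (k : ℤ) (ξ : ℝ) : ℂ := Complex.I * (ξ - k * t)

/-- The symbol of `Δ_t = ∂_x² + (∂_y - t ∂_x)²`, namely `-(k² + (ξ - k t)²)`. -/
def symLap (t : ℝ) (k : ℤ) (ξ : ℝ) : ℂ := symDx k ξ ^ 2 + symDy t k ξ ^ 2

/-- A solution on `[0, ∞)` of the inviscid Boussinesq equations in vorticity formulation, linearized
around `v = (y, 0)`, `θ = α y`, in the coordinates moving with the shear:
`∂_t ω = ∂_x θ`, `∂_t θ = - α v₂`, `v = ∇_t^⊥ Δ_t⁻¹ ω` with `∇_t^⊥ = (-(∂_y - t ∂_x), ∂_x)`.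
The time derivatives are taken in `L²(𝕋 × ℝ)`. The field `w₁` is the fluctuation `v₁ - ⟨v₁⟩` of the
horizontal velocity (the average `⟨v₁⟩`, which does not enter the equations, need not be
in `L²`); the vertical velocity `v₂` has zero `x`-average. -/
structure IsSolution (α : ℝ) (ω θ w₁ v₂ : ℝ → L2) : Prop where
  vorticity : ∀ t, 0 ≤ t → ∃ q : L2, IsMultiplier symDx (θ t) q ∧
    HasDerivWithinAt ω q (Set.Ici 0) t
  temperature : ∀ t, 0 ≤ t → HasDerivWithinAt θ (-(α : ℂ) • v₂ t) (Set.Ici 0) t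
  biotSavart₁ : ∀ t, 0 ≤ t →
    IsMultiplier (fun k ξ => -symDy t k ξ / symLap t k ξ) (fluct (ω t)) (w₁ t)
  biotSavart₂ : ∀ t, 0 ≤ t →
    IsMultiplier (fun k ξ => symDx k ξ / symLap t k ξ) (ω t) (v₂ t)

/-- The field is real valued. -/
def IsReal (f : L2) : Prop := ∀ᵐ p ∂cylMeasure, (f p).im = 0

/-- The field belongs to `H^s` for every `s`. -/
def IsSmooth (f : L2) : Prop := ∀ s : ℝ, sobolevNorm s f < ∞

/-- `c = ½ Re √(1 - 4α)`. -/
def rate (α : ℝ) : ℝ := 1 / 2 * ((1 - 4 * (α : ℂ)) ^ (1 / 2 : ℂ)).re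

/-- The factor `1 + log t` for `α = 1/4` (double characteristic exponent), and `1` otherwise. -/
def logFactor (α t : ℝ) : ℝ := if α = 1 / 4 then 1 + Real.log t else 1

/-- The quantity `X` attached to a solution (one of `θ - ⟨θ⟩`, `v₁ - ⟨v₁⟩`, `v₂`) is asymptotically
stable in `H^N`, for data `ω₀ ∈ H^a`, `θ₀ ∈ H^b`: its `H^N` norm tends to `0` as `t → ∞`. -/
def Stable (α : ℝ) (X : (ω θ w₁ v₂ : ℝ → L2) → ℝ → L2) (N : ℕ) (a b : ℝ) : Prop :=
  ∀ ω θ w₁ v₂ : ℝ → L2, IsSolution α ω θ w₁ v₂ →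
    sobolevNorm a (ω 0) < ∞ → sobolevNorm b (θ 0) < ∞ →
    Tendsto (fun t => sobolevNorm N (X ω θ w₁ v₂ t)) atTop (𝓝 0)

/-- The quantity `X` is unstable: for some real-valued initial data, smooth in the Sobolev sense,
its `H^N` norm is finite at all times but tends to `∞` as `t → ∞`, for every `N`. -/
def Unstable (α : ℝ) (X : (ω θ w₁ v₂ : ℝ → L2) → ℝ → L2) : Prop :=
  ∃ ω θ w₁ v₂ : ℝ → L2, IsSolution α ω θ w₁ v₂ ∧
    IsReal (ω 0) ∧ IsReal (θ 0) ∧ IsSmooth (ω 0) ∧ IsSmooth (θ 0) ∧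
    ∀ N : ℕ, (∀ t, 0 ≤ t → sobolevNorm N (X ω θ w₁ v₂ t) < ∞) ∧
      Tendsto (fun t => sobolevNorm N (X ω θ w₁ v₂ t)) atTop (𝓝 ∞)

/-- `θ - ⟨θ⟩`. -/
def tempFluct (_ω θ _w₁ _v₂ : ℝ → L2) (t : ℝ) : L2 := fluct (θ t)

/-- `v₁ - ⟨v₁⟩`. -/
def horVelFluct (_ω _θ w₁ _v₂ : ℝ → L2) (t : ℝ) : L2 := w₁ t

/-- `v₂`. -/
def vertVel (_ω _θ _w₁ v₂ : ℝ → L2) (t : ℝ) : L2 := v₂ t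

/-- `ω`. -/
def vort (ω _θ _w₁ _v₂ : ℝ → L2) (t : ℝ) : L2 := ω t

end

end Boussinesq

namespace Boussinesq

noncomputable section

/-! The system decouples over the frequencies `(k, ξ)`. For `k ≠ 0`, put `s = t - ξ/k`, let `u(s)`
be the transform of `ω` and `v(s)` that of `∂_x θ`. Then `u' = v` and `v' = -α u / (1 + s²)`: one
scalar equation for all frequencies, which only differ in the starting point `-ξ/k`. At infinity the
characteristic exponents satisfy `p² - p + α = 0`, so their real parts are `1/2 ± c`, and a
logarithm appears at the double root `α = 1/4`. Hence `u` grows at most like `s^(1/2+c)` and `v`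
like `s^(-1/2+c)`, up to that logarithm, while the Biot–Savart law divides `u` by about `⟨s⟩` for
`v₁` and by about `⟨s⟩²` for `v₂`. This explains the three rates.

Upper bounds. In the variable `τ = arsinh s` the equation is a constant-coefficient system up to an
integrable error. A quadratic form adapted to the limit system gives two-sided exponential control
(`exists_energy`, `exists_growth`). Gluing at `s = 0` (`exists_propagation`) and trading powers of
`⟨s⟩` at the starting point for powers of `t` (`exists_decay_bound`) gives a bound uniform in the
frequency. Since `|k| ⟨ξ/k⟩ ≤ (1 + k² + ξ²)^(1/2)`, the powers of `⟨ξ/k⟩` are exactly the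
derivatives lost.

Lower bounds. The data live at `k = ±1` with starting points in `[1, 3]`, so no mode crosses `s = 0`
and all start on a growing solution (`exists_lower_bound`). For `α ≤ 1/4` a monotone quantity
compares `u` with an exact power. For `α > 1/4` the Wronskian of `u` and its conjugate forces `|u|
|v| ≥ 1`, and the upper bounds on each factor turn into lower bounds on the other.

Return to `L²`. Solutions are synthesized frequency by frequency (`exists_isSolution`); by
`IsSolution.unique` every solution arises this way, so the mode analysis applies to all of them
(`IsSolution.hasModes`). The stability thresholds are then the signs of `c - 1/2` and `c - 3/2`. -/

/-! ### Plancherel's theorem on the cylinder. -/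

theorem eLpNorm_two_sq {X E : Type*} [MeasurableSpace X] [NormedAddCommGroup E] (μ : Measure X)
    (f : X → E) : eLpNorm f 2 μ ^ 2 = ∫⁻ x, ‖f x‖ₑ ^ 2 ∂μ := by
  have h := eLpNorm_nnreal_pow_eq_lintegral (f := f) (μ := μ) (p := 2) (by norm_num)
  simpa using h

theorem memLp_slice (f : L2) :
    ∀ᵐ y : ℝ, MemLp (fun x : Torus => f (x, y)) 2 AddCircle.haarAddCircle := by
  have hf : MemLp f 2 cylMeasure := Lp.memLp f
  have hs : AEStronglyMeasurable (fun z : ℝ × Torus => f (z.2, z.1))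
      ((volume : Measure ℝ).prod AddCircle.haarAddCircle) := hf.1.prod_swap
  have hfin : ∫⁻ z, ‖f z‖ₑ ^ 2 ∂cylMeasure < ∞ := by
    rw [← eLpNorm_two_sq]; exact ENNReal.pow_lt_top hf.2
  rw [lintegral_prod_symm _ (hf.1.enorm.pow_const _)] at hfin
  have h1 : AEMeasurable (fun z : ℝ × Torus => ‖f (z.2, z.1)‖ₑ ^ 2)
      ((volume : Measure ℝ).prod AddCircle.haarAddCircle) := hs.enorm.pow_const _
  filter_upwards [hs.prodMk_left, ae_lt_top' h1.lintegral_prod_right' hfin.ne] with y hy hy2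
  refine ⟨hy, ?_⟩
  rw [← eLpNorm_two_sq] at hy2
  exact (ENNReal.pow_lt_top_iff.1 hy2).resolve_right (by norm_num)

theorem tsum_enorm_sq_fourierCoeff {g : Torus → ℂ} (hg : MemLp g 2 AddCircle.haarAddCircle) :
    ∑' k : ℤ, ‖fourierCoeff g k‖ₑ ^ 2 = ∫⁻ x, ‖g x‖ₑ ^ 2 ∂AddCircle.haarAddCircle := by
  have h := hasSum_sq_fourierCoeff (hg.toLp g)
  have h1 : ∀ k : ℤ, fourierCoeff (hg.toLp g) k = fourierCoeff g k := fun k =>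
    congrFun (fourierCoeff_congr_ae hg.coeFn_toLp) k
  simp_rw [h1] at h
  have h2 : ∑' k : ℤ, ‖fourierCoeff g k‖ₑ ^ 2
      = ENNReal.ofReal (∑' k : ℤ, ‖fourierCoeff g k‖ ^ 2) := by
    rw [ENNReal.ofReal_tsum_of_nonneg (fun k => by positivity) h.summable]
    refine tsum_congr fun k => ?_
    rw [ENNReal.ofReal_pow (norm_nonneg _), ofReal_norm]
  rw [h2, h.tsum_eq, ofReal_integral_eq_lintegral_ofReal]
  · refine lintegral_congr_ae ?_
    filter_upwards [hg.coeFn_toLp] with x hx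
    rw [hx, ENNReal.ofReal_pow (norm_nonneg _), ofReal_norm]
  · exact (Lp.memLp (hg.toLp g)).integrable_norm_pow (by norm_num)
  · exact ae_of_all _ fun x => by positivity

/-- Parseval in `x` on almost every slice, combined with Tonelli in `y`. -/
theorem tsum_enorm_sq_xCoeff (f : L2) :
    ∑' k : ℤ, ∫⁻ y, ‖xCoeff f k y‖ₑ ^ 2 = ‖f‖ₑ ^ 2 := by
  rw [← lintegral_tsum fun k => ((memLp_xCoeff f k).1.enorm.pow_const 2), Lp.enorm_def,
    eLpNorm_two_sq, lintegral_prod_symm _ ((Lp.memLp f).1.enorm.pow_const _)]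
  refine lintegral_congr_ae ?_
  filter_upwards [memLp_slice f] with y hy
  exact tsum_enorm_sq_fourierCoeff hy

theorem ae_slice_of_ae {P : Torus × ℝ → Prop} (h : ∀ᵐ z ∂cylMeasure, P z) :
    ∀ᵐ y : ℝ, ∀ᵐ x ∂(AddCircle.haarAddCircle (T := 2 * Real.pi)), P (x, y) := by
  have h2 := (Measure.measurePreserving_swap (μ := (volume : Measure ℝ))
    (ν := AddCircle.haarAddCircle (T := 2 * Real.pi))).quasiMeasurePreserving.ae h
  exact Measure.ae_ae_of_ae_prod h2

theorem xCoeff_add (f g : L2) (k : ℤ) : xCoeff (f + g) k =ᵐ[volume] xCoeff f k + xCoeff g k := by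
  filter_upwards [memLp_slice f, memLp_slice g, ae_slice_of_ae (Lp.coeFn_add f g)] with y hf hg h
  rw [xCoeff, congrFun (fourierCoeff_congr_ae h) k]
  exact congrFun (fourierCoeff.add (hf.integrable (by norm_num)) (hg.integrable (by norm_num))) k

theorem xCoeff_smul (c : ℂ) (f : L2) (k : ℤ) : xCoeff (c • f) k =ᵐ[volume] c • xCoeff f k := by
  filter_upwards [ae_slice_of_ae (Lp.coeFn_smul c f)] with y h
  rw [xCoeff, congrFun (fourierCoeff_congr_ae h) k, Pi.smul_apply, xCoeff,
    ← fourierCoeff.const_smul]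
  rfl

/-- The `k`-th Fourier coefficient in `x` as a bounded linear map into `L²(ℝ)`. -/
def xCoeffL (k : ℤ) : L2 →L[ℂ] Lp ℂ 2 (volume : Measure ℝ) :=
  LinearMap.mkContinuous
    { toFun := fun f => (memLp_xCoeff f k).toLp (xCoeff f k)
      map_add' := fun f g => by
        rw [← MemLp.toLp_add, MemLp.toLp_eq_toLp_iff]; exact xCoeff_add f g k
      map_smul' := fun c f => by
        rw [RingHom.id_apply, ← MemLp.toLp_const_smul, MemLp.toLp_eq_toLp_iff]
        exact xCoeff_smul c f k } 1 (fun f => by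
      have h : ‖(memLp_xCoeff f k).toLp (xCoeff f k)‖ₑ ^ 2 ≤ ‖f‖ₑ ^ 2 := by
        rw [Lp.enorm_toLp, eLpNorm_two_sq, ← tsum_enorm_sq_xCoeff]
        exact ENNReal.le_tsum k
      have h2 := (ENNReal.pow_le_pow_left_iff two_ne_zero).1 h
      simpa using enorm_le_iff_norm_le.1 h2)

/-- The Fourier transform `f ↦ FT f k` as a bounded linear map into `L²(ℝ)`, in the frequency
variable of Mathlib's Fourier transform. -/
def coef (k : ℤ) : L2 →L[ℂ] Lp ℂ 2 (volume : Measure ℝ) :=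
  (Lp.fourierTransformₗᵢ ℝ ℂ).toContinuousLinearEquiv.toContinuousLinearMap ∘L xCoeffL k

theorem FT_eq_coef (f : L2) (k : ℤ) (ξ : ℝ) : FT f k ξ = coef k f (ξ / (2 * Real.pi)) := rfl

theorem enorm_coef (f : L2) (k : ℤ) : ‖coef k f‖ₑ ^ 2 = ∫⁻ y, ‖xCoeff f k y‖ₑ ^ 2 := by
  have h : ‖coef k f‖ₑ = ‖xCoeffL k f‖ₑ :=
    enorm_eq_iff_norm_eq.2 ((Lp.fourierTransformₗᵢ ℝ ℂ).norm_map _)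
  rw [h, ← eLpNorm_two_sq]
  exact congrArg (· ^ 2) (Lp.enorm_toLp (hf := memLp_xCoeff f k))

theorem tsum_enorm_sq_coef (f : L2) : ∑' k : ℤ, ‖coef k f‖ₑ ^ 2 = ‖f‖ₑ ^ 2 := by
  simp_rw [enorm_coef]; exact tsum_enorm_sq_xCoeff f

theorem eq_of_coef_eq {f g : L2} (h : ∀ k, coef k f = coef k g) : f = g := by
  have h1 := tsum_enorm_sq_coef (f - g)
  simp only [map_sub, h, sub_self, enorm_zero] at h1
  simpa [sub_eq_zero] using h1.symm

theorem lintegral_comp_div_two_pi (F : ℝ → ℝ≥0∞) :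
    ∫⁻ ξ, F (ξ / (2 * Real.pi)) = ENNReal.ofReal (2 * Real.pi) * ∫⁻ η, F η := by
  have hp : (2 * Real.pi)⁻¹ ≠ 0 := by positivity
  have h := lintegral_map_equiv (μ := volume) F (Homeomorph.mulRight₀ _ hp).toMeasurableEquiv
  have h2 := Real.map_volume_mul_right hp
  simp only [Homeomorph.toMeasurableEquiv_coe, Homeomorph.coe_mulRight₀] at h
  rw [h2, lintegral_smul_measure] at h
  simp_rw [div_eq_mul_inv]
  rw [← h, inv_inv, abs_of_pos Real.two_pi_pos, smul_eq_mul]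

theorem ae_comp_div_two_pi {P : ℝ → Prop} :
    (∀ᵐ ξ : ℝ, P (ξ / (2 * Real.pi))) ↔ ∀ᵐ η : ℝ, P η := by
  have hp : (2 * Real.pi)⁻¹ ≠ 0 := by positivity
  have h1 : ∀ c : ℝ, c ≠ 0 → ∀ {Q : ℝ → Prop}, (∀ᵐ η : ℝ, Q η) → ∀ᵐ ξ : ℝ, Q (ξ * c) := by
    intro c hc Q hQ
    have : Measure.QuasiMeasurePreserving (fun x : ℝ => x * c) volume volume := by
      refine ⟨by fun_prop, ?_⟩
      rw [Real.map_volume_mul_right hc]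
      exact Measure.smul_absolutelyContinuous
    exact this.ae hQ
  simp_rw [div_eq_mul_inv]
  refine ⟨fun h => ?_, fun h => h1 _ hp h⟩
  filter_upwards [h1 (2 * Real.pi) (by positivity) h] with x hx
  rwa [mul_assoc, mul_inv_cancel₀ (by positivity), mul_one] at hx

theorem lintegral_enorm_sq_FT (f : L2) (k : ℤ) :
    ∫⁻ ξ, ‖FT f k ξ‖ₑ ^ 2 = ENNReal.ofReal (2 * Real.pi) * ‖coef k f‖ₑ ^ 2 := by
  rw [Lp.enorm_def, eLpNorm_two_sq, ← lintegral_comp_div_two_pi]; rfl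

theorem tsum_lintegral_enorm_sq_FT (f : L2) :
    ∑' k : ℤ, ∫⁻ ξ, ‖FT f k ξ‖ₑ ^ 2 = ENNReal.ofReal (2 * Real.pi) * ‖f‖ₑ ^ 2 := by
  simp_rw [lintegral_enorm_sq_FT, ENNReal.tsum_mul_left, tsum_enorm_sq_coef]

theorem aestronglyMeasurable_FT (f : L2) (k : ℤ) : AEStronglyMeasurable (FT f k) volume := by
  have : Measure.QuasiMeasurePreserving (fun x : ℝ => x / (2 * Real.pi)) volume volume :=
    ⟨by fun_prop, Measure.AbsolutelyContinuous.mk fun s hs h => by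
      rw [Measure.map_apply (by fun_prop) hs]
      have := (ae_comp_div_two_pi (P := fun x => x ∉ s)).2 (measure_eq_zero_iff_ae_notMem.1 h)
      exact measure_eq_zero_iff_ae_notMem.2 this⟩
  exact (Lp.memLp (coef k f)).1.comp_quasiMeasurePreserving this

theorem FT_add (f g : L2) (k : ℤ) : ∀ᵐ ξ : ℝ, FT (f + g) k ξ = FT f k ξ + FT g k ξ := by
  simp_rw [FT_eq_coef, map_add]
  exact (ae_comp_div_two_pi (P := fun η => (coef k f + coef k g : Lp ℂ 2 volume) η =
    coef k f η + coef k g η)).2 (Lp.coeFn_add _ _)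

theorem FT_sub (f g : L2) (k : ℤ) : ∀ᵐ ξ : ℝ, FT (f - g) k ξ = FT f k ξ - FT g k ξ := by
  simp_rw [FT_eq_coef, map_sub]
  exact (ae_comp_div_two_pi (P := fun η => (coef k f - coef k g : Lp ℂ 2 volume) η =
    coef k f η - coef k g η)).2 (Lp.coeFn_sub _ _)

theorem FT_smul (c : ℂ) (f : L2) (k : ℤ) : ∀ᵐ ξ : ℝ, FT (c • f) k ξ = c * FT f k ξ := by
  simp_rw [FT_eq_coef, map_smul]
  exact (ae_comp_div_two_pi (P := fun η => (c • coef k f : Lp ℂ 2 volume) η =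
    c * coef k f η)).2 (Lp.coeFn_smul _ _)

theorem eq_of_FT_ae_eq {f g : L2} (h : ∀ k, ∀ᵐ ξ : ℝ, FT f k ξ = FT g k ξ) : f = g :=
  eq_of_coef_eq fun k => Lp.ext ((ae_comp_div_two_pi (P := fun η => coef k f η = coef k g η)).1 (h k))

/-! ### Single Fourier modes and surjectivity of the transform. -/

theorem memLp_mode (k : ℤ) {H : ℝ → ℂ} (hH : MemLp H 2 volume) :
    MemLp (fun z : Torus × ℝ => fourier k z.1 * H z.2) 2 cylMeasure := by
  have h := hH.comp_snd (AddCircle.haarAddCircle (T := 2 * Real.pi))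
  refine h.of_le ?_ (ae_of_all _ fun z => ?_)
  · exact ((fourier (T := 2 * Real.pi) k).continuous.comp continuous_fst).aestronglyMeasurable.mul
      h.1
  · rw [norm_mul, fourier_apply, Circle.norm_coe, one_mul]

/-- The function `(x, y) ↦ e^{ikx} H(y)`. -/
def mode (k : ℤ) (H : Lp ℂ 2 (volume : Measure ℝ)) : L2 := (memLp_mode k (Lp.memLp H)).toLp _

theorem xCoeff_mode (k j : ℤ) (H : Lp ℂ 2 (volume : Measure ℝ)) :
    xCoeff (mode k H) j =ᵐ[volume] if j = k then ⇑H else 0 := by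
  filter_upwards [ae_slice_of_ae (memLp_mode k (Lp.memLp H)).coeFn_toLp] with y h
  rw [xCoeff, mode, congrFun (fourierCoeff_congr_ae h) j]
  simp_rw [mul_comm _ (H y)]
  rw [fourierCoeff.const_mul, fourierCoeff_fourier]
  split_ifs with hjk
  · simp [hjk]
  · simp [hjk]

theorem xCoeffL_mode (k j : ℤ) (H : Lp ℂ 2 (volume : Measure ℝ)) :
    xCoeffL j (mode k H) = if j = k then H else 0 := by
  refine Lp.ext ((memLp_xCoeff _ j).coeFn_toLp.trans ((xCoeff_mode k j H).trans ?_))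
  split_ifs
  · rfl
  · exact (Lp.coeFn_zero _ _ _).symm

theorem coef_mode (k j : ℤ) (H : Lp ℂ 2 (volume : Measure ℝ)) :
    coef j (mode k H) = if j = k then 𝓕 H else 0 := by
  change (Lp.fourierTransformₗᵢ ℝ ℂ) (xCoeffL j (mode k H)) = _
  rw [xCoeffL_mode]
  split_ifs
  · rfl
  · exact map_zero _

theorem enorm_sum_mode (H : ℤ → Lp ℂ 2 (volume : Measure ℝ)) (t : Finset ℤ) :
    ‖∑ k ∈ t, mode k (H k)‖ₑ ^ 2 = ∑ k ∈ t, ‖𝓕 (H k)‖ₑ ^ 2 := by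
  classical
  rw [← tsum_enorm_sq_coef, tsum_eq_sum (s := t)]
  · refine Finset.sum_congr rfl fun j hj => ?_
    simp_rw [map_sum, coef_mode, Finset.sum_ite_eq, if_pos hj]
  · intro j hj
    simp_rw [map_sum, coef_mode, Finset.sum_ite_eq, if_neg hj]
    simp

/-- Riesz–Fischer: distinct modes are orthogonal, so square summability makes the series of modes
Cauchy. -/
theorem exists_coef_eq (h : ℤ → Lp ℂ 2 (volume : Measure ℝ)) (hh : ∑' k, ‖h k‖ₑ ^ 2 ≠ ∞) :
    ∃ f : L2, ∀ k, coef k f = h k := by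
  have hsum : Summable fun k => mode k (𝓕⁻ (h k)) := by
    rw [summable_iff_vanishing_norm]
    intro ε hε
    have hs : Summable fun k => ‖h k‖ ^ 2 := by
      have := ENNReal.summable_toReal hh
      simpa using this
    obtain ⟨s, hs⟩ := summable_iff_vanishing_norm.1 hs (ε ^ 2) (by positivity)
    refine ⟨s, fun t ht => ?_⟩
    have h1 := hs t ht
    have h2 := enorm_sum_mode (fun k => 𝓕⁻ (h k)) t
    have h3 := congrArg ENNReal.toReal h2
    rw [ENNReal.toReal_sum fun _ _ => ENNReal.pow_ne_top enorm_ne_top] at h3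
    simp only [fourier_fourierInv_eq, ENNReal.toReal_pow, toReal_enorm] at h3
    rw [← h3, Real.norm_of_nonneg (by positivity)] at h1
    exact lt_of_pow_lt_pow_left₀ 2 hε.le h1
  refine ⟨∑' k, mode k (𝓕⁻ (h k)), fun j => ?_⟩
  rw [(coef j).map_tsum hsum]
  simp_rw [coef_mode, tsum_ite_eq', fourier_fourierInv_eq]

theorem exists_FT_eq (F : ℤ → ℝ → ℂ) (hF : ∀ k, AEStronglyMeasurable (F k) volume)
    (hfin : ∑' k, ∫⁻ ξ, ‖F k ξ‖ₑ ^ 2 ≠ ∞) : ∃ f : L2, ∀ k, ∀ᵐ ξ : ℝ, FT f k ξ = F k ξ := by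
  have hp : (2 * Real.pi) ≠ 0 := by positivity
  have hint : ∀ k, ∫⁻ ξ, ‖F k ξ‖ₑ ^ 2
      = ENNReal.ofReal (2 * Real.pi) * ∫⁻ η, ‖F k (η * (2 * Real.pi))‖ₑ ^ 2 := by
    intro k
    rw [← lintegral_comp_div_two_pi]
    simp_rw [div_mul_cancel₀ _ hp]
  have hmeas : ∀ k, AEStronglyMeasurable (fun η => F k (η * (2 * Real.pi))) volume := by
    intro k
    refine (hF k).comp_quasiMeasurePreserving ⟨by fun_prop, ?_⟩
    rw [Real.map_volume_mul_right hp]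
    exact Measure.smul_absolutelyContinuous
  simp_rw [hint, ENNReal.tsum_mul_left] at hfin
  have hfin' : ∑' k, ∫⁻ η, ‖F k (η * (2 * Real.pi))‖ₑ ^ 2 ≠ ∞ := fun h => by
    rw [h, ENNReal.mul_top (by simp [Real.pi_pos])] at hfin
    exact hfin rfl
  have hmem : ∀ k, MemLp (fun η => F k (η * (2 * Real.pi))) 2 volume := by
    refine fun k => ⟨hmeas k, ?_⟩
    have h := ENNReal.ne_top_of_tsum_ne_top hfin' k
    rw [← eLpNorm_two_sq] at h
    exact (ENNReal.pow_lt_top_iff.1 h.lt_top).resolve_right (by norm_num)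
  obtain ⟨f, hf⟩ := exists_coef_eq (fun k => (hmem k).toLp _) (by
    simp_rw [Lp.enorm_toLp, eLpNorm_two_sq]; exact hfin')
  refine ⟨f, fun k => ?_⟩
  have h1 : ∀ᵐ η : ℝ, coef k f η = F k (η * (2 * Real.pi)) := by
    rw [hf k]; exact (hmem k).coeFn_toLp
  filter_upwards [ae_comp_div_two_pi.2 h1] with ξ hξ
  rw [FT_eq_coef, hξ, div_mul_cancel₀ _ hp]

/-! ### Averages and fluctuations on the Fourier side. -/

theorem xMean_eq_mode (f : L2) : xMean f = mode 0 (xCoeffL 0 f) := by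
  refine Lp.ext ?_
  refine (MemLp.coeFn_toLp _).trans (EventuallyEq.trans ?_ (MemLp.coeFn_toLp _).symm)
  have h : ∀ᵐ y : ℝ, xCoeffL 0 f y = xCoeff f 0 y := (memLp_xCoeff f 0).coeFn_toLp
  have h2 := (Measure.quasiMeasurePreserving_snd
    (μ := AddCircle.haarAddCircle (T := 2 * Real.pi)) (ν := (volume : Measure ℝ))).ae h
  filter_upwards [h2] with z hz
  simp [hz]

theorem coef_fluct (f : L2) (k : ℤ) : coef k (fluct f) = if k = 0 then 0 else coef k f := by
  rw [fluct, map_sub, xMean_eq_mode, coef_mode]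
  split_ifs with h
  · rw [h, sub_eq_zero]; rfl
  · rw [sub_zero]

theorem FT_fluct_of_ne (f : L2) {k : ℤ} (hk : k ≠ 0) (ξ : ℝ) : FT (fluct f) k ξ = FT f k ξ := by
  rw [FT_eq_coef, FT_eq_coef, coef_fluct, if_neg hk]

theorem FT_fluct_zero (f : L2) : ∀ᵐ ξ : ℝ, FT (fluct f) 0 ξ = 0 := by
  simp_rw [FT_eq_coef, coef_fluct, if_true]
  exact (ae_comp_div_two_pi (P := fun η => (0 : Lp ℂ 2 (volume : Measure ℝ)) η = 0)).2
    (Lp.coeFn_zero _ _ _)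

/-! ### Sobolev norms and pointwise comparison of transforms. -/

theorem sobolevNorm_le_mul (s a : ℝ) {f g : L2} {c : ℝ} (hc : 0 ≤ c)
    (h : ∀ k : ℤ, ∀ᵐ ξ : ℝ, ‖FT f k ξ‖ ≤ c * ((1 + (k : ℝ) ^ 2 + ξ ^ 2) ^ (a / 2) * ‖FT g k ξ‖)) :
    sobolevNorm s f ≤ ENNReal.ofReal c * sobolevNorm (s + a) g := by
  have key : ∑' k : ℤ, ∫⁻ ξ : ℝ, ENNReal.ofReal ((1 + (k : ℝ) ^ 2 + ξ ^ 2) ^ s) * ‖FT f k ξ‖ₑ ^ 2 ≤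
      ENNReal.ofReal c ^ 2 * ∑' k : ℤ, ∫⁻ ξ : ℝ,
        ENNReal.ofReal ((1 + (k : ℝ) ^ 2 + ξ ^ 2) ^ (s + a)) * ‖FT g k ξ‖ₑ ^ 2 := by
    rw [← ENNReal.tsum_mul_left]
    refine ENNReal.tsum_le_tsum fun k => ?_
    rw [← lintegral_const_mul' _ _ (by finiteness)]
    refine lintegral_mono_ae ?_
    filter_upwards [h k] with ξ hξ
    have hJ : 0 < 1 + (k : ℝ) ^ 2 + ξ ^ 2 := by positivity
    rw [← ofReal_norm, ← ofReal_norm, ← ENNReal.ofReal_pow (norm_nonneg _),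
      ← ENNReal.ofReal_pow (norm_nonneg _), ← ENNReal.ofReal_pow hc,
      ← ENNReal.ofReal_mul (by positivity), ← ENNReal.ofReal_mul (by positivity),
      ← ENNReal.ofReal_mul (by positivity)]
    refine ENNReal.ofReal_le_ofReal ?_
    have h2 := pow_le_pow_left₀ (norm_nonneg _) hξ 2
    calc _ ≤ (1 + (k : ℝ) ^ 2 + ξ ^ 2) ^ s *
          (c * ((1 + (k : ℝ) ^ 2 + ξ ^ 2) ^ (a / 2) * ‖FT g k ξ‖)) ^ 2 := by gcongr
      _ = _ := by
        rw [mul_pow, mul_pow, ← Real.rpow_natCast (_ ^ (a / 2)) 2,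
          ← Real.rpow_mul hJ.le, Real.rpow_add hJ]
        norm_num
        ring
  calc sobolevNorm s f ≤ _ := ENNReal.rpow_le_rpow key (by norm_num)
    _ = _ := by
      rw [ENNReal.mul_rpow_of_nonneg _ _ (by norm_num), ← ENNReal.rpow_natCast, ← ENNReal.rpow_mul]
      norm_num
      rfl

/-- The bridge from mode estimates to Sobolev estimates: a power `a/2` of `1 + k² + ξ²` costs `a`
derivatives. The factor `2` absorbs the square of a sum; the square root of the total is then
subadditive. -/
theorem sobolevNorm_le_add (s a b : ℝ) {f g h : L2} {c : ℝ} (hc : 0 ≤ c)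
    (H : ∀ k : ℤ, ∀ᵐ ξ : ℝ, ‖FT f k ξ‖ ≤ c * ((1 + (k : ℝ) ^ 2 + ξ ^ 2) ^ (a / 2) * ‖FT g k ξ‖ +
      (1 + (k : ℝ) ^ 2 + ξ ^ 2) ^ (b / 2) * ‖FT h k ξ‖)) :
    sobolevNorm s f ≤ ENNReal.ofReal (2 * c) * (sobolevNorm (s + a) g + sobolevNorm (s + b) h) := by
  set A : ℤ → ℝ → ℝ≥0∞ := fun k ξ =>
    ENNReal.ofReal ((1 + (k : ℝ) ^ 2 + ξ ^ 2) ^ (s + a)) * ‖FT g k ξ‖ₑ ^ 2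
  set B : ℤ → ℝ → ℝ≥0∞ := fun k ξ =>
    ENNReal.ofReal ((1 + (k : ℝ) ^ 2 + ξ ^ 2) ^ (s + b)) * ‖FT h k ξ‖ₑ ^ 2
  have hA : ∀ k, AEMeasurable (A k) volume := fun k =>
    (ENNReal.measurable_ofReal.comp (by fun_prop)).aemeasurable.mul
      ((aestronglyMeasurable_FT g k).enorm.pow_const 2)
  have key : ∑' k : ℤ, ∫⁻ ξ : ℝ, ENNReal.ofReal ((1 + (k : ℝ) ^ 2 + ξ ^ 2) ^ s) * ‖FT f k ξ‖ₑ ^ 2 ≤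
      ENNReal.ofReal (2 * c) ^ 2 * ((∑' k : ℤ, ∫⁻ ξ : ℝ, A k ξ) + ∑' k : ℤ, ∫⁻ ξ : ℝ, B k ξ) := by
    rw [← ENNReal.tsum_add, ← ENNReal.tsum_mul_left]
    refine ENNReal.tsum_le_tsum fun k => ?_
    rw [← lintegral_add_left' (hA k), ← lintegral_const_mul' _ _ (by finiteness)]
    refine lintegral_mono_ae ?_
    filter_upwards [H k] with ξ hξ
    have hJ : 0 < 1 + (k : ℝ) ^ 2 + ξ ^ 2 := by positivity
    simp only [A, B]
    rw [← ofReal_norm, ← ofReal_norm, ← ofReal_norm, ← ENNReal.ofReal_pow (norm_nonneg _),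
      ← ENNReal.ofReal_pow (norm_nonneg _), ← ENNReal.ofReal_pow (norm_nonneg _),
      ← ENNReal.ofReal_pow (by positivity),
      ← ENNReal.ofReal_mul (by positivity), ← ENNReal.ofReal_mul (by positivity),
      ← ENNReal.ofReal_mul (by positivity), ← ENNReal.ofReal_add (by positivity) (by positivity),
      ← ENNReal.ofReal_mul (by positivity)]
    refine ENNReal.ofReal_le_ofReal ?_
    have h2 := pow_le_pow_left₀ (norm_nonneg _) hξ 2
    have e : ∀ r : ℝ, (1 + (k : ℝ) ^ 2 + ξ ^ 2) ^ r = ((1 + (k : ℝ) ^ 2 + ξ ^ 2) ^ (r / 2)) ^ 2 := by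
      intro r
      rw [← Real.rpow_natCast (_ ^ (r / 2)) 2, ← Real.rpow_mul hJ.le]; norm_num
    rw [Real.rpow_add hJ, Real.rpow_add hJ, e a, e b]
    have h3 : (0 : ℝ) ≤ (1 + (k : ℝ) ^ 2 + ξ ^ 2) ^ s := by positivity
    set X := (1 + (k : ℝ) ^ 2 + ξ ^ 2) ^ (a / 2)
    set Y := (1 + (k : ℝ) ^ 2 + ξ ^ 2) ^ (b / 2)
    calc _ ≤ (1 + (k : ℝ) ^ 2 + ξ ^ 2) ^ s * (c * (X * ‖FT g k ξ‖ + Y * ‖FT h k ξ‖)) ^ 2 := by gcongr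
      _ ≤ (1 + (k : ℝ) ^ 2 + ξ ^ 2) ^ s *
          (c ^ 2 * (4 * ((X * ‖FT g k ξ‖) ^ 2 + (Y * ‖FT h k ξ‖) ^ 2))) := by
        rw [mul_pow]
        gcongr
        nlinarith [sq_nonneg (X * ‖FT g k ξ‖ - Y * ‖FT h k ξ‖), sq_nonneg (X * ‖FT g k ξ‖),
          sq_nonneg (Y * ‖FT h k ξ‖)]
      _ = _ := by ring
  calc sobolevNorm s f ≤ _ := ENNReal.rpow_le_rpow key (by norm_num)
    _ ≤ _ := by
      rw [ENNReal.mul_rpow_of_nonneg _ _ (by norm_num), ← ENNReal.rpow_natCast, ← ENNReal.rpow_mul]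
      norm_num
      gcongr
      exact ENNReal.rpow_add_le_add_rpow _ _ (by norm_num) (by norm_num)

theorem sobolevNorm_zero_eq (f : L2) :
    sobolevNorm 0 f = ENNReal.ofReal (2 * Real.pi) ^ (1 / 2 : ℝ) * ‖f‖ₑ := by
  simp_rw [sobolevNorm, Real.rpow_zero, ENNReal.ofReal_one, one_mul]
  rw [tsum_lintegral_enorm_sq_FT, ENNReal.mul_rpow_of_nonneg _ _ (by norm_num),
    ← ENNReal.rpow_natCast, ← ENNReal.rpow_mul]
  norm_num

theorem norm_le_of_FT_le {f g h : L2} {c : ℝ} (hc : 0 ≤ c)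
    (H : ∀ k : ℤ, ∀ᵐ ξ : ℝ, ‖FT f k ξ‖ ≤ c * (‖FT g k ξ‖ + ‖FT h k ξ‖)) :
    ‖f‖ ≤ 2 * c * (‖g‖ + ‖h‖) := by
  have h1 := sobolevNorm_le_add 0 0 0 hc (by simpa using H)
  simp only [add_zero, sobolevNorm_zero_eq] at h1
  rw [← mul_add, mul_left_comm] at h1
  have hp : ENNReal.ofReal (2 * Real.pi) ^ (1 / 2 : ℝ) ≠ 0 := by
    simp [Real.pi_pos]
  have hp' : ENNReal.ofReal (2 * Real.pi) ^ (1 / 2 : ℝ) ≠ ∞ := by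
    finiteness
  rw [ENNReal.mul_le_mul_iff_right hp hp'] at h1
  rw [← ofReal_norm, ← ofReal_norm, ← ofReal_norm,
    ← ENNReal.ofReal_add (norm_nonneg _) (norm_nonneg _), ← ENNReal.ofReal_mul (by positivity)] at h1
  exact (ENNReal.ofReal_le_ofReal_iff (by positivity)).1 h1

theorem sobolevNorm_eq_zero {s : ℝ} {f : L2} (h : sobolevNorm s f = 0) : f = 0 := by
  have h1 : ∑' k : ℤ, ∫⁻ ξ : ℝ, ENNReal.ofReal ((1 + (k : ℝ) ^ 2 + ξ ^ 2) ^ s) * ‖FT f k ξ‖ₑ ^ 2 = 0 := by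
    exact (ENNReal.rpow_eq_zero_iff_of_pos (by norm_num)).1 h
  rw [ENNReal.tsum_eq_zero] at h1
  refine eq_of_FT_ae_eq fun k => ?_
  have h2 := (lintegral_eq_zero_iff'
    ((ENNReal.measurable_ofReal.comp (by fun_prop)).aemeasurable.mul
      ((aestronglyMeasurable_FT f k).enorm.pow_const 2))).1 (h1 k)
  have h0 : ∀ᵐ ξ : ℝ, FT (0 : L2) k ξ = 0 := by
    simpa using FT_smul 0 0 k
  filter_upwards [h2, h0] with ξ hξ h0
  have hJ : 0 < (1 + (k : ℝ) ^ 2 + ξ ^ 2) ^ s := by positivity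
  rw [h0]
  simpa [hJ, hJ.not_ge] using hξ

/-! ### Global solvability of bounded linear differential equations. -/

section LinearODE

variable {E : Type*} [NormedAddCommGroup E] [NormedSpace ℝ E]

theorem norm_integral_cosh_smul_le {l M : ℝ} (hl : 0 < l) {g : ℝ → E}
    (hg : ∀ σ, ‖g σ‖ ≤ M) (s : ℝ) :
    ‖∫ σ in (0 : ℝ)..s, Real.cosh (l * σ) • g σ‖ ≤ M / l * Real.cosh (l * s) := by
  have hM : 0 ≤ M := (norm_nonneg _).trans (hg 0)
  have hint : ∫ σ in (0 : ℝ)..s, Real.cosh (l * σ) * M = M / l * Real.sinh (l * s) := by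
    have hd : ∀ x ∈ Set.uIcc 0 s,
        HasDerivAt (fun σ => M / l * Real.sinh (l * σ)) (Real.cosh (l * x) * M) x := by
      intro x _
      have h := (((hasDerivAt_id x).const_mul l).sinh).const_mul (M / l)
      refine h.congr_deriv ?_
      simp only [id]
      field_simp
    rw [intervalIntegral.integral_eq_sub_of_hasDerivAt hd
      ((by fun_prop : Continuous fun σ => Real.cosh (l * σ) * M).intervalIntegrable _ _)]
    simp
  refine (intervalIntegral.norm_integral_le_abs_of_norm_le
    (g := fun σ => Real.cosh (l * σ) * M) (ae_of_all _ fun σ => ?_)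
    ((by fun_prop : Continuous fun σ => Real.cosh (l * σ) * M).intervalIntegrable _ _)).trans ?_
  · rw [norm_smul, Real.norm_of_nonneg (Real.cosh_pos _).le]
    exact mul_le_mul_of_nonneg_left (hg σ) (Real.cosh_pos _).le
  · rw [hint, abs_mul, abs_of_nonneg (by positivity), Real.abs_sinh]
    gcongr
    exact (Real.sinh_lt_cosh _).le.trans_eq (Real.cosh_abs _)

/-- Picard iteration in a weighted norm: the unknown is divided by `cosh (l s)`, so that one
contraction on bounded continuous functions solves the equation on the whole line. -/
theorem exists_hasDerivAt_linear [CompleteSpace E] {A : ℝ → E →L[ℝ] E} (hA : Continuous A) {K : ℝ}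
    (hK : ∀ t, ‖A t‖ ≤ K) (x₀ : E) :
    ∃ y : ℝ → E, y 0 = x₀ ∧ ∀ t, HasDerivAt y (A t (y t)) t := by
  have hK0 : 0 ≤ K := (norm_nonneg _).trans (hK 0)
  -- The Lipschitz constant of the weighted Picard map is `K / l`, which this choice makes at most
  -- `1/2`.
  set l : ℝ := 2 * (K + 1) with hl
  have hl0 : 0 < l := by positivity
  have hcont : ∀ v : BoundedContinuousFunction ℝ E,
      Continuous fun σ => Real.cosh (l * σ) • A σ (v σ) := fun v =>
    (by fun_prop : Continuous fun σ : ℝ => Real.cosh (l * σ)).smul (hA.clm_apply v.continuous)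
  have hder : ∀ (v : BoundedContinuousFunction ℝ E) (s : ℝ),
      HasDerivAt (fun s => ∫ σ in (0 : ℝ)..s, Real.cosh (l * σ) • A σ (v σ))
        (Real.cosh (l * s) • A s (v s)) s := fun v s => (hcont v).integral_hasStrictDerivAt 0 s |>.hasDerivAt
  have hbd : ∀ (v : BoundedContinuousFunction ℝ E) (σ : ℝ), ‖A σ (v σ)‖ ≤ K * ‖v‖ := fun v σ =>
    ((A σ).le_opNorm _).trans (mul_le_mul (hK σ) (v.norm_coe_le_norm σ) (norm_nonneg _) hK0)
  let P : BoundedContinuousFunction ℝ E → BoundedContinuousFunction ℝ E := fun v =>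
    BoundedContinuousFunction.ofNormedAddCommGroup
      (fun s => (Real.cosh (l * s))⁻¹ • (x₀ + ∫ σ in (0 : ℝ)..s, Real.cosh (l * σ) • A σ (v σ)))
      ((Continuous.inv₀ (by fun_prop) fun s => (Real.cosh_pos _).ne').smul
        (continuous_const.add (continuous_iff_continuousAt.2 fun s => (hder v s).continuousAt)))
      (‖x₀‖ + K * ‖v‖ / l) (fun s => by
        have hc := Real.one_le_cosh (l * s)
        have hc0 := Real.cosh_pos (l * s)
        rw [norm_smul, norm_inv, Real.norm_of_nonneg hc0.le, inv_mul_le_iff₀ hc0]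
        refine (norm_add_le _ _).trans ?_
        have h1 := norm_integral_cosh_smul_le hl0 (hbd v) s
        have h2 : ‖x₀‖ ≤ Real.cosh (l * s) * ‖x₀‖ := le_mul_of_one_le_left (norm_nonneg _) hc
        linarith)
  have hP : ContractingWith (1 / 2) P := by
    refine ⟨by norm_num, LipschitzWith.of_dist_le_mul fun v w => ?_⟩
    rw [BoundedContinuousFunction.dist_le (by positivity)]
    intro s
    have hc0 := Real.cosh_pos (l * s)
    have h1 : P v s - P w s
        = (Real.cosh (l * s))⁻¹ • ∫ σ in (0 : ℝ)..s, Real.cosh (l * σ) • A σ ((v - w) σ) := by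
      change (Real.cosh (l * s))⁻¹ • (x₀ + ∫ σ in (0 : ℝ)..s, Real.cosh (l * σ) • A σ (v σ)) -
        (Real.cosh (l * s))⁻¹ • (x₀ + ∫ σ in (0 : ℝ)..s, Real.cosh (l * σ) • A σ (w σ)) = _
      rw [← smul_sub, add_sub_add_left_eq_sub, ← intervalIntegral.integral_sub
        ((hcont v).intervalIntegrable _ _) ((hcont w).intervalIntegrable _ _)]
      simp [smul_sub]
    rw [dist_eq_norm, h1, norm_smul, norm_inv, Real.norm_of_nonneg hc0.le, inv_mul_le_iff₀ hc0,
      dist_eq_norm]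
    refine (norm_integral_cosh_smul_le hl0 (hbd (v - w)) s).trans ?_
    have : K * ‖v - w‖ / l ≤ 1 / 2 * ‖v - w‖ := by
      rw [div_le_iff₀ hl0, hl]
      nlinarith [norm_nonneg (v - w)]
    calc _ ≤ 1 / 2 * ‖v - w‖ * Real.cosh (l * s) := by gcongr
      _ = _ := by simp; ring
  obtain ⟨v, hv⟩ : ∃ v, P v = v := ⟨_, hP.fixedPoint_isFixedPt⟩
  have hv2 : ∀ s, Real.cosh (l * s) • v s
      = x₀ + ∫ σ in (0 : ℝ)..s, Real.cosh (l * σ) • A σ (v σ) := by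
    intro s
    have : v s = (Real.cosh (l * s))⁻¹ •
      (x₀ + ∫ σ in (0 : ℝ)..s, Real.cosh (l * σ) • A σ (v σ)) := by
      conv_lhs => rw [← hv]
      rfl
    rw [this, smul_smul, mul_inv_cancel₀ (Real.cosh_pos _).ne', one_smul]
  refine ⟨fun s => x₀ + ∫ σ in (0 : ℝ)..s, Real.cosh (l * σ) • A σ (v σ), by simp, fun t => ?_⟩
  exact ((hder v t).const_add x₀).congr_deriv (by simp only [← hv2, map_smul])

end LinearODE

/-! ### The scalar mode equation. -/

/-- `u'' = -α u / (1 + s²)`, with `v = u'`. -/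
structure IsModeSol (α : ℝ) (u v : ℝ → ℂ) : Prop where
  deriv_fst : ∀ s, HasDerivAt u (v s) s
  deriv_snd : ∀ s, HasDerivAt v (-(α / (1 + s ^ 2) : ℝ) * u s) s

theorem exists_isModeSol_zero (α : ℝ) (a b : ℂ) : ∃ u v, IsModeSol α u v ∧ u 0 = a ∧ v 0 = b := by
  let A : ℝ → (ℂ × ℂ) →L[ℝ] (ℂ × ℂ) := fun s =>
    (ContinuousLinearMap.snd ℝ ℂ ℂ).prod ((-(α / (1 + s ^ 2))) • ContinuousLinearMap.fst ℝ ℂ ℂ)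
  have hbd : ∀ s : ℝ, |α / (1 + s ^ 2)| ≤ |α| := fun s => by
    rw [abs_div, abs_of_pos (by positivity : 0 < 1 + s ^ 2)]
    exact div_le_self (abs_nonneg _) (by nlinarith)
  have hA : Continuous A := by
    have h : A = fun s => (ContinuousLinearMap.inl ℝ ℂ ℂ) ∘L (ContinuousLinearMap.snd ℝ ℂ ℂ) +
      (-(α / (1 + s ^ 2))) • (ContinuousLinearMap.inr ℝ ℂ ℂ) ∘L (ContinuousLinearMap.fst ℝ ℂ ℂ) := by
      funext s
      ext x <;> simp [A]
    rw [h]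
    have hq : Continuous fun s : ℝ => -(α / (1 + s ^ 2)) :=
      (continuous_const.div (by fun_prop) fun s => by positivity).neg
    fun_prop
  obtain ⟨y, hy0, hy⟩ := exists_hasDerivAt_linear hA (K := 1 + |α|) (fun s => by
    refine ContinuousLinearMap.opNorm_le_bound _ (by positivity) fun x => ?_
    change ‖(x.2, (-(α / (1 + s ^ 2))) • x.1)‖ ≤ _
    have h1 := norm_fst_le x
    have h2 := norm_snd_le x
    rw [Prod.norm_def, norm_smul, norm_neg, Real.norm_eq_abs]
    refine max_le ?_ ?_
    · nlinarith [norm_nonneg x, abs_nonneg α]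
    · have := mul_le_mul (hbd s) h1 (norm_nonneg _) (abs_nonneg _)
      nlinarith [norm_nonneg x]) (a, b)
  refine ⟨fun s => (y s).1, fun s => (y s).2, ⟨fun s => ?_, fun s => ?_⟩, by simp [hy0], by simp [hy0]⟩
  · exact (ContinuousLinearMap.fst ℝ ℂ ℂ).hasFDerivAt.comp_hasDerivAt s (hy s)
  · have := (ContinuousLinearMap.snd ℝ ℂ ℂ).hasFDerivAt.comp_hasDerivAt s (hy s)
    refine this.congr_deriv ?_
    change (-(α / (1 + s ^ 2))) • (y s).1 = _
    rw [Complex.real_smul]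
    push_cast
    rfl

/-! ### The exponent `c` and its thresholds. -/

theorem rate_of_le {α : ℝ} (h : α ≤ 1 / 4) : rate α = 1 / 2 * (1 - 4 * α) ^ (1 / 2 : ℝ) := by
  have h1 : (1 - 4 * (α : ℂ)) ^ (1 / 2 : ℂ) = (((1 - 4 * α) ^ (1 / 2 : ℝ) : ℝ) : ℂ) := by
    rw [Complex.ofReal_cpow (by linarith)]
    push_cast
    rfl
  rw [rate, h1, Complex.ofReal_re]

theorem rate_of_ge {α : ℝ} (h : 1 / 4 ≤ α) : rate α = 0 := by
  have h1 : (1 - 4 * (α : ℂ)) = ((1 - 4 * α : ℝ) : ℂ) := by push_cast; rfl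
  have h2 : (-((1 - 4 * α : ℝ) : ℂ)) ^ (1 / 2 : ℂ) = (((4 * α - 1) ^ (1 / 2 : ℝ) : ℝ) : ℂ) := by
    rw [Complex.ofReal_cpow (by linarith)]
    push_cast
    ring_nf
  have h3 : Complex.exp (Real.pi * Complex.I * (1 / 2 : ℂ)) = Complex.I := by
    rw [show (Real.pi * Complex.I * (1 / 2 : ℂ)) = Real.pi / 2 * Complex.I by ring,
      Complex.exp_pi_div_two_mul_I]
  rw [rate, h1, Complex.ofReal_cpow_of_nonpos (by linarith), h2, h3]
  simp

theorem rate_nonneg (α : ℝ) : 0 ≤ rate α := by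
  rcases le_total α (1 / 4) with h | h
  · rw [rate_of_le h]
    have : 0 ≤ 1 - 4 * α := by linarith
    positivity
  · rw [rate_of_ge h]

theorem rate_sq_of_le {α : ℝ} (h : α ≤ 1 / 4) : rate α ^ 2 = 1 / 4 - α := by
  rw [rate_of_le h, ← Real.sqrt_eq_rpow, mul_pow, Real.sq_sqrt (by linarith)]
  ring

theorem rate_lt_half_iff (α : ℝ) : 0 < α ↔ rate α < 1 / 2 := by
  have h0 := rate_nonneg α
  rcases le_total α (1 / 4) with h | h
  · have h1 := rate_sq_of_le h
    constructor <;> intro h2 <;> nlinarith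
  · rw [rate_of_ge h]
    constructor <;> intro <;> linarith

theorem rate_lt_three_halves_iff (α : ℝ) : -2 < α ↔ rate α < 3 / 2 := by
  have h0 := rate_nonneg α
  rcases le_total α (1 / 4) with h | h
  · have h1 := rate_sq_of_le h
    constructor <;> intro h2 <;> nlinarith
  · rw [rate_of_ge h]
    constructor <;> intro <;> linarith

/-! ### Differential inequalities and the Japanese bracket. -/

/-- `Q exp(-h)` is nonincreasing on `[a, ∞)`. The weight `h` is differentiated only there, since one
application takes a logarithm for `h`. -/
theorem le_mul_exp_of_deriv_le {Q Q' h h' : ℝ → ℝ} (hQ : ∀ s, HasDerivAt Q (Q' s) s)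
    {a b : ℝ} (hh : ∀ s, a ≤ s → HasDerivAt h (h' s) s) (hab : a ≤ b)
    (H : ∀ s, a ≤ s → Q' s ≤ h' s * Q s) : Q b ≤ Q a * Real.exp (h b - h a) := by
  have hd : ∀ s, a ≤ s → HasDerivAt (fun s => Q s * Real.exp (-h s))
      (Q' s * Real.exp (-h s) + Q s * (Real.exp (-h s) * -h' s)) s := fun s hs =>
    (hQ s).mul (hh s hs).neg.exp
  have hanti : AntitoneOn (fun s => Q s * Real.exp (-h s)) (Set.Ici a) := by
    refine antitoneOn_of_deriv_nonpos (convex_Ici a)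
      (fun s hs => (hd s hs).continuousAt.continuousWithinAt)
      (fun s hs => (hd s (interior_subset hs)).differentiableAt.differentiableWithinAt)
      fun s hs => ?_
    rw [interior_Ici] at hs
    rw [(hd s hs.le).deriv]
    nlinarith [H s hs.le, Real.exp_pos (-h s)]
  have h1 : Q b * Real.exp (-h b) ≤ Q a * Real.exp (-h a) := hanti Set.self_mem_Ici hab hab
  calc Q b = Q b * Real.exp (-h b) * Real.exp (h b) := by
        rw [mul_assoc, ← Real.exp_add]; simp
    _ ≤ Q a * Real.exp (-h a) * Real.exp (h b) := by gcongr
    _ = _ := by rw [mul_assoc, ← Real.exp_add]; ring_nf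

theorem mul_exp_le_of_le_deriv {Q Q' h h' : ℝ → ℝ} (hQ : ∀ s, HasDerivAt Q (Q' s) s)
    {a b : ℝ} (hh : ∀ s, a ≤ s → HasDerivAt h (h' s) s) (hab : a ≤ b)
    (H : ∀ s, a ≤ s → h' s * Q s ≤ Q' s) : Q a * Real.exp (h b - h a) ≤ Q b := by
  have := le_mul_exp_of_deriv_le (fun s => (hQ s).neg) hh hab (fun s hs => by
    simp only [Pi.neg_apply]; linarith [H s hs])
  simp only [Pi.neg_apply] at this
  linarith

/-- The Japanese bracket `⟨s⟩ = √(1 + s²)`. -/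
def jap (s : ℝ) : ℝ := √(1 + s ^ 2)

theorem jap_sq (s : ℝ) : jap s ^ 2 = 1 + s ^ 2 := Real.sq_sqrt (by positivity)

theorem jap_pos (s : ℝ) : 0 < jap s := Real.sqrt_pos.2 (by positivity)

theorem one_le_jap (s : ℝ) : 1 ≤ jap s := Real.one_le_sqrt.2 (by nlinarith)

theorem abs_le_jap (s : ℝ) : |s| ≤ jap s := Real.abs_le_sqrt (by linarith)

theorem le_jap (s : ℝ) : s ≤ jap s := (le_abs_self s).trans (abs_le_jap s)

theorem jap_neg (s : ℝ) : jap (-s) = jap s := by simp [jap]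

theorem jap_zero : jap 0 = 1 := by simp [jap]

theorem jap_le_add (s t : ℝ) : jap (s + t) ≤ jap s + |t| := by
  refine Real.sqrt_le_iff.2 ⟨by linarith [jap_pos s, abs_nonneg t], ?_⟩
  have h1 := jap_sq s
  have h2 := abs_le_jap s
  have h3 : s * t ≤ jap s * |t| := by
    calc s * t ≤ |s * t| := le_abs_self _
      _ = |s| * |t| := abs_mul _ _
      _ ≤ _ := by gcongr
  nlinarith [sq_abs t]

/-- This is what makes the deviation from the constant-coefficient system integrable on `s ≥ 0`. -/
theorem jap_sub_self_mul {s : ℝ} (hs : 0 ≤ s) : (jap s - s) * jap s ≤ 1 := by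
  nlinarith [jap_sq s, le_jap s]

theorem hasDerivAt_jap (s : ℝ) : HasDerivAt jap (s / jap s) s := by
  have h : HasDerivAt (fun s : ℝ => 1 + s ^ 2) (2 * s) s := by
    simpa using ((hasDerivAt_pow 2 s).const_add 1)
  refine (h.sqrt (by positivity)).congr_deriv ?_
  rw [mul_div_mul_left _ _ two_ne_zero]
  rfl

theorem hasDerivAt_arsinh (s : ℝ) : HasDerivAt Real.arsinh (jap s)⁻¹ s := Real.hasDerivAt_arsinh s

/-! ### Energy functionals for the mode equation. -/

/-- Real-valued solutions of `u'' = -α u / (1 + s²)`, with `v = u'`. -/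
structure IsRealModeSol (α : ℝ) (u v : ℝ → ℝ) : Prop where
  deriv_fst : ∀ s, HasDerivAt u (v s) s
  deriv_snd : ∀ s, HasDerivAt v (-(α / (1 + s ^ 2)) * u s) s

/-- The logarithmic weight `1 + arsinh |s|` of the case `α = 1/4` of a double exponent. -/
def logWeight (α s : ℝ) : ℝ := if α = 1 / 4 then 1 + Real.arsinh |s| else 1

theorem one_le_logWeight (α s : ℝ) : 1 ≤ logWeight α s := by
  unfold logWeight
  split_ifs
  · linarith [Real.arsinh_nonneg_iff.2 (abs_nonneg s)]
  · rfl

theorem logWeight_zero (α : ℝ) : logWeight α 0 = 1 := by simp [logWeight]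

theorem logWeight_neg (α s : ℝ) : logWeight α (-s) = logWeight α s := by simp [logWeight]

/-- With `τ = arsinh s` and `z = ⟨s⟩ v - u/2` one has `du/dτ = u/2 + z` and `dz/dτ = z/2 + (1/4 - α)
u + (s - ⟨s⟩) v`. Subtracting `u/2` isolates the common growth `e^(τ/2)` and leaves a trace-free
matrix with eigenvalues `±√(1/4 - α)`. -/
theorem hasDerivAt_shear {α : ℝ} {u v : ℝ → ℝ} (h : IsRealModeSol α u v) (s : ℝ) :
    HasDerivAt (fun s => jap s * v s - u s / 2)
      (((s - jap s) * v s + (jap s * v s - u s / 2) / 2 + (1 / 4 - α) * u s) / jap s) s := by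
  refine (((hasDerivAt_jap s).mul (h.deriv_snd s)).sub ((h.deriv_fst s).div_const 2)).congr_deriv ?_
  rw [← jap_sq]
  have := (jap_pos s).ne'
  field_simp
  ring

/-- The energy is `z² + m u²` with `m = |α - 1/4|`. For the limit system its logarithmic derivative
in `τ` lies between `1 - 2c` and `1 + 2c`; the cross term cancels if `α > 1/4`, and is absorbed
using `m = c²` if `α < 1/4`. The energy is definite because `m > 0`. -/
theorem exists_energy_of_ne {α : ℝ} (hα : α ≠ 1 / 4) : ∃ K C : ℝ, 0 ≤ K ∧ 0 < C ∧
    ∀ u v : ℝ → ℝ, IsRealModeSol α u v → ∃ Q Q' : ℝ → ℝ, (∀ s, HasDerivAt Q (Q' s) s) ∧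
      ∀ s, 0 ≤ s → |Q' s - Q s / jap s| ≤ (2 * rate α / jap s + K / (1 + s ^ 2)) * Q s ∧
        Q s ≤ C * (|u s| + jap s * |v s|) ^ 2 ∧ (|u s| + jap s * |v s|) ^ 2 ≤ C * Q s := by
  set m := |α - 1 / 4| with hm
  have hm0 : 0 < m := abs_pos.2 (sub_ne_zero.2 hα)
  set c := rate α with hc
  have hc0 : 0 ≤ c := rate_nonneg α
  have hcm : ∀ z u : ℝ, |2 * (1 / 4 - α + m) * (z * u)| ≤ 2 * c * (z ^ 2 + m * u ^ 2) := by
    intro z u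
    rcases le_total α (1 / 4) with h | h
    · have h1 := rate_sq_of_le h
      have h2 : m = 1 / 4 - α := by rw [hm, abs_of_nonpos (by linarith)]; ring
      rw [← hc, ← h2] at h1
      rw [← h2, ← h1, abs_le]
      constructor <;> nlinarith [mul_nonneg hc0 (sq_nonneg (z - c * u)),
        mul_nonneg hc0 (sq_nonneg (z + c * u))]
    · have h2 : 1 / 4 - α + m = 0 := by rw [hm, abs_of_nonneg (by linarith)]; ring
      rw [h2]
      simpa using (by positivity : 0 ≤ 2 * c * (z ^ 2 + m * u ^ 2))
  -- `3 + 1/m` comes from the error bound `|z (2z + u)| ≤ 3 z² + u²` and `m u² ≤ Q`; the second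
  -- constant is a generous equivalence constant.
  refine ⟨3 + 1 / m, 8 + m + 8 / m, by positivity, by positivity, fun u v h => ?_⟩
  refine ⟨fun s => (jap s * v s - u s / 2) ^ 2 + m * u s ^ 2,
    fun s => 2 * (jap s * v s - u s / 2) *
      (((s - jap s) * v s + (jap s * v s - u s / 2) / 2 + (1 / 4 - α) * u s) / jap s) +
      m * (2 * u s * v s), fun s => ?_, fun s hs => ?_⟩
  · refine (((hasDerivAt_shear h s).pow 2).add (((h.deriv_fst s).pow 2).const_mul m)).congr_deriv ?_
    simp
  have hj := jap_pos s
  have hjne := hj.ne'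
  set z := jap s * v s - u s / 2 with hz
  have hv : v s = (z + u s / 2) / jap s := by rw [hz]; field_simp; ring
  have hQ : 0 ≤ z ^ 2 + m * u s ^ 2 := by positivity
  have hu2 : u s ^ 2 ≤ (1 / m) * (z ^ 2 + m * u s ^ 2) := by
    rw [mul_add, ← mul_assoc, one_div_mul_cancel hm0.ne', one_mul]
    nlinarith [show 0 ≤ 1 / m * z ^ 2 by positivity]
  have hz2 : z ^ 2 ≤ z ^ 2 + m * u s ^ 2 := by nlinarith [show 0 ≤ m * u s ^ 2 by positivity]
  dsimp only
  simp only [← hz]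
  refine ⟨?_, ?_, ?_⟩
  · have e1 : 2 * z * (((s - jap s) * v s + z / 2 + (1 / 4 - α) * u s) / jap s) +
        m * (2 * u s * v s) - (z ^ 2 + m * u s ^ 2) / jap s =
        (2 * (1 / 4 - α + m) * (z * u s)) / jap s +
        -((jap s - s) * jap s * (z * (2 * z + u s)) / jap s ^ 3) := by
      rw [hv]; field_simp; ring
    rw [e1, add_mul]
    refine (abs_add_le _ _).trans (add_le_add ?_ ?_)
    · rw [abs_div, abs_of_pos hj, div_mul_eq_mul_div]
      gcongr
      exact hcm _ _
    · rw [abs_neg, abs_div, abs_of_pos (by positivity : 0 < jap s ^ 3), abs_mul,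
        abs_of_nonneg (mul_nonneg (sub_nonneg.2 (le_jap s)) hj.le), ← jap_sq, div_mul_eq_mul_div]
      have h1 : |z * (2 * z + u s)| ≤ (3 + 1 / m) * (z ^ 2 + m * u s ^ 2) := by
        have : |z * (2 * z + u s)| ≤ 3 * z ^ 2 + u s ^ 2 := by
          rw [abs_le]
          constructor <;> nlinarith [sq_nonneg (z - u s), sq_nonneg (z + u s), sq_nonneg (u s)]
        linarith
      have h2 : jap s ^ 2 ≤ jap s ^ 3 := pow_le_pow_right₀ (one_le_jap s) (by norm_num)
      refine div_le_div₀ (by positivity) ?_ (by positivity) h2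
      calc _ ≤ 1 * |z * (2 * z + u s)| := by gcongr; exact jap_sub_self_mul hs
        _ ≤ _ := by rw [one_mul]; exact h1
  · have e : (|u s| + jap s * |v s|) ^ 2 = u s ^ 2 + 2 * |u s| * (jap s * |v s|) + (jap s * v s) ^ 2 := by
      rw [add_sq, mul_pow, sq_abs, mul_pow, sq_abs]
    have h1 : 0 ≤ 2 * |u s| * (jap s * |v s|) := by positivity
    have h2 : 0 ≤ 8 / m := by positivity
    rw [e]
    have h3 : z ^ 2 ≤ 2 * (jap s * v s) ^ 2 + 2 * u s ^ 2 := by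
      rw [hz]; nlinarith [sq_nonneg (jap s * v s + u s), sq_nonneg (u s), sq_nonneg (jap s * v s)]
    set X := u s ^ 2 + 2 * |u s| * (jap s * |v s|) + (jap s * v s) ^ 2 with hX
    have h4 : 0 ≤ (8 / m) * X := by positivity
    have h5 : m * u s ^ 2 ≤ m * X := by
      gcongr
      linarith [sq_nonneg (jap s * v s)]
    have h6 : (8 + m + 8 / m) * X = 8 * X + m * X + 8 / m * X := by ring
    have h7 : 0 ≤ X := by positivity
    linarith
  · have h3 : |u s| + jap s * |v s| ≤ |z| + 2 * |u s| := by
      have : jap s * |v s| = |z + u s / 2| := by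
        rw [hz, sub_add_cancel, abs_mul, abs_of_pos hj]
      rw [this]
      refine (add_le_add_right (abs_add_le _ _) _).trans ?_
      rw [abs_div, abs_two]
      linarith [abs_nonneg (u s)]
    have h4 := pow_le_pow_left₀ (by positivity) h3 2
    have h5 : (|z| + 2 * |u s|) ^ 2 ≤ 8 * z ^ 2 + 8 * u s ^ 2 := by
      nlinarith [sq_abs z, sq_abs (u s), sq_nonneg (|z| - 2 * |u s|), sq_nonneg z]
    have h6 : (8 / m) * (z ^ 2 + m * u s ^ 2) = 8 * ((1 / m) * (z ^ 2 + m * u s ^ 2)) := by ring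
    have h7 : 0 ≤ m * (z ^ 2 + m * u s ^ 2) := by positivity
    have h8 : (8 + m + 8 / m) * (z ^ 2 + m * u s ^ 2) = 8 * (z ^ 2 + m * u s ^ 2) +
      m * (z ^ 2 + m * u s ^ 2) + 8 / m * (z ^ 2 + m * u s ^ 2) := by ring
    linarith

theorem one_add_arsinh_sq_le {s : ℝ} (hs : 0 ≤ s) : (1 + Real.arsinh s) ^ 2 ≤ 16 * jap s := by
  have h1 : 0 < s + jap s := by linarith [jap_pos s]
  have h2 : Real.arsinh s = Real.log (s + jap s) := rfl
  have h3 := Real.log_le_rpow_div h1.le (ε := 1 / 2) (by norm_num)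
  rw [← Real.sqrt_eq_rpow, ← h2] at h3
  have h4 : √(s + jap s) ^ 2 = s + jap s := Real.sq_sqrt h1.le
  have h5 := Real.arsinh_nonneg_iff.2 hs
  have h6 : Real.arsinh s ≤ 2 * √(s + jap s) := by linarith
  have h7 : 1 ≤ √(s + jap s) := Real.one_le_sqrt.2 (by linarith [one_le_jap s])
  have h8 := le_jap s
  have h9 : (1 + Real.arsinh s) ^ 2 ≤ (1 + 2 * √(s + jap s)) ^ 2 := by gcongr
  have h10 : √(s + jap s) ^ 2 ≤ 2 * jap s := by linarith
  have h11 : √(s + jap s) ≤ 3 / 2 * jap s := by nlinarith [one_le_jap s]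
  nlinarith [one_le_jap s]

/-- At the double root the limit system is a Jordan block: up to the factor `e^(τ/2)`, both `z` and
`u - τ z` are conserved. With `1 + τ` in place of `τ`, the sum of the squares of `z` and `u - (1 +
τ) z` is equivalent to the natural size only up to powers of `1 + τ`, the source of the logarithm.
-/
theorem exists_energy_quarter : ∃ K C : ℝ, 0 ≤ K ∧ 0 < C ∧
    ∀ u v : ℝ → ℝ, IsRealModeSol (1 / 4) u v → ∃ Q Q' : ℝ → ℝ, (∀ s, HasDerivAt Q (Q' s) s) ∧
      ∀ s, 0 ≤ s → |Q' s - Q s / jap s| ≤ K / (1 + s ^ 2) * Q s ∧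
        Q s ≤ C * ((1 + Real.arsinh s) * (|u s| + jap s * |v s|)) ^ 2 ∧
        (|u s| + jap s * |v s|) ^ 2 ≤ C * (1 + Real.arsinh s) ^ 2 * Q s := by
  -- `128 = 8 * 16`: the error carries `8 (1 + τ)²`, and `(1 + τ)² ≤ 16 ⟨s⟩` lowers the decay
  -- `⟨s⟩⁻³` to the still integrable `⟨s⟩⁻²`.
  refine ⟨128, 32, by positivity, by positivity, fun u v h => ?_⟩
  refine ⟨fun s => (u s - (1 + Real.arsinh s) * (jap s * v s - u s / 2)) ^ 2 +
      (jap s * v s - u s / 2) ^ 2,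
    fun s => 2 * (u s - (1 + Real.arsinh s) * (jap s * v s - u s / 2)) *
      (v s - ((jap s)⁻¹ * (jap s * v s - u s / 2) + (1 + Real.arsinh s) *
      (((s - jap s) * v s + (jap s * v s - u s / 2) / 2 + (1 / 4 - 1 / 4) * u s) / jap s))) +
      2 * (jap s * v s - u s / 2) *
      (((s - jap s) * v s + (jap s * v s - u s / 2) / 2 + (1 / 4 - 1 / 4) * u s) / jap s),
    fun s => ?_, fun s hs => ?_⟩
  · refine ((((h.deriv_fst s).sub (((hasDerivAt_arsinh s).const_add 1).mul
      (hasDerivAt_shear h s))).pow 2).add ((hasDerivAt_shear h s).pow 2)).congr_deriv ?_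
    simp
  have hj := jap_pos s
  have hjne := hj.ne'
  set z := jap s * v s - u s / 2 with hz
  set A := 1 + Real.arsinh s with hA
  have hA1 : 1 ≤ A := by linarith [Real.arsinh_nonneg_iff.2 hs]
  set a := u s - A * z with ha
  have hu : u s = a + A * z := by rw [ha]; ring
  have hv : v s = (z + u s / 2) / jap s := by rw [hz]; field_simp; ring
  have hQ : 0 ≤ a ^ 2 + z ^ 2 := by positivity
  dsimp only
  simp only [← hz, ← hA, ← ha]
  refine ⟨?_, ?_, ?_⟩
  · have e1 : 2 * a * (v s - ((jap s)⁻¹ * z + A * (((s - jap s) * v s + z / 2 + (1 / 4 - 1 / 4) * u s) /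
          jap s))) + 2 * z * (((s - jap s) * v s + z / 2 + (1 / 4 - 1 / 4) * u s) / jap s) -
          (a ^ 2 + z ^ 2) / jap s =
        (jap s - s) * jap s * ((A * a - z) * (2 * z + u s)) / jap s ^ 3 := by
      rw [hv, hu]; field_simp; ring
    rw [e1, abs_div, abs_of_pos (by positivity : 0 < jap s ^ 3), abs_mul,
      abs_of_nonneg (mul_nonneg (sub_nonneg.2 (le_jap s)) hj.le), ← jap_sq,
      div_mul_eq_mul_div]
    have h1 : |(A * a - z) * (2 * z + u s)| ≤ 8 * A ^ 2 * (a ^ 2 + z ^ 2) := by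
      rw [abs_mul, hu]
      have b1 : |A * a - z| ≤ A * (|a| + |z|) := by
        refine (abs_sub _ _).trans ?_
        rw [abs_mul, abs_of_nonneg (by linarith : 0 ≤ A)]
        nlinarith [abs_nonneg z]
      have b2 : |2 * z + (a + A * z)| ≤ 3 * A * (|a| + |z|) := by
        refine (abs_add_le _ _).trans ((add_le_add_right (abs_add_le _ _) _).trans ?_)
        rw [abs_mul, abs_mul, abs_two, abs_of_nonneg (by linarith : 0 ≤ A)]
        nlinarith [abs_nonneg z, abs_nonneg a]
      have b3 : (|a| + |z|) ^ 2 ≤ 2 * (a ^ 2 + z ^ 2) := by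
        nlinarith [sq_abs a, sq_abs z, sq_nonneg (|a| - |z|)]
      calc _ ≤ (A * (|a| + |z|)) * (3 * A * (|a| + |z|)) := by gcongr
        _ = 3 * A ^ 2 * (|a| + |z|) ^ 2 := by ring
        _ ≤ 3 * A ^ 2 * (2 * (a ^ 2 + z ^ 2)) := by gcongr
        _ ≤ _ := by linarith [show 0 ≤ A ^ 2 * (a ^ 2 + z ^ 2) by positivity]
    calc _ ≤ 1 * (8 * (16 * jap s) * (a ^ 2 + z ^ 2)) / jap s ^ 3 := by
          gcongr
          · exact jap_sub_self_mul hs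
          · refine h1.trans ?_
            gcongr
            exact one_add_arsinh_sq_le hs
      _ = _ := by field_simp; ring
  · have h1 : |z| ≤ |u s| + jap s * |v s| := by
      rw [hz]
      refine (abs_sub _ _).trans ?_
      rw [abs_mul, abs_of_pos hj, abs_div, abs_two]
      linarith [abs_nonneg (u s)]
    have h2 : |a| ≤ 2 * (A * (|u s| + jap s * |v s|)) := by
      rw [ha]
      refine (abs_sub _ _).trans ?_
      rw [abs_mul, abs_of_nonneg (by linarith : 0 ≤ A)]
      have : A * |z| ≤ A * (|u s| + jap s * |v s|) := by gcongr
      nlinarith [abs_nonneg (u s), mul_nonneg hj.le (abs_nonneg (v s))]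
    have h3 : |z| ≤ A * (|u s| + jap s * |v s|) :=
      h1.trans (le_mul_of_one_le_left (by positivity) hA1)
    rw [← sq_abs a, ← sq_abs z]
    nlinarith [abs_nonneg a, abs_nonneg z]
  · have h1 : |u s| ≤ A * (|a| + |z|) := by
      rw [hu]
      refine (abs_add_le _ _).trans ?_
      rw [abs_mul, abs_of_nonneg (by linarith : 0 ≤ A)]
      nlinarith [abs_nonneg a]
    have h2 : jap s * |v s| ≤ |z| + |u s| := by
      have : jap s * |v s| = |z + u s / 2| := by
        rw [hz, sub_add_cancel, abs_mul, abs_of_pos hj]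
      rw [this]
      refine (abs_add_le _ _).trans ?_
      rw [abs_div, abs_two]
      linarith [abs_nonneg (u s)]
    have h3 : |u s| + jap s * |v s| ≤ 3 * A * (|a| + |z|) := by
      nlinarith [abs_nonneg a, abs_nonneg z]
    have b3 : (|a| + |z|) ^ 2 ≤ 2 * (a ^ 2 + z ^ 2) := by
      nlinarith [sq_abs a, sq_abs z, sq_nonneg (|a| - |z|)]
    calc _ ≤ (3 * A * (|a| + |z|)) ^ 2 := by gcongr
      _ = 9 * A ^ 2 * (|a| + |z|) ^ 2 := by ring
      _ ≤ 9 * A ^ 2 * (2 * (a ^ 2 + z ^ 2)) := by gcongr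
      _ ≤ _ := by linarith [show 0 ≤ A ^ 2 * (a ^ 2 + z ^ 2) by positivity]

theorem exists_energy (α : ℝ) : ∃ K C : ℝ, 0 ≤ K ∧ 0 < C ∧
    ∀ u v : ℝ → ℝ, IsRealModeSol α u v → ∃ Q Q' : ℝ → ℝ, (∀ s, HasDerivAt Q (Q' s) s) ∧
      ∀ s, 0 ≤ s → |Q' s - Q s / jap s| ≤ (2 * rate α / jap s + K / (1 + s ^ 2)) * Q s ∧
        Q s ≤ C * (logWeight α s * (|u s| + jap s * |v s|)) ^ 2 ∧
        (|u s| + jap s * |v s|) ^ 2 ≤ C * logWeight α s ^ 2 * Q s := by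
  by_cases hα : α = 1 / 4
  · obtain ⟨K, C, hK, hC, H⟩ := exists_energy_quarter
    refine ⟨K, C, hK, hC, fun u v h => ?_⟩
    subst hα
    obtain ⟨Q, Q', hd, hQ⟩ := H u v h
    refine ⟨Q, Q', hd, fun s hs => ?_⟩
    rw [logWeight, if_pos rfl, abs_of_nonneg hs, rate_of_ge le_rfl, mul_zero, zero_div, zero_add]
    exact hQ s hs
  · obtain ⟨K, C, hK, hC, H⟩ := exists_energy_of_ne hα
    refine ⟨K, C, hK, hC, fun u v h => ?_⟩
    obtain ⟨Q, Q', hd, hQ⟩ := H u v h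
    refine ⟨Q, Q', hd, fun s hs => ?_⟩
    rw [logWeight, if_neg hα, one_mul, one_pow, mul_one]
    exact hQ s hs

/-! ### Two-sided growth of real modes on the half line. -/

theorem rpow_le_two_rpow_mul {x q : ℝ} (hx : 0 < x) (h1 : x / 2 ≤ q) (h2 : q ≤ 2 * x) (κ : ℝ) :
    q ^ κ ≤ 2 ^ |κ| * x ^ κ := by
  have hq : 0 < q := by linarith
  rcases le_total 0 κ with h | h
  · rw [abs_of_nonneg h, ← Real.mul_rpow (by norm_num) hx.le]
    exact Real.rpow_le_rpow hq.le h2 h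
  · calc q ^ κ ≤ (x / 2) ^ κ := Real.rpow_le_rpow_of_nonpos (by positivity) h1 h
      _ = 2 ^ |κ| * x ^ κ := by
        rw [abs_of_nonpos h, Real.div_rpow hx.le (by norm_num), Real.rpow_neg (by norm_num)]
        ring

/-- `exp (arsinh s) = s + ⟨s⟩` lies between `⟨s⟩` and `2⟨s⟩` for `s ≥ 0`, and the total increment of
`arctan` is at most `π`. -/
theorem exp_arsinh_arctan_le {K : ℝ} (hK : 0 ≤ K) (κ : ℝ) {a b : ℝ} (ha : 0 ≤ a) (hb : 0 ≤ b) :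
    Real.exp (κ * (Real.arsinh b - Real.arsinh a) + K * (Real.arctan b - Real.arctan a)) ≤
      2 ^ |κ| * Real.exp (K * Real.pi) * (jap b / jap a) ^ κ := by
  have hja := jap_pos a
  have hjb := jap_pos b
  have h1 : Real.exp (κ * (Real.arsinh b - Real.arsinh a)) = ((b + jap b) / (a + jap a)) ^ κ := by
    rw [mul_comm, Real.exp_mul, Real.exp_sub, Real.exp_arsinh, Real.exp_arsinh]
    rfl
  have h2 : Real.exp (K * (Real.arctan b - Real.arctan a)) ≤ Real.exp (K * Real.pi) := by
    gcongr
    linarith [Real.arctan_lt_pi_div_two b, Real.neg_pi_div_two_lt_arctan a]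
  rw [Real.exp_add, h1, mul_right_comm]
  have haj := le_jap a
  have hbj := le_jap b
  gcongr
  refine rpow_le_two_rpow_mul (by positivity) ?_ ?_ κ
  · rw [div_div, div_le_div_iff₀ (by positivity) (by positivity)]
    nlinarith
  · rw [div_le_iff₀ (by positivity), mul_assoc, div_mul_eq_mul_div, ← mul_div_assoc,
      le_div_iff₀ hja]
    nlinarith

/-- Integration of the energy inequality from both sides: the energy is quadratic, so its rates `1 ±
2c` in `τ` are halved. The second bound says that growth is no slower than the exponent `1/2 - c`.
-/
theorem exists_real_growth (α : ℝ) : ∃ C : ℝ, 0 < C ∧ ∀ u v : ℝ → ℝ, IsRealModeSol α u v →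
    ∀ a b : ℝ, 0 ≤ a → a ≤ b →
      |u b| + jap b * |v b| ≤ C * (logWeight α a * logWeight α b) *
        (jap b / jap a) ^ (1 / 2 + rate α) * (|u a| + jap a * |v a|) ∧
      |u a| + jap a * |v a| ≤ C * (logWeight α a * logWeight α b) *
        (jap b / jap a) ^ (rate α - 1 / 2) * (|u b| + jap b * |v b|) := by
  obtain ⟨K, C, hK, hC, H⟩ := exists_energy α
  set c := rate α with hc
  have hc0 : 0 ≤ c := rate_nonneg α
  set M : ℝ := 2 ^ |2 * (1 / 2 + c)| * Real.exp (K * Real.pi) with hM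
  have hM1 : 1 ≤ M := one_le_mul_of_one_le_of_one_le
    (Real.one_le_rpow (by norm_num) (abs_nonneg _)) (Real.one_le_exp (by positivity))
  have hM2 : 2 ^ |2 * (c - 1 / 2)| * Real.exp (K * Real.pi) ≤ M := by
    rw [hM]
    refine mul_le_mul_of_nonneg_right (Real.rpow_le_rpow_of_exponent_le (by norm_num) ?_)
      (Real.exp_pos _).le
    rw [abs_of_nonneg (by positivity : 0 ≤ 2 * (1 / 2 + c)), abs_le]
    constructor <;> linarith
  refine ⟨C * M, by positivity, fun u v h a b ha hab => ?_⟩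
  obtain ⟨Q, Q', hd, hQ⟩ := H u v h
  have hb := ha.trans hab
  have hx : 0 < jap b / jap a := div_pos (jap_pos b) (jap_pos a)
  set x := jap b / jap a with hxdef
  have hLa := one_le_logWeight α a
  have hLb := one_le_logWeight α b
  have hea : 0 ≤ |u a| + jap a * |v a| := by have := jap_pos a; positivity
  have heb : 0 ≤ |u b| + jap b * |v b| := by have := jap_pos b; positivity
  have hxp : ∀ κ : ℝ, x ^ (2 * κ) = (x ^ κ) ^ 2 := fun κ => by
    rw [mul_comm, Real.rpow_mul hx.le, Real.rpow_two]
  obtain ⟨-, hQa, hQa'⟩ := hQ a ha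
  obtain ⟨-, hQb, hQb'⟩ := hQ b hb
  have hQ0 : ∀ s, 0 ≤ s → 0 ≤ Q s := fun s hs => by
    have h1 := (sq_nonneg _).trans (hQ s hs).2.2
    have h2 := one_le_logWeight α s
    exact nonneg_of_mul_nonneg_right h1 (by positivity)
  have harc : ∀ κ K' s : ℝ, HasDerivAt (fun s => κ * Real.arsinh s + K' * Real.arctan s)
      (κ / jap s + K' / (1 + s ^ 2)) s := fun κ K' s =>
    ((((hasDerivAt_arsinh s).const_mul κ).add ((Real.hasDerivAt_arctan s).const_mul K'))).congr_deriv
      (by rw [mul_one_div, div_eq_mul_inv κ])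
  refine ⟨?_, ?_⟩
  · have h1 := le_mul_exp_of_deriv_le hd (fun s _ => harc (2 * (1 / 2 + c)) K s) hab fun s hs => by
      have := (abs_le.1 (hQ s (ha.trans hs)).1).2
      have e : (2 * (1 / 2 + c) / jap s + K / (1 + s ^ 2)) * Q s =
        Q s / jap s + (2 * c / jap s + K / (1 + s ^ 2)) * Q s := by ring
      linarith
    have h2 := exp_arsinh_arctan_le hK (2 * (1 / 2 + c)) ha hb
    have h3 : Q b ≤ Q a * (M * x ^ (2 * (1 / 2 + c))) := by
      refine h1.trans (mul_le_mul_of_nonneg_left (le_trans (le_of_eq ?_) h2) (hQ0 a ha))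
      congr 1
      ring
    refine (pow_le_pow_iff_left₀ (by positivity) (by positivity) two_ne_zero).1 ?_
    calc _ ≤ C * logWeight α b ^ 2 * (Q a * (M * x ^ (2 * (1 / 2 + c)))) := by
          refine hQb'.trans ?_
          gcongr
      _ ≤ C * logWeight α b ^ 2 * (C * (logWeight α a * (|u a| + jap a * |v a|)) ^ 2 *
          (M * M * x ^ (2 * (1 / 2 + c)))) := by
        gcongr
        exact le_mul_of_one_le_left (by positivity) hM1
      _ = _ := by rw [hxp]; ring
  · have h1 := mul_exp_le_of_le_deriv hd (fun s _ => harc (-(2 * (c - 1 / 2))) (-K) s) hab fun s hs => by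
      have := (abs_le.1 (hQ s (ha.trans hs)).1).1
      have e : (-(2 * (c - 1 / 2)) / jap s + -K / (1 + s ^ 2)) * Q s =
        Q s / jap s - (2 * c / jap s + K / (1 + s ^ 2)) * Q s := by ring
      linarith
    have h2 := exp_arsinh_arctan_le hK (2 * (c - 1 / 2)) ha hb
    have h3 : Q a ≤ Q b * (M * x ^ (2 * (c - 1 / 2))) := by
      have h4 : Q a ≤ Q b * Real.exp (2 * (c - 1 / 2) * (Real.arsinh b - Real.arsinh a) +
          K * (Real.arctan b - Real.arctan a)) := by
        rw [← div_le_iff₀ (Real.exp_pos _), div_eq_mul_inv, ← Real.exp_neg]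
        refine le_trans (le_of_eq ?_) h1
        congr 2
        ring
      refine h4.trans (mul_le_mul_of_nonneg_left (h2.trans ?_) (hQ0 b hb))
      gcongr
    refine (pow_le_pow_iff_left₀ (by positivity) (by positivity) two_ne_zero).1 ?_
    calc _ ≤ C * logWeight α a ^ 2 * (Q b * (M * x ^ (2 * (c - 1 / 2)))) := by
          refine hQa'.trans ?_
          gcongr
      _ ≤ C * logWeight α a ^ 2 * (C * (logWeight α b * (|u b| + jap b * |v b|)) ^ 2 *
          (M * M * x ^ (2 * (c - 1 / 2)))) := by
        gcongr
        exact le_mul_of_one_le_left (by positivity) hM1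
      _ = _ := by rw [hxp]; ring

/-! ### Symmetries of the mode equation and propagation of complex modes. -/

namespace IsModeSol

variable {α : ℝ} {u v : ℝ → ℂ}

theorem re (h : IsModeSol α u v) : IsRealModeSol α (fun s => (u s).re) (fun s => (v s).re) where
  deriv_fst s := Complex.reCLM.hasFDerivAt.comp_hasDerivAt s (h.deriv_fst s)
  deriv_snd s := (Complex.reCLM.hasFDerivAt.comp_hasDerivAt s (h.deriv_snd s)).congr_deriv
    (by rw [← Complex.ofReal_neg, Complex.reCLM_apply, Complex.re_ofReal_mul])

theorem im (h : IsModeSol α u v) : IsRealModeSol α (fun s => (u s).im) (fun s => (v s).im) where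
  deriv_fst s := Complex.imCLM.hasFDerivAt.comp_hasDerivAt s (h.deriv_fst s)
  deriv_snd s := (Complex.imCLM.hasFDerivAt.comp_hasDerivAt s (h.deriv_snd s)).congr_deriv
    (by rw [← Complex.ofReal_neg, Complex.imCLM_apply, Complex.im_ofReal_mul])

theorem reflect (h : IsModeSol α u v) : IsModeSol α (fun s => u (-s)) (fun s => -v (-s)) where
  deriv_fst s := by
    refine ((h.deriv_fst (-s)).scomp s (hasDerivAt_neg s)).congr_deriv ?_
    simp
  deriv_snd s := by
    refine ((h.deriv_snd (-s)).scomp s (hasDerivAt_neg s)).neg.congr_deriv ?_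
    simp

theorem const_mul_add (h : IsModeSol α u v) {u' v' : ℝ → ℂ} (h' : IsModeSol α u' v') (a b : ℂ) :
    IsModeSol α (fun s => a * u s + b * u' s) (fun s => a * v s + b * v' s) where
  deriv_fst s := ((h.deriv_fst s).const_mul a).add ((h'.deriv_fst s).const_mul b)
  deriv_snd s := (((h.deriv_snd s).const_mul a).add ((h'.deriv_snd s).const_mul b)).congr_deriv
    (by ring)

theorem wronskian (h : IsModeSol α u v) {u' v' : ℝ → ℂ} (h' : IsModeSol α u' v') (a b : ℝ) :
    u a * v' a - v a * u' a = u b * v' b - v b * u' b := by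
  have hd : ∀ s, HasDerivAt (fun s => u s * v' s - v s * u' s) 0 s := fun s =>
    (((h.deriv_fst s).mul (h'.deriv_snd s)).sub ((h.deriv_snd s).mul (h'.deriv_fst s))).congr_deriv
      (by ring)
  exact is_const_of_deriv_eq_zero (fun s => (hd s).differentiableAt) (fun s => (hd s).deriv) a b

theorem conj (h : IsModeSol α u v) :
    IsModeSol α (fun s => (starRingEnd ℂ) (u s)) (fun s => (starRingEnd ℂ) (v s)) where
  deriv_fst s := Complex.conjCLE.toContinuousLinearMap.hasFDerivAt.comp_hasDerivAt s (h.deriv_fst s)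
  deriv_snd s := (Complex.conjCLE.toContinuousLinearMap.hasFDerivAt.comp_hasDerivAt s
    (h.deriv_snd s)).congr_deriv (by simp)

end IsModeSol

theorem exists_growth (α : ℝ) : ∃ C : ℝ, 0 < C ∧ ∀ u v : ℝ → ℂ, IsModeSol α u v →
    ∀ a b : ℝ, 0 ≤ a → a ≤ b →
      ‖u b‖ + jap b * ‖v b‖ ≤ C * (logWeight α a * logWeight α b) *
        (jap b / jap a) ^ (1 / 2 + rate α) * (‖u a‖ + jap a * ‖v a‖) ∧
      ‖u a‖ + jap a * ‖v a‖ ≤ C * (logWeight α a * logWeight α b) *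
        (jap b / jap a) ^ (rate α - 1 / 2) * (‖u b‖ + jap b * ‖v b‖) := by
  obtain ⟨C, hC, H⟩ := exists_real_growth α
  refine ⟨2 * C, by positivity, fun u v h a b ha hab => ?_⟩
  obtain ⟨h1, h2⟩ := H _ _ h.re a b ha hab
  obtain ⟨h3, h4⟩ := H _ _ h.im a b ha hab
  have hle : ∀ s, ‖u s‖ + jap s * ‖v s‖ ≤ (|(u s).re| + jap s * |(v s).re|) +
      (|(u s).im| + jap s * |(v s).im|) := fun s => by
    have := mul_le_mul_of_nonneg_left (Complex.norm_le_abs_re_add_abs_im (v s)) (jap_pos s).le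
    linarith [Complex.norm_le_abs_re_add_abs_im (u s)]
  have hge : ∀ s, (|(u s).re| + jap s * |(v s).re|) + (|(u s).im| + jap s * |(v s).im|) ≤
      2 * (‖u s‖ + jap s * ‖v s‖) := fun s => by
    have h5 := mul_le_mul_of_nonneg_left (Complex.abs_re_le_norm (v s)) (jap_pos s).le
    have h6 := mul_le_mul_of_nonneg_left (Complex.abs_im_le_norm (v s)) (jap_pos s).le
    linarith [Complex.abs_re_le_norm (u s), Complex.abs_im_le_norm (u s)]
  have hLa := one_le_logWeight α a
  have hLb := one_le_logWeight α b
  have hja := jap_pos a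
  have hjb := jap_pos b
  constructor
  · calc _ ≤ _ := hle b
      _ ≤ _ := add_le_add h1 h3
      _ = C * (logWeight α a * logWeight α b) * (jap b / jap a) ^ (1 / 2 + rate α) *
        ((|(u a).re| + jap a * |(v a).re|) + (|(u a).im| + jap a * |(v a).im|)) := by ring
      _ ≤ C * (logWeight α a * logWeight α b) * (jap b / jap a) ^ (1 / 2 + rate α) *
        (2 * (‖u a‖ + jap a * ‖v a‖)) := by gcongr; exact hge a
      _ = _ := by ring
  · calc _ ≤ _ := hle a
      _ ≤ _ := add_le_add h2 h4
      _ = C * (logWeight α a * logWeight α b) * (jap b / jap a) ^ (rate α - 1 / 2) *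
        ((|(u b).re| + jap b * |(v b).re|) + (|(u b).im| + jap b * |(v b).im|)) := by ring
      _ ≤ C * (logWeight α a * logWeight α b) * (jap b / jap a) ^ (rate α - 1 / 2) *
        (2 * (‖u b‖ + jap b * ‖v b‖)) := by gcongr; exact hge b
      _ = _ := by ring

/-- The coefficient is even in `s`, so moving towards `0` from the left is the reflection of running
backwards on the right half line. -/
theorem exists_backward_growth (α : ℝ) : ∃ C : ℝ, 0 < C ∧ ∀ u v : ℝ → ℂ, IsModeSol α u v →
    ∀ a b : ℝ, a ≤ b → b ≤ 0 →
      ‖u b‖ + jap b * ‖v b‖ ≤ C * (logWeight α a * logWeight α b) *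
        (jap a / jap b) ^ (rate α - 1 / 2) * (‖u a‖ + jap a * ‖v a‖) := by
  obtain ⟨C, hC, H⟩ := exists_growth α
  refine ⟨C, hC, fun u v h a b hab hb => ?_⟩
  have := (H _ _ h.reflect (-b) (-a) (by linarith) (by linarith)).2
  simpa [jap_neg, logWeight_neg, mul_comm (logWeight α b)] using this

/-- A mode with `ξ/k > 0` starts at negative `s` and may cross the critical time `s = 0`; the third
case chains the two half-line bounds at `0`, where bracket and logarithmic weight are `1`. -/
theorem exists_propagation (α : ℝ) : ∃ C : ℝ, 0 < C ∧ ∀ u v : ℝ → ℂ, IsModeSol α u v →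
    ∀ a b : ℝ, a ≤ b →
      (0 ≤ a → ‖u b‖ + jap b * ‖v b‖ ≤ C * (logWeight α a * logWeight α b) *
        (jap b ^ (1 / 2 + rate α) * jap a ^ (-(1 / 2 + rate α))) * (‖u a‖ + jap a * ‖v a‖)) ∧
      (b ≤ 0 → ‖u b‖ + jap b * ‖v b‖ ≤ C * (logWeight α a * logWeight α b) *
        (jap b ^ (1 / 2 - rate α) * jap a ^ (rate α - 1 / 2)) * (‖u a‖ + jap a * ‖v a‖)) ∧
      (a ≤ 0 → 0 ≤ b → ‖u b‖ + jap b * ‖v b‖ ≤ C * (logWeight α a * logWeight α b) *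
        (jap b ^ (1 / 2 + rate α) * jap a ^ (rate α - 1 / 2)) * (‖u a‖ + jap a * ‖v a‖)) := by
  obtain ⟨C, hC, H⟩ := exists_growth α
  obtain ⟨D, hD, H'⟩ := exists_backward_growth α
  refine ⟨C + D + C * D, by positivity, fun u v h a b hab => ?_⟩
  have hja := jap_pos a
  have hjb := jap_pos b
  have hLa := one_le_logWeight α a
  have hLb := one_le_logWeight α b
  have hCD : 0 < C * D := by positivity
  refine ⟨fun ha => ?_, fun hb => ?_, fun ha hb => ?_⟩
  · refine (H u v h a b ha hab).1.trans ?_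
    rw [Real.div_rpow hjb.le hja.le, div_eq_mul_inv, Real.rpow_neg hja.le]
    gcongr
    linarith
  · refine (H' u v h a b hab hb).trans ?_
    rw [Real.div_rpow hja.le hjb.le, div_eq_mul_inv, ← Real.rpow_neg hjb.le, neg_sub,
      mul_comm (jap a ^ _)]
    gcongr
    linarith
  · have h1 := H' u v h a 0 ha le_rfl
    have h2 := (H u v h 0 b le_rfl hb).1
    rw [jap_zero, logWeight_zero, div_one, mul_one, one_mul] at h1
    rw [jap_zero, logWeight_zero, div_one, one_mul, one_mul] at h2
    calc _ ≤ _ := h2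
      _ ≤ C * logWeight α b * jap b ^ (1 / 2 + rate α) *
        (D * logWeight α a * jap a ^ (rate α - 1 / 2) * (‖u a‖ + jap a * ‖v a‖)) := by
          gcongr
      _ = C * D * (logWeight α a * logWeight α b) *
        (jap b ^ (1 / 2 + rate α) * jap a ^ (rate α - 1 / 2)) * (‖u a‖ + jap a * ‖v a‖) := by ring
      _ ≤ _ := by
        gcongr
        linarith

/-! ### Decay in `t`, uniform in the starting point. -/

theorem one_le_logFactor (α : ℝ) {t : ℝ} (ht : 1 ≤ t) : 1 ≤ logFactor α t := by
  unfold logFactor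
  split_ifs
  · linarith [Real.log_nonneg ht]
  · rfl

theorem jap_add_le {t : ℝ} (ht : 1 ≤ t) (s : ℝ) : jap (s + t) ≤ 2 * t * jap s := by
  have h1 := jap_le_add s t
  rw [abs_of_nonneg (by linarith)] at h1
  nlinarith [one_le_jap s]

theorem le_jap_mul_jap (s t : ℝ) : t ≤ 2 * jap s * jap (s + t) := by
  have h1 := le_jap (s + t)
  have h2 := neg_abs_le s
  have h3 := abs_le_jap s
  nlinarith [one_le_jap s, one_le_jap (s + t)]

theorem arsinh_abs_le (s : ℝ) : Real.arsinh |s| ≤ Real.log (2 * jap s) := by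
  have h : Real.arsinh |s| = Real.log (|s| + jap |s|) := rfl
  have h2 : jap |s| = jap s := by simp [jap]
  rw [h, h2]
  have := jap_pos s
  exact Real.log_le_log (by positivity) (by linarith [abs_le_jap s])

/-- Only one logarithm of `t` may survive. The logarithms of `⟨s⟩` are paid for by half a power of
`⟨s⟩`, which `exists_decay_bound` has to spare. -/
theorem logWeight_mul_le (α s : ℝ) {t : ℝ} (ht : 1 ≤ t) :
    logWeight α s * logWeight α (s + t) ≤
      150 * (logFactor α t * if α = 1 / 4 then jap s ^ (1 / 2 : ℝ) else 1) := by
  unfold logWeight logFactor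
  split_ifs with h
  · have hj := one_le_jap s
    have hj0 := jap_pos s
    have h0 := Real.log_nonneg ht
    have h1 := Real.log_nonneg hj
    have h2 : Real.log 2 ≤ 1 := by linarith [Real.log_two_lt_d9]
    have h3 : 1 + Real.arsinh |s| ≤ 2 * (1 + Real.log (jap s)) := by
      have := arsinh_abs_le s
      rw [Real.log_mul two_ne_zero hj0.ne'] at this
      linarith
    have h4 : 1 + Real.arsinh |s + t| ≤ 3 * ((1 + Real.log t) * (1 + Real.log (jap s))) := by
      have h5 := arsinh_abs_le (s + t)
      have ht0 : 0 < t := by linarith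
      have h6 : Real.log (2 * jap (s + t)) ≤ Real.log (2 * (2 * t * jap s)) := by
        have := jap_pos (s + t)
        refine Real.log_le_log (by positivity) ?_
        gcongr
        exact jap_add_le ht s
      have h7 : Real.log (2 * (2 * t * jap s)) =
          Real.log 2 + (Real.log 2 + Real.log t + Real.log (jap s)) := by
        rw [Real.log_mul two_ne_zero (by positivity), Real.log_mul (by positivity) hj0.ne',
          Real.log_mul two_ne_zero ht0.ne']
      nlinarith [mul_nonneg h0 h1]
    have h7 : 1 + Real.log (jap s) ≤ 5 * jap s ^ (1 / 4 : ℝ) := by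
      have h8 := Real.log_le_rpow_div hj0.le (ε := 1 / 4) (by norm_num)
      have h9 := Real.one_le_rpow hj (z := 1 / 4) (by norm_num)
      linarith
    have h10 : jap s ^ (1 / 2 : ℝ) = (jap s ^ (1 / 4 : ℝ)) ^ 2 := by
      rw [← Real.rpow_two, ← Real.rpow_mul hj0.le]; norm_num
    have h11 : 0 ≤ 1 + Real.arsinh |s + t| := by
      linarith [Real.arsinh_nonneg_iff.2 (abs_nonneg (s + t))]
    calc _ ≤ (2 * (1 + Real.log (jap s))) * (3 * ((1 + Real.log t) * (1 + Real.log (jap s)))) := by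
          gcongr
      _ = 6 * (1 + Real.log t) * (1 + Real.log (jap s)) ^ 2 := by ring
      _ ≤ 6 * (1 + Real.log t) * (5 * jap s ^ (1 / 4 : ℝ)) ^ 2 := by gcongr
      _ = _ := by rw [h10]; ring
  · norm_num

/-- The case `j = 1` serves `θ` and `v₁`, the case `j = 2` serves `v₂`. In the exponent of `⟨s⟩`,
the `j` pays for modes that are near `s = 0` at time `t`, and `c - 1/2` for the amplification of a
mode on its way to `s = 0`. -/
theorem exists_decay_bound (α : ℝ) {j : ℝ} (hj : 1 ≤ j) : ∃ C : ℝ, 0 < C ∧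
    ∀ u v : ℝ → ℂ, IsModeSol α u v → ∀ s t : ℝ, 1 ≤ t →
      (‖u (s + t)‖ + jap (s + t) * ‖v (s + t)‖) * jap (s + t) ^ (-j) ≤
        C * logFactor α t * t ^ (1 / 2 + rate α - j) *
          (jap s ^ max j (rate α - 1 / 2) * (‖u s‖ + jap s * ‖v s‖)) := by
  obtain ⟨C, hC, H⟩ := exists_propagation α
  set c := rate α with hc
  have hc0 : 0 ≤ c := rate_nonneg α
  set A : ℝ := 2 ^ |1 / 2 + c - j| with hA
  have hA1 : 1 ≤ A := Real.one_le_rpow (by norm_num) (abs_nonneg _)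
  refine ⟨C * 150 * A, by positivity, fun u v h s t ht => ?_⟩
  obtain ⟨h1, h2, h3⟩ := H u v h s (s + t) (by linarith)
  have hLL := logWeight_mul_le α s ht
  have hL1 := one_le_logWeight α s
  have hL2 := one_le_logWeight α (s + t)
  have hl := one_le_logFactor α ht
  set E := ‖u s‖ + jap s * ‖v s‖
  set E' := ‖u (s + t)‖ + jap (s + t) * ‖v (s + t)‖
  set r := jap (s + t) with hr
  set r₀ := jap s with hr₀
  have hr1 : 1 ≤ r := one_le_jap _
  have hr₀1 : 1 ≤ r₀ := one_le_jap _
  have hr0 : 0 < r := by linarith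
  have hr₀0 : 0 < r₀ := by linarith
  have ht0 : 0 < t := by linarith
  have hrj : r ^ (1 / 2 + c - j) = r ^ (1 / 2 + c) * r ^ (-j) := by
    rw [← Real.rpow_add hr0, sub_eq_add_neg]
  have hE : 0 ≤ E := by positivity
  have hE' : 0 ≤ E' := by positivity
  -- The two cases differ in whether `⟨s+t⟩^(1/2+c-j)` decays, so that a lower bound on `⟨s+t⟩` is
  -- needed, or grows, so that an upper bound is.
  rcases lt_or_ge (1 / 2 + c) j with hlt | hge
  · have crude : E' ≤ C * (logWeight α s * logWeight α (s + t)) *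
        (r ^ (1 / 2 + c) * r₀ ^ (c - 1 / 2)) * E := by
      rcases le_total 0 s with hs | hs
      · refine (h1 hs).trans ?_
        gcongr
        linarith
      · rcases le_total 0 (s + t) with hst | hst
        · exact h3 hs hst
        · refine (h2 hst).trans ?_
          gcongr
          linarith
    -- `t ≤ 2 ⟨s⟩ ⟨s+t⟩` turns decay in `⟨s+t⟩` into decay in `t` at the price of powers of `⟨s⟩`.
    have hrt : r ^ (1 / 2 + c - j) ≤ A * t ^ (1 / 2 + c - j) * r₀ ^ (j - (1 / 2 + c)) := by
      have h5 : t / (2 * r₀) ≤ r := by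
        rw [div_le_iff₀ (by positivity)]
        have := le_jap_mul_jap s t
        rw [← hr, ← hr₀] at this
        linarith
      refine (Real.rpow_le_rpow_of_nonpos (by positivity) h5 (by linarith)).trans (le_of_eq ?_)
      rw [Real.div_rpow ht0.le (by positivity), Real.mul_rpow (by norm_num) hr₀0.le, hA,
        abs_of_neg (by linarith), Real.rpow_neg (by norm_num), ← neg_sub (1 / 2 + c) j,
        Real.rpow_neg hr₀0.le]
      field_simp
    -- The total cost is only `j - 1`, hence the room for the extra `1/2` coming from the
    -- logarithms.
    have hG : (if α = 1 / 4 then r₀ ^ (1 / 2 : ℝ) else 1) * r₀ ^ (j - 1) ≤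
        r₀ ^ max j (c - 1 / 2) := by
      split_ifs
      · rw [← Real.rpow_add hr₀0]
        exact Real.rpow_le_rpow_of_exponent_le hr₀1 (le_trans (by linarith) (le_max_left _ _))
      · rw [one_mul]
        exact Real.rpow_le_rpow_of_exponent_le hr₀1 (le_trans (by linarith) (le_max_left _ _))
    calc E' * r ^ (-j) ≤ C * (logWeight α s * logWeight α (s + t)) *
        (r ^ (1 / 2 + c) * r₀ ^ (c - 1 / 2)) * E * r ^ (-j) := by gcongr
      _ = C * (logWeight α s * logWeight α (s + t)) *
        (r ^ (1 / 2 + c - j) * r₀ ^ (c - 1 / 2)) * E := by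
          rw [hrj]; ring
      _ ≤ C * (150 * (logFactor α t * if α = 1 / 4 then r₀ ^ (1 / 2 : ℝ) else 1)) *
        ((A * t ^ (1 / 2 + c - j) * r₀ ^ (j - (1 / 2 + c))) * r₀ ^ (c - 1 / 2)) * E := by gcongr
      _ = C * 150 * A * logFactor α t * t ^ (1 / 2 + c - j) *
        (((if α = 1 / 4 then r₀ ^ (1 / 2 : ℝ) else 1) * r₀ ^ (j - 1)) * E) := by
          rw [show j - 1 = (j - (1 / 2 + c)) + (c - 1 / 2) by ring, Real.rpow_add hr₀0]; ring
      _ ≤ _ := by gcongr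
  · have hα : α ≠ 1 / 4 := by
      rintro rfl
      rw [rate_of_ge le_rfl] at hc
      linarith
    have hLL' : logWeight α s * logWeight α (s + t) ≤ 150 * logFactor α t := by
      rwa [if_neg hα, mul_one] at hLL
    have main : ∀ x : ℝ, 0 ≤ x → E' ≤ C * (logWeight α s * logWeight α (s + t)) * x * E →
        x * r ^ (-j) ≤ A * t ^ (1 / 2 + c - j) * r₀ ^ max j (c - 1 / 2) →
        E' * r ^ (-j) ≤ C * 150 * A * logFactor α t * t ^ (1 / 2 + c - j) *
          (r₀ ^ max j (c - 1 / 2) * E) := by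
      intro x hx hx1 hx2
      calc E' * r ^ (-j) ≤ C * (logWeight α s * logWeight α (s + t)) * x * E * r ^ (-j) := by gcongr
        _ = C * (logWeight α s * logWeight α (s + t)) * (x * r ^ (-j)) * E := by ring
        _ ≤ C * (150 * logFactor α t) * (A * t ^ (1 / 2 + c - j) * r₀ ^ max j (c - 1 / 2)) * E := by
          gcongr
        _ = _ := by ring
    have hA2 : A = 2 ^ (1 / 2 + c - j) := by rw [hA, abs_of_nonneg (by linarith)]
    rcases le_total 0 s with hs | hs
    · refine main _ (by positivity) (h1 hs) ?_
      have hrt : r ^ (1 / 2 + c - j) ≤ A * t ^ (1 / 2 + c - j) * r₀ ^ (1 / 2 + c - j) := by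
        rw [hA2, ← Real.mul_rpow (by norm_num) ht0.le, ← Real.mul_rpow (by positivity) hr₀0.le]
        exact Real.rpow_le_rpow hr0.le (jap_add_le ht s) (by linarith)
      calc r ^ (1 / 2 + c) * r₀ ^ (-(1 / 2 + c)) * r ^ (-j)
          = r ^ (1 / 2 + c - j) * r₀ ^ (-(1 / 2 + c)) := by
            rw [hrj]; ring
        _ ≤ (A * t ^ (1 / 2 + c - j) * r₀ ^ (1 / 2 + c - j)) * r₀ ^ (-(1 / 2 + c)) := by gcongr
        _ = A * t ^ (1 / 2 + c - j) * r₀ ^ (-j) := by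
            rw [mul_assoc, ← Real.rpow_add hr₀0]; ring_nf
        _ ≤ _ := by
            gcongr
            exact le_trans (by linarith) (le_max_left _ _)
    · have hmax : r₀ ^ (c - 1 / 2) ≤ r₀ ^ max j (c - 1 / 2) :=
        Real.rpow_le_rpow_of_exponent_le hr₀1 (le_max_right _ _)
      rcases le_total 0 (s + t) with hst | hst
      · refine main _ (by positivity) (h3 hs hst) ?_
        have hrt : r ^ (1 / 2 + c - j) ≤ A * t ^ (1 / 2 + c - j) := by
          rw [hA2, ← Real.mul_rpow (by norm_num) ht0.le]
          refine Real.rpow_le_rpow hr0.le ?_ (by linarith)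
          have := jap_le_add 0 (s + t)
          rw [zero_add, jap_zero, abs_of_nonneg hst] at this
          linarith
        calc r ^ (1 / 2 + c) * r₀ ^ (c - 1 / 2) * r ^ (-j)
            = r ^ (1 / 2 + c - j) * r₀ ^ (c - 1 / 2) := by
              rw [hrj]; ring
          _ ≤ _ := by gcongr
      · refine main _ (by positivity) (h2 hst) ?_
        -- Before the critical time there is no decay to exploit, but none is required: here the
        -- exponent of `t` is nonnegative.
        have hx1 : r ^ (1 / 2 - c) * r ^ (-j) ≤ 1 := by
          rw [← Real.rpow_add hr0]
          exact Real.rpow_le_one_of_one_le_of_nonpos hr1 (by linarith)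
        have hx2 : 1 ≤ A * t ^ (1 / 2 + c - j) :=
          one_le_mul_of_one_le_of_one_le hA1 (Real.one_le_rpow ht (by linarith))
        calc r ^ (1 / 2 - c) * r₀ ^ (c - 1 / 2) * r ^ (-j)
            = (r ^ (1 / 2 - c) * r ^ (-j)) * r₀ ^ (c - 1 / 2) := by ring
          _ ≤ (A * t ^ (1 / 2 + c - j)) * r₀ ^ (c - 1 / 2) := mul_le_mul_of_nonneg_right (hx1.trans hx2) (by positivity)
          _ ≤ _ := by gcongr

/-! ### Crude exponential bounds and a fundamental system. -/

theorem norm_coeff_le (α s : ℝ) : |α / (1 + s ^ 2)| ≤ |α| := by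
  rw [abs_div, abs_of_pos (by positivity : 0 < 1 + s ^ 2)]
  exact div_le_self (abs_nonneg _) (by nlinarith)

/-- Far from sharp, but uniform in the starting point, hence in the frequency; this suffices to
build solutions in `L²` and to keep Sobolev norms finite. -/
theorem IsModeSol.norm_le {α : ℝ} {u v : ℝ → ℂ} (h : IsModeSol α u v) {a b : ℝ} (hab : a ≤ b) :
    ‖u b‖ + ‖v b‖ ≤ 2 * Real.exp ((1 + |α|) * (b - a)) * (‖u a‖ + ‖v a‖) := by
  have hd : ∀ s, HasDerivAt (fun s => (u s, v s)) (v s, -(α / (1 + s ^ 2) : ℝ) * u s) s := fun s =>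
    (h.deriv_fst s).prodMk (h.deriv_snd s)
  have h1 := norm_le_gronwallBound_of_norm_deriv_right_le (f := fun s => (u s, v s))
    (f' := fun s => (v s, -(α / (1 + s ^ 2) : ℝ) * u s)) (δ := ‖(u a, v a)‖) (K := 1 + |α|) (ε := 0)
    (a := a) (b := b) (fun s _ => (hd s).continuousAt.continuousWithinAt)
    (fun s _ => (hd s).hasDerivWithinAt) le_rfl (fun s _ => by
      have h2 := norm_fst_le (u s, v s)
      have h3 := norm_snd_le (u s, v s)
      dsimp only at h2 h3
      have h4 := norm_coeff_le α s
      have h5 := abs_nonneg α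
      have h6 := norm_nonneg (u s, v s)
      rw [add_zero, Prod.norm_def]
      refine max_le ?_ ?_
      · dsimp only; nlinarith
      · dsimp only
        rw [norm_mul, norm_neg, Complex.norm_real, Real.norm_eq_abs]
        have := mul_le_mul h4 h2 (norm_nonneg _) h5
        linarith) b ⟨hab, le_rfl⟩
  rw [gronwallBound_ε0] at h1
  have h2 := norm_fst_le (u b, v b)
  have h3 := norm_snd_le (u b, v b)
  have h4 : ‖(u a, v a)‖ ≤ ‖u a‖ + ‖v a‖ := by
    rw [Prod.norm_def]; exact max_le (by simp) (by simp)
  have h5 := mul_le_mul_of_nonneg_right h4 (Real.exp_pos ((1 + |α|) * (b - a))).le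
  dsimp only at h2 h3
  linarith

/-- A fundamental system of solutions, normalized at the origin. -/
structure IsFundamental (α : ℝ) (φ φ' ψ ψ' : ℝ → ℂ) : Prop where
  fst : IsModeSol α φ φ'
  snd : IsModeSol α ψ ψ'
  wronskian : ∀ s, φ s * ψ' s - φ' s * ψ s = 1

theorem exists_isFundamental (α : ℝ) : ∃ φ φ' ψ ψ', IsFundamental α φ φ' ψ ψ' := by
  obtain ⟨φ, φ', h1, h2, h3⟩ := exists_isModeSol_zero α 1 0
  obtain ⟨ψ, ψ', h4, h5, h6⟩ := exists_isModeSol_zero α 0 1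
  refine ⟨φ, φ', ψ, ψ', h1, h4, fun s => ?_⟩
  rw [h1.wronskian h4 s 0, h2, h3, h5, h6]
  ring

/-! ### Lower bounds for growing modes. -/

/-- Comparison with `(s+d)^p`, `p = 1/2 + c`, an exact solution of the equation with coefficient
`α/(s+d)²`. The shift `d` is chosen by the sign of `α` so that this coefficient dominates the true
one. -/
theorem IsRealModeSol.power_lower_bound {α : ℝ} (hα : α ≤ 1 / 4) {u v : ℝ → ℝ}
    (h : IsRealModeSol α u v) {a : ℝ} (ha : 1 ≤ a) (hu : u a = 1) (hv : v a = 1 / 2 + rate α) :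
    ∃ d : ℝ, 0 ≤ d ∧ d ≤ 1 ∧ ∀ s, a ≤ s → ((s + d) / (a + d)) ^ (1 / 2 + rate α) ≤ |u s| ∧
      (1 / 2 + rate α) * |u s| ≤ (s + d) * |v s| := by
  set p := 1 / 2 + rate α with hp
  have hp0 : 0 < p := by have := rate_nonneg α; positivity
  have hpα : p - p ^ 2 = α := by
    have := rate_sq_of_le hα
    rw [hp]; linear_combination -this
  obtain ⟨d, hd0, hd1, hκ⟩ : ∃ d : ℝ, 0 ≤ d ∧ d ≤ 1 ∧
      ∀ s : ℝ, a ≤ s → α / (1 + s ^ 2) ≤ α / (s + d) ^ 2 := by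
    rcases le_total 0 α with h0 | h0
    · refine ⟨0, le_rfl, zero_le_one, fun s hs => ?_⟩
      have : 0 < s := by linarith
      rw [add_zero]
      gcongr
      linarith
    · refine ⟨1, zero_le_one, le_rfl, fun s hs => ?_⟩
      have : 0 < s := by linarith
      rw [div_le_div_iff₀ (by positivity) (by positivity)]
      nlinarith
  refine ⟨d, hd0, hd1, fun s hs => ?_⟩
  have hpos : ∀ s, a ≤ s → 0 < s + d := fun s hs => by linarith
  have hlin : ∀ s : ℝ, HasDerivAt (fun s => s + d) 1 s := fun s => (hasDerivAt_id s).add_const d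
  have hP : ∀ s, a ≤ s → HasDerivAt (fun s => u s * (v s - p * u s / (s + d)))
      (v s * (v s - p * u s / (s + d)) + u s * (-(α / (1 + s ^ 2)) * u s -
        (p * v s * (s + d) - p * u s * 1) / (s + d) ^ 2)) s := fun s hs =>
    (h.deriv_fst s).mul ((h.deriv_snd s).sub
      (((h.deriv_fst s).const_mul p).div (hlin s) (hpos s hs).ne'))
  -- The derivative is a square plus `u²` times the difference of the two coefficients, because `p -
  -- p² = α`. The initial value is nonnegative since `a + d ≥ 1`.
  have hmono : MonotoneOn (fun s => u s * (v s - p * u s / (s + d))) (Set.Ici a) := by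
    refine monotoneOn_of_deriv_nonneg (convex_Ici a)
      (fun s hs => (hP s hs).continuousAt.continuousWithinAt)
      (fun s hs => (hP s (interior_subset hs)).differentiableAt.differentiableWithinAt)
      fun s hs => ?_
    have hs' : a ≤ s := interior_subset hs
    have hsd := hpos s hs'
    rw [(hP s hs').deriv]
    have e : v s * (v s - p * u s / (s + d)) + u s * (-(α / (1 + s ^ 2)) * u s -
        (p * v s * (s + d) - p * u s * 1) / (s + d) ^ 2) =
        (v s - p * u s / (s + d)) ^ 2 + u s ^ 2 * ((p - p ^ 2) / (s + d) ^ 2 - α / (1 + s ^ 2)) := by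
      field_simp
      ring
    rw [e, hpα]
    have := sub_nonneg.2 (hκ s hs')
    positivity
  have hP0 : ∀ s, a ≤ s → p / (s + d) * u s ^ 2 ≤ u s * v s := fun s hs => by
    have h1 : u a * (v a - p * u a / (a + d)) ≤ u s * (v s - p * u s / (s + d)) :=
      hmono Set.self_mem_Ici hs hs
    rw [hu, hv, one_mul, mul_one] at h1
    have h2 : p / (a + d) ≤ p := div_le_self hp0.le (by linarith)
    have h3 : p / (s + d) * u s ^ 2 = u s * (p * u s / (s + d)) := by ring
    rw [h3]
    linarith
  have hgrow := mul_exp_le_of_le_deriv (Q := fun s => u s ^ 2) (Q' := fun s => 2 * u s * v s)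
    (h := fun s => 2 * p * Real.log (s + d)) (h' := fun s => 2 * p * (1 / (s + d)))
    (fun s => ((h.deriv_fst s).pow 2).congr_deriv (by simp))
    (fun s hs => ((hlin s).log (hpos s hs).ne').const_mul (2 * p)) hs
    (fun s hs => by
      have := hP0 s hs
      have e : 2 * p * (1 / (s + d)) * u s ^ 2 = 2 * (p / (s + d) * u s ^ 2) := by ring
      linarith)
  have hsd := hpos s hs
  have had := hpos a le_rfl
  have hu1 : ((s + d) / (a + d)) ^ p ≤ |u s| := by
    refine (pow_le_pow_iff_left₀ (by positivity) (abs_nonneg _) two_ne_zero).1 ?_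
    rw [sq_abs]
    refine le_trans (le_of_eq ?_) hgrow
    rw [hu, one_pow, one_mul, ← Real.rpow_natCast, ← Real.rpow_mul (by positivity),
      Real.rpow_def_of_pos (by positivity), Real.log_div hsd.ne' had.ne']
    push_cast
    ring_nf
  refine ⟨hu1, ?_⟩
  have hu0 : 0 < |u s| := lt_of_lt_of_le (by positivity) hu1
  have h1 := (hP0 s hs).trans (le_abs_self _)
  rw [abs_mul, ← sq_abs (u s), div_mul_eq_mul_div, div_le_iff₀ hsd] at h1
  nlinarith

/-- The initial value of `u' / u` of the growing solutions used for the lower bounds. -/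
def growthSlope (α : ℝ) : ℂ := if α ≤ 1 / 4 then ((1 / 2 + rate α : ℝ) : ℂ) else Complex.I

theorem exists_lower_bound_aux (α : ℝ) : ∃ c : ℝ, 0 < c ∧ ∀ u v : ℝ → ℂ, IsModeSol α u v →
    ∀ a : ℝ, 1 ≤ a → a ≤ 3 → u a = 1 → v a = growthSlope α → ∀ t : ℝ, 1 ≤ t →
      c * t ^ (1 / 2 + rate α) ≤ ‖u (a + t)‖ ∧ c * t ^ (rate α - 1 / 2) ≤ ‖v (a + t)‖ := by
  by_cases hα : α ≤ 1 / 4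
  · set p := 1 / 2 + rate α with hp
    have hp0 : 0 < p := by have := rate_nonneg α; positivity
    refine ⟨min ((1 / 4) ^ p) (p / 5 * (1 / 4) ^ p), by positivity,
      fun u v h a ha ha3 hu hv t ht => ?_⟩
    rw [growthSlope, if_pos hα] at hv
    obtain ⟨d, hd0, hd1, H⟩ := h.re.power_lower_bound hα ha (by simp [hu])
      (by simp only [hv, Complex.ofReal_re])
    obtain ⟨h1, h2⟩ := H (a + t) (by linarith)
    rw [← hp] at h1 h2
    have ht0 : 0 < t := by linarith
    have h3 : (1 / 4) ^ p * t ^ p ≤ |(u (a + t)).re| := by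
      refine le_trans ?_ h1
      rw [← Real.mul_rpow (by norm_num) ht0.le]
      refine Real.rpow_le_rpow (by positivity) ?_ hp0.le
      rw [le_div_iff₀ (by linarith)]
      nlinarith
    refine ⟨?_, ?_⟩
    · refine le_trans ?_ (h3.trans (Complex.abs_re_le_norm _))
      gcongr
      exact min_le_left _ _
    · refine le_trans ?_ (Complex.abs_re_le_norm _)
      have h4 : t ^ p = t * t ^ (rate α - 1 / 2) := by
        rw [show p = 1 + (rate α - 1 / 2) by rw [hp]; ring, Real.rpow_add ht0, Real.rpow_one]
      have h5 : (a + t + d) * |(v (a + t)).re| ≤ 5 * t * |(v (a + t)).re| := by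
        gcongr
        linarith
      have h6 : p * ((1 / 4) ^ p * t ^ p) ≤ 5 * t * |(v (a + t)).re| :=
        (mul_le_mul_of_nonneg_left h3 hp0.le).trans (h2.trans h5)
      rw [h4] at h6
      have h7 : p / 5 * (1 / 4) ^ p * t ^ (rate α - 1 / 2) ≤ |(v (a + t)).re| := by
        refine le_of_mul_le_mul_left ?_ (by positivity : 0 < 5 * t)
        calc _ = p * ((1 / 4) ^ p * (t * t ^ (rate α - 1 / 2))) := by ring
          _ ≤ _ := h6
      refine le_trans ?_ h7
      gcongr
      exact min_le_right _ _
  · obtain ⟨C, hC, H⟩ := exists_growth α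
    have hr : rate α = 0 := rate_of_ge (le_of_not_ge hα)
    refine ⟨1 / (5 * C * 8), by positivity, fun u v h a ha ha3 hu hv t ht => ?_⟩
    rw [growthSlope, if_neg hα] at hv
    have hα' : α ≠ 1 / 4 := fun h => hα h.le
    have h1 := (H u v h a (a + t) (by linarith) (by linarith)).1
    have hW := h.wronskian h.conj (a + t) a
    simp only [hu, hv, logWeight, if_neg hα', hr, mul_one, add_zero, norm_one, Complex.norm_I] at h1
    simp only [hu, hv, map_one, Complex.conj_I] at hW
    -- For `α > 1/4` the initial slope `i` makes the Wronskian with the conjugate solution equal to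
    -- `-2i`; it is conserved, so `u` and `v` cannot both be small.
    have hW2 : 1 ≤ ‖u (a + t)‖ * ‖v (a + t)‖ := by
      have h2 : ‖u (a + t) * (starRingEnd ℂ) (v (a + t)) - v (a + t) * (starRingEnd ℂ) (u (a + t))‖
          = 2 := by
        rw [hW, show (1 * -Complex.I - Complex.I * 1 : ℂ) = -(2 * Complex.I) by ring]
        simp
      have h3 := norm_sub_le (u (a + t) * (starRingEnd ℂ) (v (a + t)))
        (v (a + t) * (starRingEnd ℂ) (u (a + t)))
      rw [h2, norm_mul, norm_mul, RCLike.norm_conj, RCLike.norm_conj] at h3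
      linarith
    set r := jap (a + t) with hrdef
    have hr1 : 1 ≤ r := one_le_jap _
    have hr0 : 0 < r := by linarith
    have hja1 := one_le_jap a
    have hja : jap a ≤ 4 := by
      have := jap_le_add 0 a
      rw [zero_add, jap_zero, abs_of_nonneg (by linarith)] at this
      linarith
    have ht0 : 0 < t := by linarith
    have hb : ‖u (a + t)‖ + r * ‖v (a + t)‖ ≤ 5 * C * r ^ (1 / 2 : ℝ) := by
      refine h1.trans ?_
      have h4 : (r / jap a) ^ (1 / 2 : ℝ) ≤ r ^ (1 / 2 : ℝ) :=
        Real.rpow_le_rpow (by positivity) (div_le_self hr0.le hja1) (by norm_num)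
      calc _ ≤ C * r ^ (1 / 2 : ℝ) * 5 := by
            gcongr
            linarith
        _ = _ := by ring
    have hrr : r = r ^ (1 / 2 : ℝ) * r ^ (1 / 2 : ℝ) := by
      rw [← Real.rpow_add hr0]; norm_num
    have hrh : 0 < r ^ (1 / 2 : ℝ) := by positivity
    have hub : ‖u (a + t)‖ ≤ 5 * C * r ^ (1 / 2 : ℝ) := by
      have : 0 ≤ r * ‖v (a + t)‖ := by positivity
      linarith
    have hvb : r ^ (1 / 2 : ℝ) * ‖v (a + t)‖ ≤ 5 * C := by
      have h5 : r * ‖v (a + t)‖ ≤ 5 * C * r ^ (1 / 2 : ℝ) := by linarith [norm_nonneg (u (a + t))]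
      refine le_of_mul_le_mul_left ?_ hrh
      calc _ = r * ‖v (a + t)‖ := by rw [← mul_assoc, ← hrr]
        _ ≤ _ := h5
        _ = _ := by ring
    have htr : t ^ (1 / 2 : ℝ) ≤ r ^ (1 / 2 : ℝ) :=
      Real.rpow_le_rpow ht0.le (by linarith [le_jap (a + t)]) (by norm_num)
    have hrt : r ^ (1 / 2 : ℝ) ≤ 8 * t ^ (1 / 2 : ℝ) := by
      calc r ^ (1 / 2 : ℝ) ≤ (8 * t) ^ (1 / 2 : ℝ) :=
            Real.rpow_le_rpow hr0.le ((jap_add_le ht a).trans (by nlinarith)) (by norm_num)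
        _ = 8 ^ (1 / 2 : ℝ) * t ^ (1 / 2 : ℝ) := Real.mul_rpow (by norm_num) ht0.le
        _ ≤ _ := by
          gcongr
          exact Real.rpow_le_self_of_one_le (by norm_num) (by norm_num)
    have hth : 0 < t ^ (1 / 2 : ℝ) := by positivity
    rw [hr, add_zero, zero_sub]
    refine ⟨?_, ?_⟩
    · rw [div_mul_eq_mul_div, one_mul, div_le_iff₀ (by positivity)]
      have h6 : r ^ (1 / 2 : ℝ) ≤ ‖u (a + t)‖ * (5 * C) := by
        calc r ^ (1 / 2 : ℝ) ≤ r ^ (1 / 2 : ℝ) * (‖u (a + t)‖ * ‖v (a + t)‖) :=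
              le_mul_of_one_le_right hrh.le hW2
          _ = ‖u (a + t)‖ * (r ^ (1 / 2 : ℝ) * ‖v (a + t)‖) := by ring
          _ ≤ _ := by gcongr
      have h7 : 0 ≤ ‖u (a + t)‖ * (5 * C) := by positivity
      linarith
    · rw [Real.rpow_neg ht0.le, div_mul_eq_mul_div, one_mul, div_le_iff₀ (by positivity),
        inv_le_iff_one_le_mul₀ hth]
      calc (1 : ℝ) ≤ ‖u (a + t)‖ * ‖v (a + t)‖ := hW2
        _ ≤ (5 * C * (8 * t ^ (1 / 2 : ℝ))) * ‖v (a + t)‖ := by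
          gcongr
          exact hub.trans (by gcongr)
        _ = _ := by ring

/-- Both the slope and its conjugate are needed: reality of the data forces the conjugate slope at
`k = -1`. -/
theorem exists_lower_bound (α : ℝ) : ∃ c : ℝ, 0 < c ∧ ∀ u v : ℝ → ℂ, IsModeSol α u v →
    ∀ (a : ℝ) (g : ℂ), 1 ≤ a → a ≤ 3 → u a = g →
      (v a = growthSlope α * g ∨ v a = (starRingEnd ℂ) (growthSlope α) * g) → ∀ t : ℝ, 1 ≤ t →
      c * t ^ (1 / 2 + rate α) * ‖g‖ ≤ ‖u (a + t)‖ ∧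
        c * t ^ (rate α - 1 / 2) * ‖g‖ ≤ ‖v (a + t)‖ := by
  obtain ⟨c, hc, H⟩ := exists_lower_bound_aux α
  refine ⟨c, hc, fun u v h a g ha ha3 hu hv t ht => ?_⟩
  rcases eq_or_ne g 0 with rfl | hg
  · simp
  have hg0 : 0 < ‖g‖ := norm_pos_iff.2 hg
  have h1 : IsModeSol α (fun s => g⁻¹ * u s) (fun s => g⁻¹ * v s) := by
    simpa using h.const_mul_add h g⁻¹ 0
  have key : c * t ^ (1 / 2 + rate α) ≤ ‖g⁻¹ * u (a + t)‖ ∧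
      c * t ^ (rate α - 1 / 2) ≤ ‖g⁻¹ * v (a + t)‖ := by
    rcases hv with hv | hv
    · exact H _ _ h1 a ha ha3 (by rw [hu, inv_mul_cancel₀ hg]) (by rw [hv]; field_simp) t ht
    · have := H _ _ h1.conj a ha ha3 (by rw [hu, inv_mul_cancel₀ hg, map_one])
        (by rw [hv, mul_left_comm, inv_mul_cancel₀ hg, mul_one, Complex.conj_conj]) t ht
      simpa only [RCLike.norm_conj] using this
  rw [norm_mul, norm_inv, norm_mul, norm_inv] at key
  rw [← le_div_iff₀ hg0, ← le_div_iff₀ hg0, div_eq_inv_mul ‖u _‖, div_eq_inv_mul ‖v _‖]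
  exact key

/-! ### Synthesis in `L²` and quantitative differentiability. -/

theorem exists_FT_eq_of_le {F : ℤ → ℝ → ℂ} (hF : ∀ k, AEStronglyMeasurable (F k) volume) (g h : L2)
    {c : ℝ} (H : ∀ k, ∀ᵐ ξ : ℝ, ‖F k ξ‖ ≤ c * (‖FT g k ξ‖ + ‖FT h k ξ‖)) :
    ∃ f : L2, ∀ k, ∀ᵐ ξ : ℝ, FT f k ξ = F k ξ := by
  refine exists_FT_eq F hF (ne_top_of_le_ne_top (b := ENNReal.ofReal (2 * c ^ 2) *
    ((∑' k : ℤ, ∫⁻ ξ : ℝ, ‖FT g k ξ‖ₑ ^ 2) + ∑' k : ℤ, ∫⁻ ξ : ℝ, ‖FT h k ξ‖ₑ ^ 2)) ?_ ?_)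
  · rw [tsum_lintegral_enorm_sq_FT, tsum_lintegral_enorm_sq_FT]
    finiteness
  · rw [← ENNReal.tsum_add, ← ENNReal.tsum_mul_left]
    refine ENNReal.tsum_le_tsum fun k => ?_
    rw [← lintegral_add_left' ((aestronglyMeasurable_FT g k).enorm.pow_const 2),
      ← lintegral_const_mul' _ _ (by finiteness)]
    refine lintegral_mono_ae ?_
    filter_upwards [H k] with ξ hξ
    rw [← ofReal_norm, ← ofReal_norm, ← ofReal_norm, ← ENNReal.ofReal_pow (norm_nonneg _),
      ← ENNReal.ofReal_pow (norm_nonneg _), ← ENNReal.ofReal_pow (norm_nonneg _),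
      ← ENNReal.ofReal_add (by positivity) (by positivity), ← ENNReal.ofReal_mul (by positivity)]
    refine ENNReal.ofReal_le_ofReal ((pow_le_pow_left₀ (norm_nonneg _) hξ 2).trans ?_)
    rw [mul_pow, mul_comm (2 : ℝ), mul_assoc]
    gcongr
    nlinarith [sq_nonneg (‖FT g k ξ‖ - ‖FT h k ξ‖)]

theorem hasDerivWithinAt_of_norm_le_sq {E : Type*} [NormedAddCommGroup E] [NormedSpace ℝ E]
    {f : ℝ → E} {f' : E} {s : Set ℝ} {t C : ℝ}
    (h : ∀ t' ∈ s, |t' - t| ≤ 1 → ‖f t' - f t - (t' - t) • f'‖ ≤ C * (t' - t) ^ 2) :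
    HasDerivWithinAt f f' s t := by
  rw [hasDerivWithinAt_iff_isLittleO]
  have h1 : (fun t' => f t' - f t - (t' - t) • f') =O[𝓝[s] t] fun t' => (t' - t) ^ 2 := by
    refine Asymptotics.IsBigO.of_bound C ?_
    have h2 : ∀ᶠ t' in 𝓝[s] t, |t' - t| ≤ 1 :=
      nhdsWithin_le_nhds (Metric.closedBall_mem_nhds t one_pos)
    filter_upwards [h2, self_mem_nhdsWithin] with t' h3 h4
    rw [Real.norm_of_nonneg (sq_nonneg _)]
    exact h t' h4 h3
  refine h1.trans_isLittleO ?_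
  have h3 : (fun t' : ℝ => t' - t) =o[𝓝[s] t] fun _ => (1 : ℝ) := by
    rw [Asymptotics.isLittleO_one_iff]
    have : Tendsto (fun t' : ℝ => t' - t) (𝓝 t) (𝓝 (t - t)) := tendsto_id.sub_const t
    rw [sub_self] at this
    exact this.mono_left nhdsWithin_le_nhds
  have := h3.mul_isBigO (Asymptotics.isBigO_refl (fun t' : ℝ => t' - t) (𝓝[s] t))
  simpa [sq] using this

theorem norm_taylor_le {f f' f'' : ℝ → ℂ} (h : ∀ s, HasDerivAt f (f' s) s)
    (h' : ∀ s, HasDerivAt f' (f'' s) s) {a b B : ℝ} (hB : ∀ s ∈ Set.Icc a b, ‖f'' s‖ ≤ B) {x y : ℝ}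
    (hx : x ∈ Set.Icc a b) (hy : y ∈ Set.Icc a b) :
    ‖f y - f x - (y - x : ℝ) * f' x‖ ≤ B * (y - x) ^ 2 := by
  have hB0 : 0 ≤ B := (norm_nonneg _).trans (hB x hx)
  have h1 : ∀ z ∈ Set.uIcc x y, ‖f' z - f' x‖ ≤ B * |y - x| := fun z hz => by
    have hz' : z ∈ Set.Icc a b := Set.uIcc_subset_Icc hx hy hz
    refine ((convex_Icc a b).norm_image_sub_le_of_norm_hasDerivWithin_le
      (fun s _ => (h' s).hasDerivWithinAt) hB hx hz').trans ?_
    rw [Real.norm_eq_abs]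
    exact mul_le_mul_of_nonneg_left (Set.abs_sub_left_of_mem_uIcc hz) hB0
  have h2 := (convex_uIcc x y).norm_image_sub_le_of_norm_hasDerivWithin_le
    (f := fun z => f z - (z : ℂ) * f' x) (f' := fun z => f' z - f' x)
    (fun z _ => ((h z).sub ((Complex.ofRealCLM.hasDerivAt (x := z)).mul_const
      (f' x))).hasDerivWithinAt.congr_deriv (by simp)) h1 Set.left_mem_uIcc Set.right_mem_uIcc
  rw [Real.norm_eq_abs, mul_assoc, ← sq, sq_abs] at h2
  refine (le_of_eq (congrArg _ ?_)).trans h2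
  change _ = (f y - (y : ℂ) * f' x) - (f x - (x : ℂ) * f' x)
  push_cast
  ring

/-- The remainder is quadratic with a constant depending on the frequency only through the initial
size of the mode; this gives time derivatives in `L²`, not just pointwise in frequency. -/
theorem IsModeSol.taylor {α : ℝ} {u v : ℝ → ℂ} (h : IsModeSol α u v) {a T x y : ℝ}
    (hx : x ∈ Set.Icc a (a + T)) (hy : y ∈ Set.Icc a (a + T)) :
    ‖u y - u x - (y - x : ℝ) * v x‖ ≤
      2 * |α| * (2 * Real.exp ((1 + |α|) * T)) * (‖u a‖ + ‖v a‖) * (y - x) ^ 2 ∧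
    ‖v y - v x - (y - x : ℝ) * (-(α / (1 + x ^ 2) : ℝ) * u x)‖ ≤
      2 * |α| * (2 * Real.exp ((1 + |α|) * T)) * (‖u a‖ + ‖v a‖) * (y - x) ^ 2 := by
  have hbd : ∀ s ∈ Set.Icc a (a + T), ‖u s‖ + ‖v s‖ ≤
      2 * Real.exp ((1 + |α|) * T) * (‖u a‖ + ‖v a‖) := fun s hs => by
    refine (h.norm_le hs.1).trans ?_
    gcongr
    linarith [hs.2]
  have hα := abs_nonneg α
  constructor
  · refine norm_taylor_le h.deriv_fst h.deriv_snd (fun s hs => ?_) hx hy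
    rw [norm_mul, norm_neg, Complex.norm_real, Real.norm_eq_abs]
    have h1 := hbd s hs
    calc |α / (1 + s ^ 2)| * ‖u s‖ ≤ |α| * (2 * Real.exp ((1 + |α|) * T) * (‖u a‖ + ‖v a‖)) := by
          exact mul_le_mul (norm_coeff_le α s) (by linarith [norm_nonneg (v s)]) (norm_nonneg _) hα
      _ ≤ 2 * (|α| * (2 * Real.exp ((1 + |α|) * T) * (‖u a‖ + ‖v a‖))) := by
          have : 0 ≤ |α| * (2 * Real.exp ((1 + |α|) * T) * (‖u a‖ + ‖v a‖)) := by positivity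
          linarith
      _ = _ := by ring
  · have hd : ∀ s : ℝ, HasDerivAt (fun s : ℝ => -(α / (1 + s ^ 2))) (α * (2 * s) / (1 + s ^ 2) ^ 2) s := by
      intro s
      have h1 : HasDerivAt (fun s : ℝ => 1 + s ^ 2) (2 * s) s := by
        simpa using ((hasDerivAt_pow 2 s).const_add 1)
      refine (((hasDerivAt_const s α).div h1 (by positivity)).neg).congr_deriv ?_
      field_simp
      ring
    have hd2 : ∀ s : ℝ, HasDerivAt (fun s : ℝ => (-(α / (1 + s ^ 2) : ℝ) : ℂ) * u s)
        (((α * (2 * s) / (1 + s ^ 2) ^ 2 : ℝ) : ℂ) * u s + (-(α / (1 + s ^ 2) : ℝ) : ℂ) * v s) s := by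
      intro s
      have := ((hd s).ofReal_comp).mul (h.deriv_fst s)
      simp only [Complex.ofReal_neg] at this
      exact this
    refine norm_taylor_le h.deriv_snd hd2 (fun s hs => ?_) hx hy
    refine (norm_add_le _ _).trans ?_
    rw [norm_mul, norm_mul, norm_neg, Complex.norm_real, Complex.norm_real, Real.norm_eq_abs,
      Real.norm_eq_abs]
    have h1 := hbd s hs
    have h2 : |α * (2 * s) / (1 + s ^ 2) ^ 2| ≤ |α| := by
      rw [abs_div, abs_mul, abs_of_pos (by positivity : 0 < (1 + s ^ 2) ^ 2), mul_div_assoc]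
      refine mul_le_of_le_one_right hα ?_
      rw [div_le_one (by positivity), abs_le]
      constructor <;> nlinarith [sq_nonneg (s - 1), sq_nonneg (s + 1), sq_nonneg s, sq_nonneg (s ^ 2)]
    have h3 := mul_le_mul h2 (show ‖u s‖ ≤ ‖u s‖ + ‖v s‖ by simp) (norm_nonneg _) hα
    have h4 := mul_le_mul (norm_coeff_le α s) (show ‖v s‖ ≤ ‖u s‖ + ‖v s‖ by simp) (norm_nonneg _) hα
    have h5 := mul_le_mul_of_nonneg_left h1 hα
    calc _ ≤ |α| * (2 * Real.exp ((1 + |α|) * T) * (‖u a‖ + ‖v a‖)) +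
          |α| * (2 * Real.exp ((1 + |α|) * T) * (‖u a‖ + ‖v a‖)) := by linarith
      _ = _ := by ring

/-! ### Symbols in the variable `s = t - ξ/k`. -/

theorem sq_add_sq_eq {k : ℤ} (hk : k ≠ 0) (t ξ : ℝ) :
    (k : ℝ) ^ 2 + (ξ - k * t) ^ 2 = k ^ 2 * (1 + (-ξ / k + t) ^ 2) := by
  have : (k : ℝ) ≠ 0 := Int.cast_ne_zero.2 hk
  field_simp
  ring

theorem symLap_eq {k : ℤ} (t ξ : ℝ) :
    symLap t k ξ = ((-((k : ℝ) ^ 2 + (ξ - k * t) ^ 2) : ℝ) : ℂ) := by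
  rw [symLap, symDx, symDy, mul_pow, mul_pow, Complex.I_sq]
  push_cast
  ring

theorem norm_symLap {k : ℤ} (hk : k ≠ 0) (t ξ : ℝ) :
    ‖symLap t k ξ‖ = (k : ℝ) ^ 2 * jap (-ξ / k + t) ^ 2 := by
  rw [symLap_eq, Complex.norm_real, norm_neg, sq_add_sq_eq hk, ← jap_sq,
    Real.norm_of_nonneg (by positivity)]

theorem norm_symDx (k : ℤ) (ξ : ℝ) : ‖symDx k ξ‖ = |(k : ℝ)| := by
  simp [symDx]

theorem norm_symDy {k : ℤ} (hk : k ≠ 0) (t ξ : ℝ) :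
    ‖symDy t k ξ‖ = |(k : ℝ)| * |-ξ / k + t| := by
  have hk' : (k : ℝ) ≠ 0 := Int.cast_ne_zero.2 hk
  have h : symDy t k ξ = Complex.I * ((ξ - k * t : ℝ) : ℂ) := by simp [symDy]
  rw [h, norm_mul, Complex.norm_I, one_mul, Complex.norm_real, Real.norm_eq_abs, ← abs_mul,
    ← abs_neg]
  congr 1
  field_simp
  ring

theorem one_le_abs_intCast {k : ℤ} (hk : k ≠ 0) : 1 ≤ |(k : ℝ)| := by
  exact_mod_cast Int.one_le_abs hk

theorem norm_symDx_div_symLap {k : ℤ} (hk : k ≠ 0) (t ξ : ℝ) :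
    ‖symDx k ξ / symLap t k ξ‖ = 1 / (|(k : ℝ)| * jap (-ξ / k + t) ^ 2) := by
  have h1 := one_le_abs_intCast hk
  have h2 := jap_pos (-ξ / k + t)
  rw [norm_div, norm_symLap hk, norm_symDx, ← sq_abs (k : ℝ)]
  field_simp

theorem norm_symDy_div_symLap {k : ℤ} (hk : k ≠ 0) (t ξ : ℝ) :
    ‖-symDy t k ξ / symLap t k ξ‖ = |-ξ / k + t| / (|(k : ℝ)| * jap (-ξ / k + t) ^ 2) := by
  have h1 := one_le_abs_intCast hk
  have h2 := jap_pos (-ξ / k + t)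
  rw [norm_div, norm_neg, norm_symLap hk, norm_symDy hk, ← sq_abs (k : ℝ)]
  field_simp

theorem norm_symDx_div_symLap_le (t : ℝ) (k : ℤ) (ξ : ℝ) : ‖symDx k ξ / symLap t k ξ‖ ≤ 1 := by
  rcases eq_or_ne k 0 with rfl | hk
  · simp [symDx]
  · rw [norm_symDx_div_symLap hk]
    have h1 := one_le_abs_intCast hk
    have h2 := one_le_jap (-ξ / k + t)
    exact div_le_one_of_le₀ (one_le_mul_of_one_le_of_one_le h1 (one_le_pow₀ h2)) (by positivity)

theorem norm_symDy_div_symLap_le (t : ℝ) {k : ℤ} (hk : k ≠ 0) (ξ : ℝ) :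
    ‖-symDy t k ξ / symLap t k ξ‖ ≤ 1 := by
  rw [norm_symDy_div_symLap hk]
  have h1 := one_le_abs_intCast hk
  have h2 := one_le_jap (-ξ / k + t)
  have h3 := abs_le_jap (-ξ / k + t)
  refine div_le_one_of_le₀ ?_ (by positivity)
  nlinarith

/-! ### Multipliers and uniqueness of solutions. -/

theorem IsMultiplier.norm_coef_le {m : ℤ → ℝ → ℂ} {f g : L2} (h : IsMultiplier m f g) (k : ℤ) {c : ℝ}
    (hc : ∀ ξ, ‖m k ξ‖ ≤ c) : ‖coef k g‖ ≤ c * ‖coef k f‖ := by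
  refine Lp.norm_le_mul_norm_of_ae_le_mul ?_
  rw [← ae_comp_div_two_pi (P := fun η => ‖coef k g η‖ ≤ c * ‖coef k f η‖)]
  filter_upwards [h k] with ξ hξ
  rw [FT_eq_coef, FT_eq_coef] at hξ
  rw [hξ, norm_mul]
  exact mul_le_mul_of_nonneg_right (hc ξ) (norm_nonneg _)

theorem IsMultiplier.sub {m : ℤ → ℝ → ℂ} {f g f' g' : L2} (h : IsMultiplier m f g)
    (h' : IsMultiplier m f' g') : IsMultiplier m (f - f') (g - g') := fun k => by
  filter_upwards [h k, h' k, FT_sub f f' k, FT_sub g g' k] with ξ h1 h2 h3 h4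
  rw [h3, h4, h1, h2, mul_sub]

theorem IsMultiplier.unique {m : ℤ → ℝ → ℂ} {f g g' : L2} (h : IsMultiplier m f g)
    (h' : IsMultiplier m f g') : g = g' :=
  eq_of_FT_ae_eq fun k => by
    filter_upwards [h k, h' k] with ξ h1 h2
    rw [h1, h2]

/-- `∂_x` is unbounded on `L²` but is multiplication by `ik` on the `k`-th coefficient, so
Grönwall's inequality applies to each coefficient separately. -/
theorem IsSolution.unique {α : ℝ} {ω θ w v ω' θ' w' v' : ℝ → L2} (h : IsSolution α ω θ w v)
    (h' : IsSolution α ω' θ' w' v') (hω : ω 0 = ω' 0) (hθ : θ 0 = θ' 0) {t : ℝ} (ht : 0 ≤ t) :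
    ω t = ω' t ∧ θ t = θ' t ∧ w t = w' t ∧ v t = v' t := by
  have key : ∀ k, coef k (ω t - ω' t) = 0 ∧ coef k (θ t - θ' t) = 0 := by
    intro k
    choose! q hq hqd using h.vorticity
    choose! q' hq' hqd' using h'.vorticity
    set L : L2 →L[ℝ] Lp ℂ 2 (volume : Measure ℝ) := (coef k).restrictScalars ℝ with hL
    have h1 : ∀ s, 0 ≤ s → HasDerivWithinAt (fun s => (L (ω s - ω' s), L (θ s - θ' s)))
        (L (q s - q' s), L (-(α : ℂ) • v s - -(α : ℂ) • v' s)) (Set.Ici 0) s := fun s hs =>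
      (L.hasFDerivAt.comp_hasDerivWithinAt s ((hqd s hs).sub (hqd' s hs))).prodMk
        (L.hasFDerivAt.comp_hasDerivWithinAt s ((h.temperature s hs).sub (h'.temperature s hs)))
    have h2 := norm_le_gronwallBound_of_norm_deriv_right_le
      (f := fun s => (L (ω s - ω' s), L (θ s - θ' s)))
      (f' := fun s => (L (q s - q' s), L (-(α : ℂ) • v s - -(α : ℂ) • v' s))) (δ := 0)
      (K := |(k : ℝ)| + |α|) (ε := 0) (a := 0) (b := t)
      (fun s hs => ((h1 s hs.1).continuousWithinAt).mono Set.Icc_subset_Ici_self)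
      (fun s hs => (h1 s hs.1).mono (Set.Ici_subset_Ici.2 hs.1)) (by simp [hω, hθ])
      (fun s hs => by
        have h3 : ‖L (q s - q' s)‖ ≤ |(k : ℝ)| * ‖L (θ s - θ' s)‖ :=
          ((hq s hs.1).sub (hq' s hs.1)).norm_coef_le k fun ξ => (norm_symDx k ξ).le
        have h4 : ‖L (v s - v' s)‖ ≤ 1 * ‖L (ω s - ω' s)‖ :=
          ((h.biotSavart₂ s hs.1).sub (h'.biotSavart₂ s hs.1)).norm_coef_le k fun ξ =>
            norm_symDx_div_symLap_le s k ξ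
        have h5 : ‖L (-(α : ℂ) • v s - -(α : ℂ) • v' s)‖ = |α| * ‖L (v s - v' s)‖ := by
          rw [← smul_sub, hL, ContinuousLinearMap.coe_restrictScalars', map_smul, norm_smul, norm_neg,
            Complex.norm_real, Real.norm_eq_abs]
        have h6 := norm_fst_le (L (ω s - ω' s), L (θ s - θ' s))
        have h7 := norm_snd_le (L (ω s - ω' s), L (θ s - θ' s))
        dsimp only at h6 h7
        set N := ‖(L (ω s - ω' s), L (θ s - θ' s))‖ with hN
        have hN0 : 0 ≤ N := norm_nonneg _
        have hk0 := abs_nonneg (k : ℝ)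
        have hα0 := abs_nonneg α
        rw [add_zero, Prod.norm_def]
        refine max_le ?_ ?_
        · dsimp only
          nlinarith
        · dsimp only
          rw [h5]
          nlinarith) t ⟨ht, le_rfl⟩
    rw [gronwallBound_ε0_δ0] at h2
    have h3 := norm_le_zero_iff.1 h2
    exact ⟨congrArg Prod.fst h3, congrArg Prod.snd h3⟩
  have e1 : ω t = ω' t := eq_of_coef_eq fun k => by
    have := (key k).1
    rwa [map_sub, sub_eq_zero] at this
  have e2 : θ t = θ' t := eq_of_coef_eq fun k => by
    have := (key k).2
    rwa [map_sub, sub_eq_zero] at this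
  refine ⟨e1, e2, ?_, ?_⟩
  · have := h'.biotSavart₁ t ht
    rw [← e1] at this
    exact (h.biotSavart₁ t ht).unique this
  · have := h'.biotSavart₂ t ht
    rw [← e1] at this
    exact (h.biotSavart₂ t ht).unique this

/-! ### Existence of solutions and their mode representation. -/

theorem exists_isMultiplier {m : ℤ → ℝ → ℂ} (hm : ∀ k, Measurable (m k)) {c : ℝ}
    (hc : ∀ k ξ, ‖m k ξ‖ ≤ c) (f : L2) : ∃ g, IsMultiplier m f g := by
  have hc0 : 0 ≤ c := (norm_nonneg _).trans (hc 0 0)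
  refine exists_FT_eq_of_le (F := fun k ξ => m k ξ * FT f k ξ)
    (fun k => (hm k).aestronglyMeasurable.mul (aestronglyMeasurable_FT f k)) f f (c := c)
    fun k => ae_of_all _ fun ξ => ?_
  rw [norm_mul]
  exact mul_le_mul (hc k ξ) (by simp) (norm_nonneg _) hc0

theorem FT_xMean_zero (f : L2) (ξ : ℝ) : FT (xMean f) 0 ξ = FT f 0 ξ := by
  rw [FT_eq_coef, FT_eq_coef, xMean_eq_mode, coef_mode, if_pos rfl]
  rfl

theorem FT_xMean_of_ne (f : L2) {k : ℤ} (hk : k ≠ 0) : ∀ᵐ ξ : ℝ, FT (xMean f) k ξ = 0 := by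
  simp_rw [FT_eq_coef, xMean_eq_mode, coef_mode, if_neg hk]
  exact (ae_comp_div_two_pi (P := fun η => (0 : Lp ℂ 2 (volume : Measure ℝ)) η = 0)).2
    (Lp.coeFn_zero _ _ _)

theorem hasDerivWithinAt_of_FT {f : ℝ → L2} {f' g h : L2} {t C : ℝ} (hC : 0 ≤ C)
    (H : ∀ t' : ℝ, 0 ≤ t' → |t' - t| ≤ 1 → ∀ k : ℤ, ∀ᵐ ξ : ℝ,
      ‖FT (f t') k ξ - FT (f t) k ξ - ((t' - t : ℝ) : ℂ) * FT f' k ξ‖ ≤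
        C * (‖FT g k ξ‖ + ‖FT h k ξ‖) * (t' - t) ^ 2) :
    HasDerivWithinAt f f' (Set.Ici 0) t := by
  refine hasDerivWithinAt_of_norm_le_sq (C := 2 * C * (‖g‖ + ‖h‖)) fun t' ht' htt' => ?_
  have h1 : ‖f t' - f t - ((t' - t : ℝ) : ℂ) • f'‖ ≤ 2 * (C * (t' - t) ^ 2) * (‖g‖ + ‖h‖) := by
    refine norm_le_of_FT_le (by positivity) fun k => ?_
    filter_upwards [H t' ht' htt' k, FT_sub (f t' - f t) (((t' - t : ℝ) : ℂ) • f') k,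
      FT_sub (f t') (f t) k, FT_smul ((t' - t : ℝ) : ℂ) f' k] with ξ e1 e2 e3 e4
    rw [e2, e3, e4]
    linarith
  have h2 : (t' - t) • f' = ((t' - t : ℝ) : ℂ) • f' := (Complex.coe_smul _ _).symm
  rw [h2]
  linarith

theorem symDx_div_symLap {k : ℤ} (hk : k ≠ 0) (t ξ : ℝ) :
    symDx k ξ / symLap t k ξ = 1 / (Complex.I * k) * ((1 / (1 + (-ξ / k + t) ^ 2) : ℝ) : ℂ) := by
  have hk' : (k : ℂ) ≠ 0 := Int.cast_ne_zero.2 hk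
  have h1 : (((1 + (-ξ / k + t) ^ 2) : ℝ) : ℂ) ≠ 0 :=
    Complex.ofReal_ne_zero.2 (by positivity)
  rw [symLap_eq, sq_add_sq_eq hk, symDx, Complex.ofReal_div, Complex.ofReal_neg, Complex.ofReal_mul]
  generalize (((1 + (-ξ / k + t) ^ 2) : ℝ) : ℂ) = X at h1 ⊢
  push_cast
  field_simp
  rw [Complex.I_sq, neg_neg]

theorem norm_one_div_I_mul_le (k : ℤ) : ‖1 / (Complex.I * k)‖ ≤ 1 := by
  rcases eq_or_ne k 0 with rfl | hk
  · simp
  · rw [norm_div, norm_mul, norm_one, Complex.norm_I, one_mul, Complex.norm_intCast]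
    exact div_le_one_of_le₀ (one_le_abs_intCast hk) (abs_nonneg _)

/-- Frequency by frequency, `ω` and `∂_x θ` are given by a solution of the scalar mode equation. -/
def HasModes (α : ℝ) (ω θ : ℝ → L2) : Prop :=
  ∀ t, 0 ≤ t → (∀ᵐ ξ : ℝ, FT (ω t) 0 ξ = FT (ω 0) 0 ξ) ∧
    ∀ k : ℤ, k ≠ 0 → ∀ᵐ ξ : ℝ, ∃ u v, IsModeSol α u v ∧
    u (-ξ / k) = FT (ω 0) k ξ ∧ v (-ξ / k) = Complex.I * k * FT (θ 0) k ξ ∧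
    u (-ξ / k + t) = FT (ω t) k ξ ∧ v (-ξ / k + t) = Complex.I * k * FT (θ t) k ξ

/-- Each mode is solved from `s = -ξ/k` with data `ω₀` and `∂_x θ₀`, and reassembled by Plancherel.
Only `∂_x θ₀ ∈ L²` is needed for existence. -/
theorem exists_isSolution (α : ℝ) {ω₀ θ₀ q₀ : L2} (hq₀ : IsMultiplier symDx θ₀ q₀) :
    ∃ ω θ w v : ℝ → L2, IsSolution α ω θ w v ∧ ω 0 = ω₀ ∧ θ 0 = θ₀ ∧ HasModes α ω θ := by
  obtain ⟨φ, φ', ψ, ψ', hφψ⟩ := exists_isFundamental α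
  -- Cramer's rule with Wronskian `1`. Writing all modes in one fixed fundamental system makes their
  -- dependence on `ξ` measurable.
  set a : ℤ → ℝ → ℂ := fun k ξ => FT ω₀ k ξ * ψ' (-ξ / k) - FT q₀ k ξ * ψ (-ξ / k) with ha
  set b : ℤ → ℝ → ℂ := fun k ξ => FT q₀ k ξ * φ (-ξ / k) - FT ω₀ k ξ * φ' (-ξ / k) with hb
  set U : ℤ → ℝ → ℝ → ℂ := fun k ξ s => a k ξ * φ s + b k ξ * ψ s with hU
  set V : ℤ → ℝ → ℝ → ℂ := fun k ξ s => a k ξ * φ' s + b k ξ * ψ' s with hV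
  have hUV : ∀ k ξ, IsModeSol α (U k ξ) (V k ξ) := fun k ξ =>
    hφψ.fst.const_mul_add hφψ.snd (a k ξ) (b k ξ)
  have hU0 : ∀ k ξ, U k ξ (-ξ / k) = FT ω₀ k ξ := fun k ξ => by
    simp only [hU, ha, hb]
    linear_combination FT ω₀ k ξ * hφψ.wronskian (-ξ / k)
  have hV0 : ∀ k ξ, V k ξ (-ξ / k) = FT q₀ k ξ := fun k ξ => by
    simp only [hV, ha, hb]
    linear_combination FT q₀ k ξ * hφψ.wronskian (-ξ / k)
  have hbd : ∀ t, 0 ≤ t → ∀ k ξ, ‖U k ξ (-ξ / k + t)‖ + ‖V k ξ (-ξ / k + t)‖ ≤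
      2 * Real.exp ((1 + |α|) * t) * (‖FT ω₀ k ξ‖ + ‖FT q₀ k ξ‖) := fun t ht k ξ => by
    have := (hUV k ξ).norm_le (a := -ξ / k) (b := -ξ / k + t) (by linarith)
    rwa [hU0, hV0, add_sub_cancel_left] at this
  have hcφ : Continuous φ := continuous_iff_continuousAt.2 fun s => (hφψ.fst.deriv_fst s).continuousAt
  have hcφ' : Continuous φ' :=
    continuous_iff_continuousAt.2 fun s => (hφψ.fst.deriv_snd s).continuousAt
  have hcψ : Continuous ψ := continuous_iff_continuousAt.2 fun s => (hφψ.snd.deriv_fst s).continuousAt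
  have hcψ' : Continuous ψ' :=
    continuous_iff_continuousAt.2 fun s => (hφψ.snd.deriv_snd s).continuousAt
  have hshift : ∀ {χ : ℝ → ℂ}, Continuous χ → ∀ (k : ℤ) (t : ℝ),
      AEStronglyMeasurable (fun ξ : ℝ => χ (-ξ / k + t)) volume := fun hχ k t =>
    (hχ.comp (by fun_prop : Continuous fun ξ : ℝ => -ξ / k + t)).aestronglyMeasurable
  have hshift0 : ∀ {χ : ℝ → ℂ}, Continuous χ → ∀ (k : ℤ),
      AEStronglyMeasurable (fun ξ : ℝ => χ (-ξ / k)) volume := fun hχ k => by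
    simpa using hshift hχ k 0
  have hma : ∀ k, AEStronglyMeasurable (a k) volume := fun k =>
    ((aestronglyMeasurable_FT ω₀ k).mul (hshift0 hcψ' k)).sub
      ((aestronglyMeasurable_FT q₀ k).mul (hshift0 hcψ k))
  have hmb : ∀ k, AEStronglyMeasurable (b k) volume := fun k =>
    ((aestronglyMeasurable_FT q₀ k).mul (hshift0 hcφ k)).sub
      ((aestronglyMeasurable_FT ω₀ k).mul (hshift0 hcφ' k))
  have hexω : ∀ t : ℝ, 0 ≤ t → ∃ f : L2, ∀ k, ∀ᵐ ξ : ℝ,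
      FT f k ξ = if k = 0 then FT ω₀ k ξ else U k ξ (-ξ / k + t) := fun t ht => by
    refine exists_FT_eq_of_le (F := fun k ξ => if k = 0 then FT ω₀ k ξ else U k ξ (-ξ / k + t))
      (fun k => ?_) ω₀ q₀ (c := 2 * Real.exp ((1 + |α|) * t)) fun k => ae_of_all _ fun ξ => ?_
    · by_cases hk : k = 0
      · simpa only [if_pos hk] using aestronglyMeasurable_FT ω₀ k
      · simp only [if_neg hk]
        exact ((hma k).mul (hshift hcφ k t)).add ((hmb k).mul (hshift hcψ k t))
    · have h1 : 1 ≤ Real.exp ((1 + |α|) * t) := Real.one_le_exp (by positivity)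
      split_ifs with hk
      · nlinarith [norm_nonneg (FT ω₀ k ξ), norm_nonneg (FT q₀ k ξ)]
      · linarith [hbd t ht k ξ, norm_nonneg (V k ξ (-ξ / k + t))]
  have hexq : ∀ t : ℝ, 0 ≤ t → ∃ f : L2, ∀ k, ∀ᵐ ξ : ℝ,
      FT f k ξ = if k = 0 then 0 else V k ξ (-ξ / k + t) := fun t ht => by
    refine exists_FT_eq_of_le (F := fun k ξ => if k = 0 then 0 else V k ξ (-ξ / k + t))
      (fun k => ?_) ω₀ q₀ (c := 2 * Real.exp ((1 + |α|) * t)) fun k => ae_of_all _ fun ξ => ?_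
    · by_cases hk : k = 0
      · simpa only [if_pos hk] using aestronglyMeasurable_const
      · simp only [if_neg hk]
        exact ((hma k).mul (hshift hcφ' k t)).add ((hmb k).mul (hshift hcψ' k t))
    · split_ifs with hk
      · rw [norm_zero]; positivity
      · linarith [hbd t ht k ξ, norm_nonneg (U k ξ (-ξ / k + t))]
  choose! ω hω using hexω
  choose! q hq using hexq
  -- Inverts `∂_x` away from `k = 0`; there division by zero gives the symbol `0`, so the conserved
  -- average of `θ₀` is added back separately.
  have hexη : ∀ t : ℝ, ∃ η, IsMultiplier (fun k _ => 1 / (Complex.I * k)) (q t) η := fun t =>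
    exists_isMultiplier (fun k => measurable_const) (fun k _ => norm_one_div_I_mul_le k) (q t)
  choose η hη using hexη
  have hmDx : ∀ k, Measurable (symDx k) := fun k => by unfold symDx; fun_prop
  have hmDy : ∀ t k, Measurable (symDy t k) := fun t k => by unfold symDy; fun_prop
  have hmLap : ∀ t k, Measurable (symLap t k) := fun t k =>
    ((hmDx k).pow_const 2).add ((hmDy t k).pow_const 2)
  have hexv : ∀ t : ℝ, ∃ v, IsMultiplier (fun k ξ => symDx k ξ / symLap t k ξ) (ω t) v := fun t =>
    exists_isMultiplier (fun k => (hmDx k).div (hmLap t k)) (norm_symDx_div_symLap_le t) (ω t)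
  choose v hv using hexv
  have hexw : ∀ t : ℝ, ∃ w, IsMultiplier (fun k ξ => -symDy t k ξ / symLap t k ξ) (fluct (ω t)) w := by
    intro t
    obtain ⟨w, hw⟩ := exists_isMultiplier
      (m := fun k ξ => if k = 0 then 0 else -symDy t k ξ / symLap t k ξ) (c := 1) (fun k => by
        by_cases hk : k = 0
        · simp only [if_pos hk]; exact measurable_const
        · simp only [if_neg hk]; exact (hmDy t k).neg.div (hmLap t k)) (fun k ξ => by
        split_ifs with hk
        · simp
        · exact norm_symDy_div_symLap_le t hk ξ) (fluct (ω t))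
    refine ⟨w, fun k => ?_⟩
    rcases eq_or_ne k 0 with rfl | hk
    · filter_upwards [hw 0, FT_fluct_zero (ω t)] with ξ h1 h2
      rw [h1, h2]; simp
    · filter_upwards [hw k] with ξ h1
      rw [h1, if_neg hk]
  choose w hw using hexw
  set θ : ℝ → L2 := fun t => xMean θ₀ + η t with hθ
  have hFTθ : ∀ t, ∀ k : ℤ, k ≠ 0 → ∀ᵐ ξ : ℝ, FT (θ t) k ξ = 1 / (Complex.I * k) * FT (q t) k ξ := by
    intro t k hk
    filter_upwards [FT_add (xMean θ₀) (η t) k, FT_xMean_of_ne θ₀ hk, hη t k] with ξ h1 h2 h3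
    rw [h1, h2, h3, zero_add]
  have hFTθ0 : ∀ t, ∀ᵐ ξ : ℝ, FT (θ t) 0 ξ = FT θ₀ 0 ξ := by
    intro t
    filter_upwards [FT_add (xMean θ₀) (η t) 0, hη t 0] with ξ h1 h3
    rw [h1, FT_xMean_zero, h3]
    simp
  have hIk : ∀ k : ℤ, k ≠ 0 → Complex.I * (k : ℂ) ≠ 0 := fun k hk =>
    mul_ne_zero Complex.I_ne_zero (Int.cast_ne_zero.2 hk)
  have hmul : ∀ t, 0 ≤ t → IsMultiplier symDx (θ t) (q t) := by
    intro t ht k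
    rcases eq_or_ne k 0 with rfl | hk
    · filter_upwards [hq t ht 0] with ξ h1
      rw [h1]
      simp [symDx]
    · filter_upwards [hFTθ t k hk] with ξ h1
      rw [h1, symDx, ← mul_assoc, mul_one_div_cancel (hIk k hk), one_mul]
  have hω0 : ω 0 = ω₀ := eq_of_FT_ae_eq fun k => by
    filter_upwards [hω 0 le_rfl k] with ξ h1
    rw [h1, add_zero, hU0, ite_self]
  have hθ0 : θ 0 = θ₀ := eq_of_FT_ae_eq fun k => by
    rcases eq_or_ne k 0 with rfl | hk
    · exact hFTθ0 0
    · filter_upwards [hFTθ 0 k hk, hq 0 le_rfl k, hq₀ k] with ξ h1 h2 h3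
      rw [h1, h2, if_neg hk, add_zero, hV0, h3, symDx, ← mul_assoc, one_div_mul_cancel (hIk k hk),
        one_mul]
  have htay : ∀ t t' : ℝ, 0 ≤ t → 0 ≤ t' → |t' - t| ≤ 1 → ∀ k ξ,
      ‖U k ξ (-ξ / k + t') - U k ξ (-ξ / k + t) - (t' - t : ℝ) * V k ξ (-ξ / k + t)‖ ≤
        2 * |α| * (2 * Real.exp ((1 + |α|) * (t + 1))) * (‖FT ω₀ k ξ‖ + ‖FT q₀ k ξ‖) * (t' - t) ^ 2 ∧
      ‖V k ξ (-ξ / k + t') - V k ξ (-ξ / k + t) - (t' - t : ℝ) *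
        (-(α / (1 + (-ξ / k + t) ^ 2) : ℝ) * U k ξ (-ξ / k + t))‖ ≤
        2 * |α| * (2 * Real.exp ((1 + |α|) * (t + 1))) * (‖FT ω₀ k ξ‖ + ‖FT q₀ k ξ‖) * (t' - t) ^ 2 := by
    intro t t' ht ht' htt k ξ
    have h1 := (abs_le.1 htt).2
    have := (hUV k ξ).taylor (a := -ξ / k) (T := t + 1) (x := -ξ / k + t) (y := -ξ / k + t')
      ⟨by linarith, by linarith⟩ ⟨by linarith, by linarith⟩
    rwa [hU0, hV0, add_sub_add_left_eq_sub] at this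
  refine ⟨ω, θ, w, v, ⟨fun t ht => ⟨q t, hmul t ht, ?_⟩, fun t ht => ?_, fun t _ => hw t,
    fun t _ => hv t⟩, hω0, hθ0, ?_⟩
  · refine hasDerivWithinAt_of_FT (g := ω₀) (h := q₀)
      (C := 2 * |α| * (2 * Real.exp ((1 + |α|) * (t + 1)))) (by positivity)
      fun t' ht' htt k => ?_
    filter_upwards [hω t' ht' k, hω t ht k, hq t ht k] with ξ h1 h2 h3
    rw [h1, h2, h3]
    split_ifs with hk
    · rw [sub_self, mul_zero, sub_zero, norm_zero]; positivity
    · exact (htay t t' ht ht' htt k ξ).1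
  · refine hasDerivWithinAt_of_FT (g := ω₀) (h := q₀)
      (C := 2 * |α| * (2 * Real.exp ((1 + |α|) * (t + 1)))) (by positivity)
      fun t' ht' htt k => ?_
    rcases eq_or_ne k 0 with rfl | hk
    · filter_upwards [hFTθ0 t', hFTθ0 t, FT_smul (-(α : ℂ)) (v t) 0, hv t 0] with ξ h1 h2 h3 h4
      rw [h1, h2, h3, h4, sub_self, symDx]
      simp only [Int.cast_zero, mul_zero, zero_div, zero_mul, sub_zero, norm_zero]
      positivity
    · filter_upwards [hFTθ t' k hk, hFTθ t k hk, hq t' ht' k, hq t ht k, hω t ht k,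
        FT_smul (-(α : ℂ)) (v t) k, hv t k] with ξ h1 h2 h3 h4 h5 h6 h7
      rw [h1, h2, h3, h4, h6, h7, h5, if_neg hk, if_neg hk, if_neg hk, symDx_div_symLap hk]
      have e : 1 / (Complex.I * k) * V k ξ (-ξ / k + t') - 1 / (Complex.I * k) * V k ξ (-ξ / k + t) -
          ((t' - t : ℝ) : ℂ) * (-(α : ℂ) * (1 / (Complex.I * k) *
            ((1 / (1 + (-ξ / k + t) ^ 2) : ℝ) : ℂ) * U k ξ (-ξ / k + t))) =
          1 / (Complex.I * k) * (V k ξ (-ξ / k + t') - V k ξ (-ξ / k + t) - ((t' - t : ℝ) : ℂ) *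
        (-((α / (1 + (-ξ / k + t) ^ 2) : ℝ) : ℂ) * U k ξ (-ξ / k + t))) := by
        rw [show α / (1 + (-ξ / k + t) ^ 2) = α * (1 / (1 + (-ξ / k + t) ^ 2)) by ring,
          Complex.ofReal_mul]
        ring
      rw [e, norm_mul]
      refine (mul_le_of_le_one_left (norm_nonneg _) (norm_one_div_I_mul_le k)).trans ?_
      exact (htay t t' ht ht' htt k ξ).2
  · refine fun t ht => ⟨?_, fun k hk => ?_⟩
    · filter_upwards [hω t ht 0] with ξ h1
      rw [h1, if_pos rfl, hω0]
    filter_upwards [hω t ht k, hmul t ht k, hq t ht k, hq₀ k] with ξ h1 h2 h3 h4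
    refine ⟨U k ξ, V k ξ, hUV k ξ, ?_, ?_, ?_, ?_⟩
    · rw [hω0, hU0]
    · rw [hθ0, hV0, h4, symDx]
    · rw [h1, if_neg hk]
    · rw [← symDx, ← h2, h3, if_neg hk]

/-- An arbitrary solution has `∂_x θ(0) ∈ L²` by the vorticity equation at `t = 0`, so it coincides
with the constructed one. -/
theorem IsSolution.hasModes {α : ℝ} {ω θ w v : ℝ → L2} (h : IsSolution α ω θ w v) :
    HasModes α ω θ := by
  obtain ⟨q₀, hq₀, -⟩ := h.vorticity 0 le_rfl
  obtain ⟨ω', θ', w', v', h', hω, hθ, hm⟩ := exists_isSolution (ω₀ := ω 0) α hq₀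
  intro t ht
  obtain ⟨e1, e2, -, -⟩ := h'.unique h hω hθ ht
  have := hm t ht
  rwa [e1, e2, hω, hθ] at this

/-! ### Real data at frequencies `±1`. -/

-- The substitution `η ↦ -η` in the inverse transform; this is what makes `datum` real valued.
open SchwartzMap in
theorem fourierInv_reflect_eq_conj {χ χ' : 𝓢(ℝ, ℂ)} (hreal : ∀ η, (starRingEnd ℂ) (χ η) = χ η)
    (hχ' : ∀ η, χ' η = χ (-η)) (y : ℝ) : (𝓕⁻ χ') y = (starRingEnd ℂ) ((𝓕⁻ χ) y) := by
  rw [fourierInv_coe, fourierInv_coe, Real.fourierInv_eq', Real.fourierInv_eq', ← integral_conj,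
    ← integral_neg_eq_self]
  refine integral_congr_ae (ae_of_all _ fun η => ?_)
  simp only [smul_eq_mul, map_mul, hreal, hχ', neg_neg, ← Complex.exp_conj, Complex.conj_I,
    Complex.conj_ofReal, inner_neg_left]
  congr 2
  push_cast
  ring

/-- A real bump function of the frequency, supported in `-3 < 2πη < -1`. -/
def freqBump : ContDiffBump (-(2 / (2 * Real.pi)) : ℝ) where
  rIn := 1 / 2 / (2 * Real.pi)
  rOut := 1 / (2 * Real.pi)
  rIn_pos := by positivity
  rIn_lt_rOut := by
    gcongr
    norm_num

open scoped ContDiff in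
theorem contDiff_freqBump : ContDiff ℝ ∞ fun η : ℝ => ((freqBump η : ℝ) : ℂ) :=
  Complex.ofRealCLM.contDiff.comp freqBump.contDiff

theorem hasCompactSupport_freqBump : HasCompactSupport fun η : ℝ => ((freqBump η : ℝ) : ℂ) :=
  freqBump.hasCompactSupport.comp_left (g := fun x : ℝ => (x : ℂ)) Complex.ofReal_zero

/-- The bump function as a Schwartz function. -/
def bumpS : SchwartzMap ℝ ℂ := hasCompactSupport_freqBump.toSchwartzMap contDiff_freqBump

/-- The reflected bump function as a Schwartz function. -/
def bumpS' : SchwartzMap ℝ ℂ :=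
  (hasCompactSupport_freqBump.comp_homeomorph (Homeomorph.neg ℝ)).toSchwartzMap
    (contDiff_freqBump.comp contDiff_neg)

theorem bumpS_apply (η : ℝ) : bumpS η = ((freqBump η : ℝ) : ℂ) := rfl

theorem bumpS'_apply (η : ℝ) : bumpS' η = ((freqBump (-η) : ℝ) : ℂ) := rfl

theorem freqBump_eq_zero {ξ : ℝ} (h : ¬(-3 ≤ ξ ∧ ξ ≤ -1)) : freqBump (ξ / (2 * Real.pi)) = 0 := by
  have hp : (0 : ℝ) < 2 * Real.pi := by positivity
  refine freqBump.zero_of_le_dist ?_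
  change 1 / (2 * Real.pi) ≤ _
  rw [Real.dist_eq, show ξ / (2 * Real.pi) - -(2 / (2 * Real.pi)) = (ξ + 2) / (2 * Real.pi) by ring,
    abs_div, abs_of_pos hp]
  gcongr
  rw [le_abs]
  by_contra h2
  push Not at h2
  exact h ⟨by linarith, by linarith⟩

/-- The real field with `x`-frequencies `±1` and Fourier transform `c χ(ξ)`, `c̄ χ(-ξ)`. -/
def datum (c : ℂ) : L2 :=
  c • mode 1 ((𝓕⁻ bumpS).toLp 2) + (starRingEnd ℂ) c • mode (-1) ((𝓕⁻ bumpS').toLp 2)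

theorem isReal_datum (c : ℂ) : IsReal (datum c) := by
  have hae : ∀ S : SchwartzMap ℝ ℂ, ∀ k : ℤ, ∀ᵐ z ∂cylMeasure,
      mode k (S.toLp 2) z = fourier k z.1 * S z.2 := by
    intro S k
    have h2 := (Measure.quasiMeasurePreserving_snd
      (μ := AddCircle.haarAddCircle (T := 2 * Real.pi)) (ν := (volume : Measure ℝ))).ae
      (S.coeFn_toLp 2 volume)
    filter_upwards [(memLp_mode k (Lp.memLp (S.toLp 2))).coeFn_toLp, h2] with z h1 h2
    rw [mode, h1, h2]
  filter_upwards [Lp.coeFn_add (c • mode 1 ((𝓕⁻ bumpS).toLp 2))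
      ((starRingEnd ℂ) c • mode (-1) ((𝓕⁻ bumpS').toLp 2)),
    Lp.coeFn_smul c (mode 1 ((𝓕⁻ bumpS).toLp 2)),
    Lp.coeFn_smul ((starRingEnd ℂ) c) (mode (-1) ((𝓕⁻ bumpS').toLp 2)),
    hae (𝓕⁻ bumpS) 1, hae (𝓕⁻ bumpS') (-1)] with z h1 h2 h3 h4 h5
  rw [datum, h1, Pi.add_apply, h2, h3, Pi.smul_apply, Pi.smul_apply, h4, h5, fourier_neg,
    fourierInv_reflect_eq_conj (χ := bumpS) (χ' := bumpS') (fun η => by rw [bumpS_apply, Complex.conj_ofReal])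
      (fun η => rfl)]
  simp only [smul_eq_mul, Complex.add_im, Complex.mul_im, Complex.mul_re, Complex.conj_re,
    Complex.conj_im]
  ring

theorem coef_datum (c : ℂ) (k : ℤ) : coef k (datum c) =
    (if k = 1 then c • bumpS.toLp 2 volume else 0) +
      if k = -1 then (starRingEnd ℂ) c • bumpS'.toLp 2 volume else 0 := by
  rw [datum, map_add, map_smul, map_smul, coef_mode, coef_mode, SchwartzMap.toLp_fourier_eq,
    SchwartzMap.toLp_fourier_eq, fourier_fourierInv_eq, fourier_fourierInv_eq]
  simp only [smul_ite, smul_zero]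

theorem coef_datum_ae (c : ℂ) (k : ℤ) : ∀ᵐ η : ℝ, coef k (datum c) η =
    if k = 1 then c * (freqBump η : ℝ)
    else if k = -1 then (starRingEnd ℂ) c * (freqBump (-η) : ℝ) else 0 := by
  rw [coef_datum]
  by_cases h1 : k = 1
  · have h2 : k ≠ -1 := by omega
    rw [if_pos h1, if_neg h2, add_zero]
    filter_upwards [Lp.coeFn_smul c (bumpS.toLp 2 volume), bumpS.coeFn_toLp 2 volume] with η e1 e2
    rw [if_pos h1, e1, Pi.smul_apply, e2, smul_eq_mul, bumpS_apply]
  · by_cases h2 : k = -1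
    · rw [if_pos h2, if_neg h1, zero_add]
      filter_upwards [Lp.coeFn_smul ((starRingEnd ℂ) c) (bumpS'.toLp 2 volume),
        bumpS'.coeFn_toLp 2 volume] with η e1 e2
      rw [if_neg h1, if_pos h2, e1, Pi.smul_apply, e2, smul_eq_mul, bumpS'_apply]
    · rw [if_neg h1, if_neg h2, add_zero]
      filter_upwards [Lp.coeFn_zero ℂ 2 (volume : Measure ℝ)] with η e1
      rw [if_neg h1, if_neg h2, e1, Pi.zero_apply]

theorem FT_datum (c : ℂ) (k : ℤ) : ∀ᵐ ξ : ℝ, FT (datum c) k ξ =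
    if k = 1 then c * (freqBump (ξ / (2 * Real.pi)) : ℝ)
    else if k = -1 then (starRingEnd ℂ) c * (freqBump (-ξ / (2 * Real.pi)) : ℝ) else 0 := by
  filter_upwards [ae_comp_div_two_pi.2 (coef_datum_ae c k)] with ξ hξ
  rw [FT_eq_coef, hξ, neg_div]

theorem datum_one_ne_zero : datum 1 ≠ 0 := by
  intro h
  have h1 := coef_datum 1 1
  rw [h, map_zero, if_pos rfl, if_neg (by norm_num), add_zero, one_smul] at h1
  have h2 : (bumpS : SchwartzMap ℝ ℂ) = 0 := SchwartzMap.injective_toLp (F := ℂ) 2 volume (by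
    change bumpS.toLp 2 volume = (0 : SchwartzMap ℝ ℂ).toLp 2 volume
    rw [← h1]
    exact (map_zero (SchwartzMap.toLpCLM ℂ (E := ℝ) ℂ 2 volume)).symm)
  have h3 : bumpS (-(2 / (2 * Real.pi))) = 0 := by rw [h2]; rfl
  rw [bumpS_apply, freqBump.one_of_mem_closedBall (by
    simpa using freqBump.rIn_pos.le)] at h3
  simp at h3

theorem isSmooth_datum (c : ℂ) : IsSmooth (datum c) := by
  intro s
  have h := sobolevNorm_le_mul s (-s) (f := datum c) (g := datum c) (c := 11 ^ (|s| / 2))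
    (by positivity) fun k => by
      filter_upwards [FT_datum c k] with ξ hξ
      by_cases h0 : FT (datum c) k ξ = 0
      · rw [h0]; simp
      -- On the support `|k| = 1` and `|ξ| ≤ 3`, so all Sobolev weights are comparable to `1`.
      have hJ : 1 + (k : ℝ) ^ 2 + ξ ^ 2 ≤ 11 := by
        rw [hξ] at h0
        split_ifs at h0 with h1 h2
        · have h3 : -3 ≤ ξ ∧ ξ ≤ -1 := by
            by_contra h3
            rw [freqBump_eq_zero h3] at h0
            simp at h0
          rw [h1]
          push_cast
          nlinarith
        · have h3 : -3 ≤ -ξ ∧ -ξ ≤ -1 := by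
            by_contra h3
            rw [freqBump_eq_zero h3] at h0
            simp at h0
          rw [h2]
          push_cast
          nlinarith
        · exact absurd rfl h0
      set J := 1 + (k : ℝ) ^ 2 + ξ ^ 2 with hJdef
      have hJ1 : 1 ≤ J := by rw [hJdef]; nlinarith [sq_nonneg (k : ℝ), sq_nonneg ξ]
      have hJ0 : 0 < J := by linarith
      have h4 : 1 ≤ (11 : ℝ) ^ (|s| / 2) * J ^ (-s / 2) := by
        have h5 : J ^ (s / 2) ≤ 11 ^ (|s| / 2) :=
          calc J ^ (s / 2) ≤ J ^ (|s| / 2) :=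
                Real.rpow_le_rpow_of_exponent_le hJ1 (by linarith [le_abs_self s])
            _ ≤ _ := Real.rpow_le_rpow hJ0.le hJ (by positivity)
        rw [neg_div, Real.rpow_neg hJ0.le, ← div_eq_mul_inv, le_div_iff₀ (by positivity), one_mul]
        exact h5
      rw [← mul_assoc]
      exact le_mul_of_one_le_left (norm_nonneg _) h4
  rw [add_neg_cancel, sobolevNorm_zero_eq] at h
  refine h.trans_lt ?_
  finiteness

/-! ### Upper bounds in Sobolev spaces. -/

theorem exists_isMultiplier_symDx {θ₀ : L2} (h : sobolevNorm 2 θ₀ < ∞) :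
    ∃ q₀, IsMultiplier symDx θ₀ q₀ := by
  refine exists_FT_eq (F := fun k ξ => symDx k ξ * FT θ₀ k ξ) (fun k => ?_)
    (ne_top_of_le_ne_top (b := ∑' k : ℤ, ∫⁻ ξ : ℝ,
      ENNReal.ofReal ((1 + (k : ℝ) ^ 2 + ξ ^ 2) ^ (2 : ℝ)) * ‖FT θ₀ k ξ‖ₑ ^ 2) ?_ ?_)
  · exact aestronglyMeasurable_const.mul (aestronglyMeasurable_FT θ₀ k)
  · intro h2
    rw [sobolevNorm, h2, ENNReal.top_rpow_of_pos (by norm_num)] at h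
    exact lt_irrefl _ h
  · refine ENNReal.tsum_le_tsum fun k => lintegral_mono fun ξ => ?_
    dsimp only
    rw [← ofReal_norm, ← ofReal_norm, ← ENNReal.ofReal_pow (norm_nonneg _),
      ← ENNReal.ofReal_pow (norm_nonneg _), ← ENNReal.ofReal_mul (by positivity)]
    refine ENNReal.ofReal_le_ofReal ?_
    rw [norm_mul, mul_pow, norm_symDx, sq_abs]
    gcongr
    rw [Real.rpow_two]
    nlinarith [sq_nonneg (k : ℝ), sq_nonneg ξ, mul_nonneg (sq_nonneg (k : ℝ)) (sq_nonneg ξ)]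

theorem jap_le_sqrt {k : ℤ} (hk : k ≠ 0) (ξ : ℝ) :
    jap (-ξ / k) ≤ (1 + (k : ℝ) ^ 2 + ξ ^ 2) ^ (1 / 2 : ℝ) ∧
      jap (-ξ / k) * |(k : ℝ)| ≤ (1 + (k : ℝ) ^ 2 + ξ ^ 2) ^ (1 / 2 : ℝ) := by
  have hk1 := one_le_abs_intCast hk
  have hj := jap_pos (-ξ / k)
  have h : jap (-ξ / k) * |(k : ℝ)| ≤ (1 + (k : ℝ) ^ 2 + ξ ^ 2) ^ (1 / 2 : ℝ) := by
    rw [← Real.sqrt_eq_rpow]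
    refine Real.le_sqrt_of_sq_le ?_
    have h1 := sq_add_sq_eq hk 0 ξ
    rw [add_zero, mul_zero, sub_zero, ← jap_sq] at h1
    rw [mul_pow, sq_abs]
    linarith
  exact ⟨(le_mul_of_one_le_right hj.le hk1).trans h, h⟩

/-- The temperature costs just one derivative more than the vorticity: its extra factor `⟨ξ/k⟩ |k|`
is `√(k² + ξ²)`, so `∂_x` and the extra bracket are paid for together. -/
theorem exists_sobolevNorm_le (α : ℝ) {j : ℝ} (hj : 1 ≤ j) : ∃ C : ℝ, 0 < C ∧
    ∀ ω θ : ℝ → L2, HasModes α ω θ → ∀ (f : L2) (t : ℝ), 1 ≤ t → (∀ᵐ ξ : ℝ, FT f 0 ξ = 0) →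
      (∀ k : ℤ, k ≠ 0 → ∀ᵐ ξ : ℝ, ‖FT f k ξ‖ ≤
        (‖FT (ω t) k ξ‖ + jap (-ξ / k + t) * ‖Complex.I * k * FT (θ t) k ξ‖) *
          jap (-ξ / k + t) ^ (-j)) →
      ∀ s : ℝ, sobolevNorm s f ≤
        ENNReal.ofReal (C * logFactor α t * t ^ (1 / 2 + rate α - j)) *
          (sobolevNorm (s + max j (rate α - 1 / 2)) (ω 0) +
            sobolevNorm (s + max (j + 1) (rate α + 1 / 2)) (θ 0)) := by
  obtain ⟨C, hC, H⟩ := exists_decay_bound α hj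
  refine ⟨2 * C, by positivity, fun ω θ hm f t ht h0 hf s => ?_⟩
  have hL := one_le_logFactor α ht
  have ht0 : 0 < t := by linarith
  set m := max j (rate α - 1 / 2) with hmdef
  have hm0 : 0 ≤ m := (by linarith : (0 : ℝ) ≤ j).trans (le_max_left _ _)
  have hm1 : max (j + 1) (rate α + 1 / 2) = m + 1 := by
    rw [hmdef, ← max_add_add_right]
    congr 1
    ring
  rw [hm1, show 2 * C * logFactor α t * t ^ (1 / 2 + rate α - j) =
    2 * (C * logFactor α t * t ^ (1 / 2 + rate α - j)) by ring]
  refine sobolevNorm_le_add s m (m + 1) (by positivity) fun k => ?_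
  rcases eq_or_ne k 0 with rfl | hk
  · filter_upwards [h0] with ξ hξ
    rw [hξ, norm_zero]
    positivity
  filter_upwards [hf k hk, (hm t ht0.le).2 k hk] with ξ hξ ⟨u, v, huv, hu, hv, hut, hvt⟩
  have h1 := H u v huv (-ξ / k) t ht
  rw [hut, hvt, hu, hv] at h1
  refine (hξ.trans h1).trans ?_
  refine mul_le_mul_of_nonneg_left ?_ (by positivity)
  obtain ⟨hj1, hj2⟩ := jap_le_sqrt hk ξ
  have hjp := jap_pos (-ξ / k)
  set J := 1 + (k : ℝ) ^ 2 + ξ ^ 2 with hJ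
  have hJ0 : 0 < J := by positivity
  have e1 : jap (-ξ / k) ^ m ≤ J ^ (m / 2) := by
    refine (Real.rpow_le_rpow hjp.le hj1 hm0).trans_eq ?_
    rw [← Real.rpow_mul hJ0.le]
    congr 1
    ring
  have e2 : J ^ ((m + 1) / 2) = J ^ (m / 2) * J ^ (1 / 2 : ℝ) := by
    rw [← Real.rpow_add hJ0]
    congr 1
    ring
  rw [norm_mul, norm_mul, Complex.norm_I, one_mul, Complex.norm_intCast, e2, mul_add,
    ← mul_assoc (jap _), ← mul_assoc]
  gcongr

theorem IsSolution.FT_zero {α : ℝ} {ω θ w v : ℝ → L2} (h : IsSolution α ω θ w v) {t : ℝ}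
    (ht : 0 ≤ t) : (∀ᵐ ξ : ℝ, FT (w t) 0 ξ = 0) ∧ ∀ᵐ ξ : ℝ, FT (v t) 0 ξ = 0 := by
  constructor
  · filter_upwards [h.biotSavart₁ t ht 0, FT_fluct_zero (ω t)] with ξ h1 h2
    rw [h1, h2, mul_zero]
  · filter_upwards [h.biotSavart₂ t ht 0] with ξ h1
    rw [h1]
    simp [symDx]

theorem IsSolution.norm_FT {α : ℝ} {ω θ w v : ℝ → L2} (h : IsSolution α ω θ w v) {t : ℝ}
    (ht : 0 ≤ t) {k : ℤ} (hk : k ≠ 0) :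
    (∀ᵐ ξ : ℝ, ‖FT (w t) k ξ‖ =
      |-ξ / k + t| / (|(k : ℝ)| * jap (-ξ / k + t) ^ 2) * ‖FT (ω t) k ξ‖) ∧
    ∀ᵐ ξ : ℝ, ‖FT (v t) k ξ‖ = 1 / (|(k : ℝ)| * jap (-ξ / k + t) ^ 2) * ‖FT (ω t) k ξ‖ := by
  constructor
  · filter_upwards [h.biotSavart₁ t ht k] with ξ h1
    rw [h1, norm_mul, norm_symDy_div_symLap hk, FT_fluct_of_ne _ hk]
  · filter_upwards [h.biotSavart₂ t ht k] with ξ h1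
    rw [h1, norm_mul, norm_symDx_div_symLap hk]

theorem norm_FT_le_norm_I_mul (f : L2) {k : ℤ} (hk : k ≠ 0) (ξ : ℝ) :
    ‖FT f k ξ‖ ≤ ‖Complex.I * k * FT f k ξ‖ := by
  rw [norm_mul, norm_mul, Complex.norm_I, one_mul, Complex.norm_intCast]
  exact le_mul_of_one_le_left (norm_nonneg _) (one_le_abs_intCast hk)

theorem exists_upper_bound (α : ℝ) : ∃ C : ℝ, 0 < C ∧ ∀ ω θ w₁ v₂ : ℝ → L2,
    IsSolution α ω θ w₁ v₂ → ∀ (s t : ℝ), 1 ≤ t →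
      sobolevNorm s (fluct (θ t)) ≤
        ENNReal.ofReal (C * logFactor α t * t ^ (-1 / 2 + rate α)) *
          (sobolevNorm (s + max 1 (rate α - 1 / 2)) (ω 0) +
            sobolevNorm (s + max 2 (rate α + 1 / 2)) (θ 0)) ∧
      sobolevNorm s (w₁ t) ≤
        ENNReal.ofReal (C * logFactor α t * t ^ (-1 / 2 + rate α)) *
          (sobolevNorm (s + max 1 (rate α - 1 / 2)) (ω 0) +
            sobolevNorm (s + max 2 (rate α + 1 / 2)) (θ 0)) ∧
      sobolevNorm s (v₂ t) ≤
        ENNReal.ofReal (C * logFactor α t * t ^ (-3 / 2 + rate α)) *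
          (sobolevNorm (s + max 2 (rate α - 1 / 2)) (ω 0) +
            sobolevNorm (s + max 3 (rate α + 1 / 2)) (θ 0)) := by
  obtain ⟨C, hC, H⟩ := exists_sobolevNorm_le α (j := 1) le_rfl
  obtain ⟨D, hD, H'⟩ := exists_sobolevNorm_le α (j := 2) (by norm_num)
  refine ⟨C + D, by positivity, fun ω θ w₁ v₂ h s t ht => ?_⟩
  have ht0 : 0 ≤ t := by linarith
  have hL := one_le_logFactor α ht
  rw [show (1 : ℝ) + 1 = 2 by norm_num, show 1 / 2 + rate α - 1 = -1 / 2 + rate α by ring] at H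
  rw [show (2 : ℝ) + 1 = 3 by norm_num, show 1 / 2 + rate α - 2 = -3 / 2 + rate α by ring] at H'
  refine ⟨(H ω θ h.hasModes _ t ht (FT_fluct_zero _) (fun k hk => ?_) s).trans ?_,
    (H ω θ h.hasModes _ t ht (h.FT_zero ht0).1 (fun k hk => ?_) s).trans ?_,
    (H' ω θ h.hasModes _ t ht (h.FT_zero ht0).2 (fun k hk => ?_) s).trans ?_⟩
  · refine ae_of_all _ fun ξ => ?_
    have hj := jap_pos (-ξ / k + t)
    rw [FT_fluct_of_ne _ hk, Real.rpow_neg_one, ← div_eq_mul_inv, le_div_iff₀ hj, mul_comm]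
    have := mul_le_mul_of_nonneg_left (norm_FT_le_norm_I_mul (θ t) hk ξ) hj.le
    linarith [norm_nonneg (FT (ω t) k ξ)]
  · gcongr
    linarith
  · filter_upwards [(h.norm_FT ht0 hk).1] with ξ hξ
    have hj := jap_pos (-ξ / k + t)
    have hk1 := one_le_abs_intCast hk
    rw [hξ, Real.rpow_neg_one, ← div_eq_mul_inv, le_div_iff₀ hj]
    have h1 : |-ξ / k + t| / (|(k : ℝ)| * jap (-ξ / k + t) ^ 2) * jap (-ξ / k + t) ≤ 1 := by
      rw [div_mul_eq_mul_div, div_le_one (by positivity)]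
      have := abs_le_jap (-ξ / k + t)
      calc |-ξ / k + t| * jap (-ξ / k + t) ≤ jap (-ξ / k + t) * jap (-ξ / k + t) := by gcongr
        _ = 1 * jap (-ξ / k + t) ^ 2 := by ring
        _ ≤ _ := by gcongr
    have h2 := mul_le_mul_of_nonneg_right h1 (norm_nonneg (FT (ω t) k ξ))
    have h3 : 0 ≤ jap (-ξ / k + t) * ‖Complex.I * k * FT (θ t) k ξ‖ := by positivity
    linarith
  · gcongr
    linarith
  · filter_upwards [(h.norm_FT ht0 hk).2] with ξ hξ
    have hj := jap_pos (-ξ / k + t)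
    have hk1 := one_le_abs_intCast hk
    rw [hξ, Real.rpow_neg hj.le, Real.rpow_two, ← div_eq_mul_inv, le_div_iff₀ (by positivity)]
    have h1 : 1 / (|(k : ℝ)| * jap (-ξ / k + t) ^ 2) * jap (-ξ / k + t) ^ 2 ≤ 1 := by
      rw [div_mul_eq_mul_div, div_le_one (by positivity)]
      gcongr
    have h2 := mul_le_mul_of_nonneg_right h1 (norm_nonneg (FT (ω t) k ξ))
    have h3 : 0 ≤ jap (-ξ / k + t) * ‖Complex.I * k * FT (θ t) k ξ‖ := by positivity
    linarith
  · gcongr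
    linarith

/-- Instability requires finite norms from `t = 0` on, which the decay bounds for `t ≥ 1` do not
cover; the exponential mode bound does. -/
theorem IsSolution.sobolevNorm_lt_top {α : ℝ} {ω θ w v : ℝ → L2} (h : IsSolution α ω θ w v)
    (hω : IsSmooth (ω 0)) (hθ : IsSmooth (θ 0)) {t : ℝ} (ht : 0 ≤ t) (s : ℝ) :
    sobolevNorm s (ω t) < ∞ ∧ sobolevNorm s (fluct (θ t)) < ∞ ∧ sobolevNorm s (w t) < ∞ ∧
      sobolevNorm s (v t) < ∞ := by
  have key : ∀ f : L2, (∀ᵐ ξ : ℝ, ‖FT f 0 ξ‖ ≤ ‖FT (ω 0) 0 ξ‖) →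
      (∀ k : ℤ, k ≠ 0 → ∀ᵐ ξ : ℝ,
        ‖FT f k ξ‖ ≤ ‖FT (ω t) k ξ‖ + ‖Complex.I * k * FT (θ t) k ξ‖) → sobolevNorm s f < ∞ := by
    intro f h0 hf
    have h1 := sobolevNorm_le_add s 0 1 (f := f) (g := ω 0) (h := θ 0)
      (c := 2 * Real.exp ((1 + |α|) * t)) (by positivity) fun k => by
        rcases eq_or_ne k 0 with rfl | hk
        · filter_upwards [h0] with ξ hξ
          rw [zero_div, Real.rpow_zero, one_mul]
          have h2 : 1 ≤ 2 * Real.exp ((1 + |α|) * t) := by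
            linarith [Real.one_le_exp (x := (1 + |α|) * t) (by positivity)]
          refine hξ.trans ((le_mul_of_one_le_left (norm_nonneg _) h2).trans ?_)
          gcongr
          exact le_add_of_nonneg_right (by positivity)
        · filter_upwards [hf k hk, (h.hasModes t ht).2 k hk] with
            ξ hξ ⟨u, v, huv, hu, hv, hut, hvt⟩
          have h2 := huv.norm_le (le_add_of_nonneg_right (a := -ξ / k) ht)
          rw [hut, hvt, hu, hv, add_sub_cancel_left] at h2
          refine (hξ.trans h2).trans ?_
          rw [zero_div, Real.rpow_zero, one_mul, norm_mul (_ * _), norm_mul, Complex.norm_I,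
            one_mul, Complex.norm_intCast]
          have h3 : |(k : ℝ)| ≤ (1 + (k : ℝ) ^ 2 + ξ ^ 2) ^ (1 / 2 : ℝ) :=
            (le_mul_of_one_le_left (abs_nonneg _) (one_le_jap (-ξ / k))).trans (jap_le_sqrt hk ξ).2
          gcongr
    refine h1.trans_lt (ENNReal.mul_lt_top ENNReal.ofReal_lt_top (ENNReal.add_lt_top.2 ⟨hω _, hθ _⟩))
  have hz : ∀ f : L2, (∀ᵐ ξ : ℝ, FT f 0 ξ = 0) → ∀ᵐ ξ : ℝ, ‖FT f 0 ξ‖ ≤ ‖FT (ω 0) 0 ξ‖ :=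
    fun f hf => hf.mono fun ξ hξ => by
      rw [hξ, norm_zero]
      exact norm_nonneg _
  refine ⟨key _ ?_ fun k hk => ae_of_all _ fun ξ => le_add_of_nonneg_right (norm_nonneg _),
    key _ (hz _ (FT_fluct_zero _)) fun k hk => ae_of_all _ fun ξ => ?_,
    key _ (hz _ (h.FT_zero ht).1) fun k hk => ?_, key _ (hz _ (h.FT_zero ht).2) fun k hk => ?_⟩
  · filter_upwards [(h.hasModes t ht).1] with ξ hξ
    rw [hξ]
  · rw [FT_fluct_of_ne _ hk]
    exact (norm_FT_le_norm_I_mul _ hk ξ).trans (le_add_of_nonneg_left (norm_nonneg _))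
  · filter_upwards [h.biotSavart₁ t ht k] with ξ hξ
    rw [hξ, norm_mul, FT_fluct_of_ne _ hk]
    exact (mul_le_of_le_one_left (norm_nonneg _) (norm_symDy_div_symLap_le t hk ξ)).trans
      (le_add_of_nonneg_right (norm_nonneg _))
  · filter_upwards [h.biotSavart₂ t ht k] with ξ hξ
    rw [hξ, norm_mul]
    exact (mul_le_of_le_one_left (norm_nonneg _) (norm_symDx_div_symLap_le t k ξ)).trans
      (le_add_of_nonneg_right (norm_nonneg _))

/-! ### The growing solution. -/

theorem ofReal_mul_sobolevNorm_le (s : ℝ) {f g : L2} {c : ℝ} (hc : 0 < c)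
    (h : ∀ k : ℤ, ∀ᵐ ξ : ℝ, c * ‖FT g k ξ‖ ≤ ‖FT f k ξ‖) :
    ENNReal.ofReal c * sobolevNorm s g ≤ sobolevNorm s f := by
  have h1 := sobolevNorm_le_mul s 0 (f := g) (g := f) (c := c⁻¹) (by positivity) fun k => by
    filter_upwards [h k] with ξ hξ
    rw [zero_div, Real.rpow_zero, one_mul, inv_mul_eq_div, le_div_iff₀ hc, mul_comm]
    exact hξ
  rw [add_zero] at h1
  calc ENNReal.ofReal c * sobolevNorm s g
      ≤ ENNReal.ofReal c * (ENNReal.ofReal c⁻¹ * sobolevNorm s f) := by gcongr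
    _ = sobolevNorm s f := by
      rw [← mul_assoc, ← ENNReal.ofReal_mul hc.le, mul_inv_cancel₀ hc.ne', ENNReal.ofReal_one,
        one_mul]

/-- Dividing `β` by `i` makes `∂_x θ₀` equal to `β ω₀` at `k = 1` and to its conjugate multiple at
`k = -1`. The support of the bump places every starting point in `[1, 3]`. -/
theorem FT_datum_pair (β : ℂ) (k : ℤ) : ∀ᵐ ξ : ℝ,
    (FT (datum 1) k ξ = 0 ∧ FT (datum (β / Complex.I)) k ξ = 0) ∨
    (k ≠ 0 ∧ |(k : ℝ)| = 1 ∧ 1 ≤ -ξ / k ∧ -ξ / k ≤ 3 ∧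
      (Complex.I * k * FT (datum (β / Complex.I)) k ξ = β * FT (datum 1) k ξ ∨
        Complex.I * k * FT (datum (β / Complex.I)) k ξ =
          (starRingEnd ℂ) β * FT (datum 1) k ξ)) := by
  filter_upwards [FT_datum 1 k, FT_datum (β / Complex.I) k] with ξ h1 h2
  rw [h1, h2]
  have hI := Complex.I_ne_zero
  by_cases hk1 : k = 1
  · subst hk1
    rw [if_pos rfl, if_pos rfl]
    by_cases h3 : -3 ≤ ξ ∧ ξ ≤ -1
    · refine Or.inr ⟨one_ne_zero, by simp, ?_, ?_, Or.inl ?_⟩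
      · rw [Int.cast_one, div_one]; linarith
      · rw [Int.cast_one, div_one]; linarith
      · push_cast
        field_simp
    · left
      rw [freqBump_eq_zero h3]
      simp
  · by_cases hk2 : k = -1
    · subst hk2
      rw [if_neg hk1, if_neg hk1, if_pos rfl, if_pos rfl]
      by_cases h3 : -3 ≤ -ξ ∧ -ξ ≤ -1
      · refine Or.inr ⟨by norm_num, by simp, ?_, ?_, Or.inr ?_⟩
        · rw [Int.cast_neg, Int.cast_one, neg_div_neg_eq, div_one]; linarith
        · rw [Int.cast_neg, Int.cast_one, neg_div_neg_eq, div_one]; linarith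
        · rw [map_div₀, Complex.conj_I, map_one]
          push_cast
          field_simp
      · left
        rw [freqBump_eq_zero h3]
        simp
    · left
      rw [if_neg hk1, if_neg hk2, if_neg hk1, if_neg hk2]
      exact ⟨rfl, rfl⟩

theorem exists_growing_solution (α : ℝ) :
    ∃ (C : ℝ) (ω θ w₁ v₂ : ℝ → L2) (q₀ : L2), 0 < C ∧ IsSolution α ω θ w₁ v₂ ∧
      IsReal (ω 0) ∧ IsReal (θ 0) ∧ IsSmooth (ω 0) ∧ IsSmooth (θ 0) ∧
      IsMultiplier symDx (θ 0) q₀ ∧ ω 0 ≠ 0 ∧ ∀ (s t : ℝ), 1 ≤ t →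
        ENNReal.ofReal (C * t ^ (1 / 2 + rate α)) *
            (sobolevNorm s (ω 0) + sobolevNorm s q₀) ≤ sobolevNorm s (ω t) ∧
        ENNReal.ofReal (C * t ^ (-1 / 2 + rate α)) *
            (sobolevNorm s (ω 0) + sobolevNorm s q₀) ≤ sobolevNorm s (fluct (θ t)) ∧
        ENNReal.ofReal (C * t ^ (-1 / 2 + rate α)) *
            (sobolevNorm s (ω 0) + sobolevNorm s q₀) ≤ sobolevNorm s (w₁ t) ∧
        ENNReal.ofReal (C * t ^ (-3 / 2 + rate α)) *
            (sobolevNorm s (ω 0) + sobolevNorm s q₀) ≤ sobolevNorm s (v₂ t) := by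
  obtain ⟨c, hc, H⟩ := exists_lower_bound α
  set β := growthSlope α with hβ
  obtain ⟨q₀, hq₀⟩ := exists_isMultiplier_symDx (isSmooth_datum (β / Complex.I) 2)
  obtain ⟨ω, θ, w, v, hS, hω, hθ, hm⟩ := exists_isSolution (ω₀ := datum 1) α hq₀
  -- `1 + ‖β‖` accounts for `∂_x θ₀` on the data side; `32` is a safe constant in `1 + (a+t)² ≤ 32
  -- t²`, valid for `1 ≤ a ≤ 3` and `t ≥ 1`.
  refine ⟨c / (32 * (1 + ‖β‖)), ω, θ, w, v, q₀, by positivity, hS, ?_⟩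
  rw [hω, hθ]
  refine ⟨isReal_datum 1, isReal_datum _, isSmooth_datum 1, isSmooth_datum _, hq₀,
    datum_one_ne_zero, fun s t ht => ?_⟩
  have ht0 : 0 < t := by linarith
  have hsum : sobolevNorm s (datum 1) + sobolevNorm s q₀ ≤
      ENNReal.ofReal (1 + ‖β‖) * sobolevNorm s (datum 1) := by
    have h1 := sobolevNorm_le_mul s 0 (f := q₀) (g := datum 1) (c := ‖β‖) (norm_nonneg _)
      fun k => by
        filter_upwards [FT_datum_pair β k, hq₀ k] with ξ h1 h2
        rw [zero_div, Real.rpow_zero, one_mul, h2, symDx]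
        rcases h1 with ⟨h3, h4⟩ | ⟨-, -, -, -, h3 | h3⟩
        · rw [h4, mul_zero, norm_zero]
          positivity
        · rw [h3, norm_mul]
        · rw [h3, norm_mul, Complex.norm_conj]
    rw [add_zero] at h1
    rw [ENNReal.ofReal_add zero_le_one (norm_nonneg _), ENNReal.ofReal_one, add_mul, one_mul]
    gcongr
  have key : ∀ (f : L2) (x : ℝ), 0 < x →
      (∀ k : ℤ, ∀ᵐ ξ : ℝ, c / 32 * x * ‖FT (datum 1) k ξ‖ ≤ ‖FT f k ξ‖) →
      ENNReal.ofReal (c / (32 * (1 + ‖β‖)) * x) * (sobolevNorm s (datum 1) + sobolevNorm s q₀) ≤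
        sobolevNorm s f := by
    intro f x hx hf
    refine le_trans ?_ (ofReal_mul_sobolevNorm_le s (by positivity) hf)
    refine (mul_le_mul_right hsum _).trans_eq ?_
    rw [← mul_assoc, ← ENNReal.ofReal_mul (by positivity)]
    congr 2
    field_simp
  have modes : ∀ k : ℤ, ∀ᵐ ξ : ℝ, FT (datum 1) k ξ = 0 ∨
      (k ≠ 0 ∧ |(k : ℝ)| = 1 ∧ 1 ≤ -ξ / k ∧ -ξ / k ≤ 3 ∧
        c * t ^ (1 / 2 + rate α) * ‖FT (datum 1) k ξ‖ ≤ ‖FT (ω t) k ξ‖ ∧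
        c * t ^ (rate α - 1 / 2) * ‖FT (datum 1) k ξ‖ ≤ ‖FT (θ t) k ξ‖) := by
    intro k
    by_cases hk : k = 0
    · filter_upwards [FT_datum_pair β k] with ξ h1
      rcases h1 with h1 | h1
      · exact Or.inl h1.1
      · exact absurd hk h1.1
    · filter_upwards [FT_datum_pair β k, (hm t ht0.le).2 k hk] with
        ξ h1 ⟨u, v, huv, hu, hv, hut, hvt⟩
      rcases h1 with h1 | ⟨h1, h2, h3, h4, h5⟩
      · exact Or.inl h1.1
      · rw [hω] at hu
        rw [hθ] at hv
        have h6 := H u v huv (-ξ / k) _ h3 h4 hu (by rwa [hv]) t ht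
        rw [hut, hvt, norm_mul (_ * _), norm_mul, Complex.norm_I, one_mul, Complex.norm_intCast,
          h2, one_mul] at h6
        exact Or.inr ⟨h1, h2, h3, h4, h6⟩
  have hle : ∀ x : ℝ, 0 ≤ x → c / 32 * x ≤ c * x := fun x hx => by
    have : c / 32 ≤ c := by linarith
    gcongr
  have e1 : t ^ (1 / 2 + rate α) = t ^ (-1 / 2 + rate α) * t := by
    rw [← Real.rpow_add_one ht0.ne']
    congr 1
    ring
  have e2 : t ^ (1 / 2 + rate α) = t ^ (-3 / 2 + rate α) * t ^ 2 := by
    rw [← Real.rpow_natCast t 2, ← Real.rpow_add ht0]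
    congr 1
    push_cast
    ring
  refine ⟨key _ _ (by positivity) fun k => ?_, key _ _ (by positivity) fun k => ?_,
    key _ _ (by positivity) fun k => ?_, key _ _ (by positivity) fun k => ?_⟩
  · filter_upwards [modes k] with ξ hξ
    rcases hξ with hξ | ⟨h1, h2, h3, h4, h5, h6⟩
    · rw [hξ, norm_zero, mul_zero]
      exact norm_nonneg _
    · exact (mul_le_mul_of_nonneg_right (hle _ (by positivity)) (norm_nonneg _)).trans h5
  · filter_upwards [modes k] with ξ hξ
    rcases hξ with hξ | ⟨h1, h2, h3, h4, h5, h6⟩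
    · rw [hξ, norm_zero, mul_zero]
      exact norm_nonneg _
    · rw [FT_fluct_of_ne _ h1, show -1 / 2 + rate α = rate α - 1 / 2 by ring]
      exact (mul_le_mul_of_nonneg_right (hle _ (by positivity)) (norm_nonneg _)).trans h6
  · by_cases hk : k = 0
    · filter_upwards [modes k] with ξ hξ
      rcases hξ with hξ | hξ
      · rw [hξ, norm_zero, mul_zero]
        exact norm_nonneg _
      · exact absurd hk hξ.1
    filter_upwards [modes k, (hS.norm_FT ht0.le hk).1] with ξ hξ hw
    rcases hξ with hξ | ⟨h1, h2, h3, h4, h5, h6⟩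
    · rw [hξ, norm_zero, mul_zero]
      exact norm_nonneg _
    · rw [hw, h2, one_mul, jap_sq, abs_of_pos (by linarith)]
      set a := -ξ / k with ha
      calc c / 32 * t ^ (-1 / 2 + rate α) * ‖FT (datum 1) k ξ‖
          = 1 / (32 * t) * (c * t ^ (1 / 2 + rate α) * ‖FT (datum 1) k ξ‖) := by
            rw [e1]
            field_simp
        _ ≤ (a + t) / (1 + (a + t) ^ 2) * ‖FT (ω t) k ξ‖ := by
            have h7 : 1 / (32 * t) ≤ (a + t) / (1 + (a + t) ^ 2) := by
              rw [div_le_div_iff₀ (by positivity) (by positivity)]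
              nlinarith
            exact mul_le_mul h7 h5 (by positivity) (h7.trans' (by positivity))
  · by_cases hk : k = 0
    · filter_upwards [modes k] with ξ hξ
      rcases hξ with hξ | hξ
      · rw [hξ, norm_zero, mul_zero]
        exact norm_nonneg _
      · exact absurd hk hξ.1
    filter_upwards [modes k, (hS.norm_FT ht0.le hk).2] with ξ hξ hw
    rcases hξ with hξ | ⟨h1, h2, h3, h4, h5, h6⟩
    · rw [hξ, norm_zero, mul_zero]
      exact norm_nonneg _
    · rw [hw, h2, one_mul, jap_sq]
      set a := -ξ / k with ha
      calc c / 32 * t ^ (-3 / 2 + rate α) * ‖FT (datum 1) k ξ‖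
          = 1 / (32 * t ^ 2) * (c * t ^ (1 / 2 + rate α) * ‖FT (datum 1) k ξ‖) := by
            rw [e2]
            field_simp
        _ ≤ 1 / (1 + (a + t) ^ 2) * ‖FT (ω t) k ξ‖ := by
            gcongr
            nlinarith

/-! ### Passage to the limit in time. -/

theorem tendsto_logFactor_mul_rpow (α : ℝ) {C p : ℝ} (hp : p < 0) :
    Tendsto (fun t : ℝ => C * logFactor α t * t ^ p) atTop (𝓝 0) := by
  have h1 : Tendsto (fun t : ℝ => t ^ p) atTop (𝓝 0) := by
    simpa using tendsto_rpow_neg_atTop (neg_pos.2 hp)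
  have h2 : Tendsto (fun t : ℝ => Real.log t * t ^ p) atTop (𝓝 0) := by
    have := (isLittleO_log_rpow_atTop (neg_pos.2 hp)).tendsto_div_nhds_zero
    refine this.congr' ?_
    filter_upwards [eventually_gt_atTop 0] with t ht
    rw [Real.rpow_neg ht.le, div_inv_eq_mul]
  by_cases hα : α = 1 / 4
  · simp only [logFactor, if_pos hα]
    have := ((h1.add h2).const_mul C)
    rw [add_zero, mul_zero] at this
    refine this.congr fun t => by ring
  · simp only [logFactor, if_neg hα, mul_one]
    simpa using h1.const_mul C

theorem tendsto_zero_of_le {α C p : ℝ} (hp : p < 0) {f : ℝ → ℝ≥0∞} {D : ℝ≥0∞} (hD : D < ∞)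
    (h : ∀ t, 1 ≤ t → f t ≤ ENNReal.ofReal (C * logFactor α t * t ^ p) * D) :
    Tendsto f atTop (𝓝 0) := by
  have h1 := ENNReal.Tendsto.mul_const (b := D)
    (ENNReal.tendsto_ofReal (tendsto_logFactor_mul_rpow α (C := C) hp)) (Or.inr hD.ne)
  rw [ENNReal.ofReal_zero, zero_mul] at h1
  refine tendsto_of_tendsto_of_tendsto_of_le_of_le' tendsto_const_nhds h1
    (Eventually.of_forall fun _ => zero_le) ?_
  filter_upwards [eventually_ge_atTop 1] with t ht using h t ht

theorem tendsto_top_of_le {C p : ℝ} (hC : 0 < C) (hp : 0 < p) {f : ℝ → ℝ≥0∞} {D : ℝ≥0∞}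
    (hD : D ≠ 0) (h : ∀ t, 1 ≤ t → ENNReal.ofReal (C * t ^ p) * D ≤ f t) :
    Tendsto f atTop (𝓝 ∞) := by
  have h1 := ENNReal.Tendsto.mul_const (b := D) (ENNReal.tendsto_ofReal_atTop.comp
    ((tendsto_rpow_atTop hp).const_mul_atTop hC)) (Or.inl ENNReal.top_ne_zero)
  rw [ENNReal.top_mul hD] at h1
  refine tendsto_of_tendsto_of_tendsto_of_le_of_le' h1 tendsto_const_nhds ?_
    (Eventually.of_forall fun _ => le_top)
  filter_upwards [eventually_ge_atTop 1] with t ht using h t ht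

/-- The value `p = 0` is allowed so as to include the borderline cases `α = 0` and `α = -2`, where
the norm need not blow up but stays away from `0`. -/
theorem not_tendsto_zero_of_le {C p : ℝ} (hC : 0 < C) (hp : 0 ≤ p) {f : ℝ → ℝ≥0∞} {D : ℝ≥0∞}
    (hD : D ≠ 0) (h : ∀ t, 1 ≤ t → ENNReal.ofReal (C * t ^ p) * D ≤ f t) :
    ¬Tendsto f atTop (𝓝 0) := by
  intro hf
  have h1 : ENNReal.ofReal C * D ≤ 0 := by
    refine ge_of_tendsto hf ?_
    filter_upwards [eventually_ge_atTop 1] with t ht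
    refine le_trans ?_ (h t ht)
    gcongr
    exact le_mul_of_one_le_right hC.le (Real.one_le_rpow ht hp)
  rw [nonpos_iff_eq_zero, mul_eq_zero, ENNReal.ofReal_eq_zero, not_le.2 hC |> iff_false_intro] at h1
  exact hD (h1.resolve_left id)

theorem half_lt_rate {α : ℝ} (hα : α < 0) : 1 / 2 < rate α := by
  have h := rate_sq_of_le (α := α) (by linarith)
  nlinarith [rate_nonneg α]

theorem three_halves_lt_rate {α : ℝ} (hα : α < -2) : 3 / 2 < rate α := by
  have h := rate_sq_of_le (α := α) (by linarith)
  nlinarith [rate_nonneg α]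

end

end Boussinesq

/-! ### Assembly of the theorem. -/

theorem mainTheorem4 (α : ℝ) :
    -- solvability of the linearized problem
    (∀ ω₀ θ₀ : Boussinesq.L2, Boussinesq.sobolevNorm 1 ω₀ < ∞ → Boussinesq.sobolevNorm 2 θ₀ < ∞ →
      ∃ ω θ w₁ v₂ : ℝ → Boussinesq.L2,
        Boussinesq.IsSolution α ω θ w₁ v₂ ∧ ω 0 = ω₀ ∧ θ 0 = θ₀) ∧
    -- upper bounds
    (∃ C : ℝ, 0 < C ∧ ∀ ω θ w₁ v₂ : ℝ → Boussinesq.L2, Boussinesq.IsSolution α ω θ w₁ v₂ →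
      ∀ (N : ℕ) (t : ℝ), 1 ≤ t →
        Boussinesq.sobolevNorm N (Boussinesq.fluct (θ t)) ≤
          ENNReal.ofReal (C * Boussinesq.logFactor α t * t ^ (-1 / 2 + Boussinesq.rate α)) *
            (Boussinesq.sobolevNorm (N + max 1 (Boussinesq.rate α - 1 / 2)) (ω 0) +
              Boussinesq.sobolevNorm (N + max 2 (Boussinesq.rate α + 1 / 2)) (θ 0)) ∧
        Boussinesq.sobolevNorm N (w₁ t) ≤
          ENNReal.ofReal (C * Boussinesq.logFactor α t * t ^ (-1 / 2 + Boussinesq.rate α)) *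
            (Boussinesq.sobolevNorm (N + max 1 (Boussinesq.rate α - 1 / 2)) (ω 0) +
              Boussinesq.sobolevNorm (N + max 2 (Boussinesq.rate α + 1 / 2)) (θ 0)) ∧
        Boussinesq.sobolevNorm N (v₂ t) ≤
          ENNReal.ofReal (C * Boussinesq.logFactor α t * t ^ (-3 / 2 + Boussinesq.rate α)) *
            (Boussinesq.sobolevNorm (N + max 2 (Boussinesq.rate α - 1 / 2)) (ω 0) +
              Boussinesq.sobolevNorm (N + max 3 (Boussinesq.rate α + 1 / 2)) (θ 0))) ∧
    -- lower bounds: growth of the vorticity, and sharpness of the rates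
    (∃ (C T : ℝ) (ω θ w₁ v₂ : ℝ → Boussinesq.L2) (q₀ : Boussinesq.L2), 0 < C ∧ 1 ≤ T ∧
      Boussinesq.IsSolution α ω θ w₁ v₂ ∧
      Boussinesq.IsReal (ω 0) ∧ Boussinesq.IsReal (θ 0) ∧
      Boussinesq.IsSmooth (ω 0) ∧ Boussinesq.IsSmooth (θ 0) ∧
      Boussinesq.IsMultiplier Boussinesq.symDx (θ 0) q₀ ∧ (ω 0 ≠ 0 ∨ q₀ ≠ 0) ∧
      ∀ (N : ℕ) (t : ℝ), T ≤ t →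
        ENNReal.ofReal (C * t ^ (1 / 2 + Boussinesq.rate α)) *
            (Boussinesq.sobolevNorm N (ω 0) + Boussinesq.sobolevNorm N q₀) ≤
          Boussinesq.sobolevNorm N (ω t) ∧
        ENNReal.ofReal (C * t ^ (-1 / 2 + Boussinesq.rate α)) *
            (Boussinesq.sobolevNorm N (ω 0) + Boussinesq.sobolevNorm N q₀) ≤
          Boussinesq.sobolevNorm N (Boussinesq.fluct (θ t)) ∧
        ENNReal.ofReal (C * t ^ (-1 / 2 + Boussinesq.rate α)) *
            (Boussinesq.sobolevNorm N (ω 0) + Boussinesq.sobolevNorm N q₀) ≤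
          Boussinesq.sobolevNorm N (w₁ t) ∧
        ENNReal.ofReal (C * t ^ (-3 / 2 + Boussinesq.rate α)) *
            (Boussinesq.sobolevNorm N (ω 0) + Boussinesq.sobolevNorm N q₀) ≤
          Boussinesq.sobolevNorm N (v₂ t)) ∧
    -- thresholds for stability
    (0 < α ↔ Boussinesq.rate α < 1 / 2) ∧
    (-2 < α ↔ Boussinesq.rate α < 3 / 2) ∧
    (∀ N : ℕ, Boussinesq.Stable α Boussinesq.tempFluct N (N + 1) (N + 2) ↔ 0 < α) ∧
    (∀ N : ℕ, Boussinesq.Stable α Boussinesq.horVelFluct N (N + 1) (N + 2) ↔ 0 < α) ∧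
    (∀ N : ℕ, Boussinesq.Stable α Boussinesq.vertVel N (N + 2) (N + 3) ↔ -2 < α) ∧
    -- instability
    (α < 0 → Boussinesq.Unstable α Boussinesq.tempFluct) ∧
    (α < 0 → Boussinesq.Unstable α Boussinesq.horVelFluct) ∧
    (α < -2 → Boussinesq.Unstable α Boussinesq.vertVel) ∧
    Boussinesq.Unstable α Boussinesq.vort := by
  obtain ⟨C, ω, θ, w₁, v₂, q₀, hC, hS, hωr, hθr, hωs, hθs, hq₀, hne, hlow⟩ :=
    Boussinesq.exists_growing_solution α
  obtain ⟨D, hD, hup⟩ := Boussinesq.exists_upper_bound α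
  have hr0 := Boussinesq.rate_nonneg α
  have hhalf := Boussinesq.rate_lt_half_iff α
  have hthree := Boussinesq.rate_lt_three_halves_iff α
  have hdata : ∀ s : ℝ, Boussinesq.sobolevNorm s (ω 0) + Boussinesq.sobolevNorm s q₀ ≠ 0 :=
    fun s h => hne (Boussinesq.sobolevNorm_eq_zero (add_eq_zero.1 h).1)
  have hfin := fun (N : ℕ) (t : ℝ) (ht : 0 ≤ t) => hS.sobolevNorm_lt_top hωs hθs ht N
  refine ⟨fun ω₀ θ₀ _ hθ₀ => ?_, ⟨D, hD, fun ω θ w₁ v₂ h N t ht => hup ω θ w₁ v₂ h N t ht⟩,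
    ⟨C, 1, ω, θ, w₁, v₂, q₀, hC, le_rfl, hS, hωr, hθr, hωs, hθs, hq₀, Or.inl hne,
      fun N t ht => hlow N t ht⟩, hhalf, hthree, fun N => ⟨fun h => ?_, fun hα => ?_⟩,
    fun N => ⟨fun h => ?_, fun hα => ?_⟩, fun N => ⟨fun h => ?_, fun hα => ?_⟩, fun hα => ?_,
    fun hα => ?_, fun hα => ?_, ?_⟩
  · obtain ⟨q, hq⟩ := Boussinesq.exists_isMultiplier_symDx hθ₀
    obtain ⟨ω, θ, w, v, h, hω, hθ, -⟩ := Boussinesq.exists_isSolution (ω₀ := ω₀) α hq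
    exact ⟨ω, θ, w, v, h, hω, hθ⟩
  · by_contra hα
    rw [hhalf, not_lt] at hα
    exact Boussinesq.not_tendsto_zero_of_le hC (by linarith) (hdata N)
      (fun t ht => (hlow N t ht).2.1) (h ω θ w₁ v₂ hS (hωs _) (hθs _))
  · intro ω θ w₁ v₂ h hω hθ
    rw [hhalf] at hα
    refine Boussinesq.tendsto_zero_of_le (α := α) (C := D) (p := -1 / 2 + Boussinesq.rate α)
      (by linarith) (ENNReal.add_lt_top.2 ⟨hω, hθ⟩) fun t ht => ?_
    have := (hup ω θ w₁ v₂ h N t ht).1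
    -- In the stable range `c` is below the threshold, so the maxima reduce to the integer losses of
    -- derivatives.
    rwa [max_eq_left (by linarith), max_eq_left (by linarith)] at this
  · by_contra hα
    rw [hhalf, not_lt] at hα
    exact Boussinesq.not_tendsto_zero_of_le hC (by linarith) (hdata N)
      (fun t ht => (hlow N t ht).2.2.1) (h ω θ w₁ v₂ hS (hωs _) (hθs _))
  · intro ω θ w₁ v₂ h hω hθ
    rw [hhalf] at hα
    refine Boussinesq.tendsto_zero_of_le (α := α) (C := D) (p := -1 / 2 + Boussinesq.rate α)
      (by linarith) (ENNReal.add_lt_top.2 ⟨hω, hθ⟩) fun t ht => ?_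
    have := (hup ω θ w₁ v₂ h N t ht).2.1
    rwa [max_eq_left (by linarith), max_eq_left (by linarith)] at this
  · by_contra hα
    rw [hthree, not_lt] at hα
    exact Boussinesq.not_tendsto_zero_of_le hC (by linarith) (hdata N)
      (fun t ht => (hlow N t ht).2.2.2) (h ω θ w₁ v₂ hS (hωs _) (hθs _))
  · intro ω θ w₁ v₂ h hω hθ
    rw [hthree] at hα
    refine Boussinesq.tendsto_zero_of_le (α := α) (C := D) (p := -3 / 2 + Boussinesq.rate α)
      (by linarith) (ENNReal.add_lt_top.2 ⟨hω, hθ⟩) fun t ht => ?_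
    have := (hup ω θ w₁ v₂ h N t ht).2.2
    rwa [max_eq_left (by linarith), max_eq_left (by linarith)] at this
  · have hp := Boussinesq.half_lt_rate hα
    exact ⟨ω, θ, w₁, v₂, hS, hωr, hθr, hωs, hθs, fun N => ⟨fun t ht => (hfin N t ht).2.1,
      Boussinesq.tendsto_top_of_le hC (by linarith) (hdata N) fun t ht => (hlow N t ht).2.1⟩⟩
  · have hp := Boussinesq.half_lt_rate hα
    exact ⟨ω, θ, w₁, v₂, hS, hωr, hθr, hωs, hθs, fun N => ⟨fun t ht => (hfin N t ht).2.2.1,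
      Boussinesq.tendsto_top_of_le hC (by linarith) (hdata N) fun t ht => (hlow N t ht).2.2.1⟩⟩
  · have hp := Boussinesq.three_halves_lt_rate hα
    exact ⟨ω, θ, w₁, v₂, hS, hωr, hθr, hωs, hθs, fun N => ⟨fun t ht => (hfin N t ht).2.2.2,
      Boussinesq.tendsto_top_of_le hC (by linarith) (hdata N) fun t ht => (hlow N t ht).2.2.2⟩⟩
  · exact ⟨ω, θ, w₁, v₂, hS, hωr, hθr, hωs, hθs, fun N => ⟨fun t ht => (hfin N t ht).1,
      Boussinesq.tendsto_top_of_le hC (by linarith) (hdata N) fun t ht => (hlow N t ht).1⟩⟩
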